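/- All function spaces are spaces of complex-valued functions, and $W^1_2(a,b)=\{u\in L_2(a,b): u'\in L_2(a,b)\}$ with the weak derivative $u'$. For $\sigma\in L_2(0,1)$ let $\widetilde T_\sigma$ be the operator in $L_2(0,1)$ given by $\widetilde T_\sigma y=-(y^{[1]})'-\sigma y'$, where $y^{[1]}:=y'-\sigma y$, on the domain of all $y\in W^1_1(0,1)$ such that $y^{[1]}\in W^1_1(0,1)$, $-(y^{[1]})'-\sigma y'\in L_2(0,1)$ and $y^{[1]}(0)=0$. Let $K_\sigma$ be the Hilbert–Schmidt operator in $L_2(0,1)$ of the form $(K_\sigma u)(x)=\int_0^x k_\sigma(x,t)u(t)\,dt$ such that $\widetilde T_\sigma(I+K_\sigma)=(I+K_\sigma)\widetilde T_0$ (equality of unbounded operators, including their domains), and let $l_\sigma$ be the kernel of $L_\sigma:=(I+K_\sigma)^{-1}-I$. Define $\phi_\sigma\in L_2(0,2)$ by $$\phi_\sigma(2x)=-\tfrac12\sigma(x)+\int_0^x l_\sigma(x,t)^2\,dt\qquad\text{for a.e. }x\in(0,1).$$ Let $\mathfrak S_2^+$ and $\mathfrak S_2^-$ be the sets of Hilbert–Schmidt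 integral operators in $L_2(0,1)$ whose kernels $r(x,t)$ vanish for a.e. $(x,t)$ with $x<t$ and with $x>t$, respectively. Let $\Phi$ be the set of all $\phi\in L_2(0,2)$ such that, for the integral operator $F_\phi$ in $L_2(0,1)$ with the kernel $\phi(x+t)+\phi(|x-t|)$, there are $R^{\pm}\in\mathfrak S_2^{\pm}$ with $I+R^\pm$ invertible and $I+F_\phi=(I+R^+)^{-1}(I+R^-)^{-1}$. **Theorem.** For every $\sigma\in W^1_2(0,1)$ the function $\phi_\sigma$ exists and is uniquely determined by $\sigma$, and the restriction of the mapping $\sigma\mapsto\phi_\sigma$ to $W^1_2(0,1)$ is a bijection onto $\Phi\cap W^1_2(0,2)$. -/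

import Mathlib

open MeasureTheory Set
open scoped ContDiff ENNReal

noncomputable section

namespace HalfInverse

/-- Lebesgue measure on the interval `(a, b)`. -/
abbrev vol (a b : ℝ) : Measure ℝ := volume.restrict (Ioo a b)

/-- The complex Hilbert space `L₂(a, b)`. -/
abbrev L2 (a b : ℝ) : Type := Lp ℂ 2 (vol a b)

/-- `v` is the weak (distributional) derivative of `u` on the interval `(a, b)`, where `u` and `v`
are integrable on `(a, b)`. -/
def HasWeakDeriv (a b : ℝ) (u v : ℝ → ℂ) : Prop :=
  Integrable u (vol a b) ∧ Integrable v (vol a b) ∧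
    ∀ ψ : ℝ → ℝ, ContDiff ℝ ∞ ψ → HasCompactSupport ψ → tsupport ψ ⊆ Ioo a b →
      ∫ x, deriv ψ x • u x ∂(vol a b) = - ∫ x, ψ x • v x ∂(vol a b)

/-- The Sobolev space `W¹₂(a, b)`, as a subset of `L₂(a, b)`: the functions in `L₂(a, b)` whose
weak derivative is in `L₂(a, b)`. -/
def W12 (a b : ℝ) : Set (L2 a b) :=
  {u | ∃ v : L2 a b, HasWeakDeriv a b u v}

/-- The graph of the operator `T̃_σ` in `L₂(0, 1)`: `y ∈ dom T̃_σ` and `T̃_σ y = f`. Here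
`y₁` is the derivative of `y ∈ W¹₁(0, 1)`, and `w` is the continuous representative of the
quasi-derivative `y^[1] = y' - σ y`, which is in `W¹₁(0, 1)` with the derivative `w₁` and satisfies
the initial condition `y^[1](0) = 0`; the value of the operator is
`-(y^[1])' - σ y'`, which has to be (a.e. equal to) an element `f` of `L₂(0, 1)`. -/
def IsTildeT (σ y f : L2 0 1) : Prop :=
  ∃ y₁ w w₁ : ℝ → ℂ,
    HasWeakDeriv 0 1 y y₁ ∧
    (w =ᵐ[vol 0 1] fun x => y₁ x - σ x * y x) ∧
    ContinuousOn w (Icc 0 1) ∧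
    HasWeakDeriv 0 1 w w₁ ∧
    w 0 = 0 ∧
    (f =ᵐ[vol 0 1] fun x => - w₁ x - σ x * y₁ x)

/-- `A` is the Hilbert–Schmidt integral operator in `L₂(0, 1)` with the square integrable kernel
`k`, that is, `(A u)(x) = ∫₀¹ k(x, t) u(t) dt`. -/
def HasKernel (A : L2 0 1 →L[ℂ] L2 0 1) (k : ℝ → ℝ → ℂ) : Prop :=
  MemLp (fun p : ℝ × ℝ => k p.1 p.2) 2 ((vol 0 1).prod (vol 0 1)) ∧
    ∀ u : L2 0 1, A u =ᵐ[vol 0 1] fun x => ∫ t, k x t * u t ∂(vol 0 1)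

/-- The class `𝔖₂⁺` of Hilbert–Schmidt operators of the form `(A u)(x) = ∫₀ˣ k(x, t) u(t) dt`. -/
def IsVolterraPlus (A : L2 0 1 →L[ℂ] L2 0 1) : Prop :=
  ∃ k : ℝ → ℝ → ℂ, HasKernel A k ∧
    ∀ᵐ p : ℝ × ℝ ∂((vol 0 1).prod (vol 0 1)), p.1 < p.2 → k p.1 p.2 = 0

/-- The class `𝔖₂⁻` of Hilbert–Schmidt operators of the form `(A u)(x) = ∫ₓ¹ k(x, t) u(t) dt`. -/
def IsVolterraMinus (A : L2 0 1 →L[ℂ] L2 0 1) : Prop :=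
  ∃ k : ℝ → ℝ → ℂ, HasKernel A k ∧
    ∀ᵐ p : ℝ × ℝ ∂((vol 0 1).prod (vol 0 1)), p.2 < p.1 → k p.1 p.2 = 0

/-- The operator `I + Q` admits the factorization `(I + R⁺)⁻¹ (I + R⁻)⁻¹` with `R^± ∈ 𝔖₂^±`. -/
def Factorizable (Q : L2 0 1 →L[ℂ] L2 0 1) : Prop :=
  ∃ Rp Rm : L2 0 1 →L[ℂ] L2 0 1, IsVolterraPlus Rp ∧ IsVolterraMinus Rm ∧
    IsUnit (1 + Rp) ∧ IsUnit (1 + Rm) ∧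
    1 + Q = Ring.inverse (1 + Rp) * Ring.inverse (1 + Rm)

/-- The set `Φ` of all `φ ∈ L₂(0, 2)` such that `I + F_φ` admits factorization, where `F_φ` is the
integral operator in `L₂(0, 1)` with the kernel `φ(x + t) + φ(|x - t|)`. -/
def factorizableSet : Set (L2 0 2) :=
  {φ | ∃ F : L2 0 1 →L[ℂ] L2 0 1,
    HasKernel F (fun x t => φ (x + t) + φ |x - t|) ∧ Factorizable F}

/-- `I + K` is the transformation operator for `T̃_σ` and `T̃_0`: `K` is a Hilbert–Schmidt operator
of the form `(K u)(x) = ∫₀ˣ k(x, t) u(t) dt`, and `T̃_σ (I + K) = (I + K) T̃_0` as unbounded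
operators (equality of the domains included). -/
def IsTransformation (σ : L2 0 1) (K : L2 0 1 →L[ℂ] L2 0 1) : Prop :=
  IsVolterraPlus K ∧
    ∀ u g : L2 0 1, IsTildeT σ (u + K u) g ↔ ∃ f : L2 0 1, IsTildeT 0 u f ∧ g = f + K f

/-- `φ ∈ L₂(0, 2)` is given by `φ(2x) = -σ(x)/2 + ∫₀ˣ l_σ(x, t)² dt` for a.e. `x ∈ (0, 1)`, where
`l_σ` is the kernel of `L_σ = (I + K_σ)⁻¹ - I`, and `I + K_σ` is the transformation operator. -/
def IsPhiOf (σ : L2 0 1) (φ : L2 0 2) : Prop :=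
  ∃ (K : L2 0 1 →L[ℂ] L2 0 1) (l : ℝ → ℝ → ℂ),
    IsTransformation σ K ∧ IsUnit (1 + K) ∧
    HasKernel (Ring.inverse (1 + K) - 1) l ∧
    ∀ᵐ x ∂(vol 0 1), φ (2 * x) = -(1 / 2) * σ x + ∫ t in (0 : ℝ)..x, l x t ^ 2

/-- The mapping `σ ↦ φ_σ`. -/
def phiOf (σ : L2 0 1) : L2 0 2 := Classical.epsilon (IsPhiOf σ)

end HalfInverse

end

/-!
For `σ ∈ W¹₂(0, 1)` write `σ = h + ∫ q` with `q ∈ L₂`. Then `T̃_σ y = f` is the Cauchy problem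
`y'' = q y - f`, `y'(0) = h y(0)` (`isTildeT_iff`), and everything is governed by a classical chain
of continuous kernels.

*Existence and uniqueness of `φ_σ`.* The kernel `k(x, t)` of the transformation operator is a
solution of a Goursat problem in the variables `ξ = (x + t) / 2`, `η = (x - t) / 2`, which is solved
by a contraction (`exists_goursat`); its cosine transform solves the Cauchy problem
(`Goursat.intertwines`), and as the cosines are dense this is equivalent to
`T̃_σ (I + K) = (I + K) T̃_0` (`IntertwinesOp.isTransformation`, `IntertwinesOp.unique`). Its
diagonal is `k(x, x) = (σ(x) + h) / 2`. Let the even function `φ` solve the Volterra equation which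
is the Gelfand–Levitan equation `k + f + ∫₀ˣ k f = 0`, `f(x, t) = φ(x + t) + φ(|x - t|)`, at
`t = 0`. Both `k` and `f + ∫₀ˣ k f` have the mixed derivative given by the wave equation with the
potential `q`, the latter because this holds for cosines and even functions are limits of sums of
cosines; hence the equation holds for all `t` (`Goursat.gelfandLevitan`).

*The factorization.* The Gelfand–Levitan equation says that `(I + K)(I + F)` is upper triangular, so
that `I + F = (I + K)⁻¹ (I + Kᵀ)⁻¹` (`GelfandLevitan.factorization`). With the kernel `m` of
`(I + K)⁻¹ - I` this reads `f(x, t) = m(x, t) + ∫₀ᵗ m(x, s) m(t, s) ds` for `t ≤ x`. On the diagonal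
it becomes `φ(2x) + φ(0) = -k(x, x) + ∫₀ˣ m(x, t)² dt`, where `φ(0) = -h / 2`, and therefore
`φ = φ_σ` (`TransformData.isPhiOf_iff`) and `φ_σ ∈ Φ`.

*Bijectivity.* In the triangular factorization `φ` determines `m`, and already the diagonal of `m`
determines `m` and `φ` (`TriangularFactor.eq_of_norm_le`, by a Gronwall type estimate). The first
gives injectivity, as `m(x, x) = -(σ(x) + h) / 2`. For surjectivity let `φ ∈ Φ ∩ W¹₂(0, 2)`. The
factorization makes all truncations of `I + F` to `(0, x)` invertible, so that the Gelfand–Levitan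
equation has a continuous solution `k` (`Factorizable.exists_gelfandLevitan`). Its diagonal is in
`W¹₂(0, 1)`, because `k(x, x) = -φ(2x) - φ(0) + ∫₀ˣ m(x, t)² dt` with a Lipschitz last term
(`GelfandLevitan.exists_primitive_diagonal`). The function `σ(x) = 2 k(x, x) - k(0, 0)` has a
transformation operator with the same diagonal, hence `φ_σ = φ`. The same Lipschitz argument,
applied to the Volterra equation for `φ`, shows that `φ_σ ∈ W¹₂(0, 2)` (`exists_transformData`).
-/

namespace HalfInverse


/-! ### Primitives and weak derivatives -/

theorem intervalIntegral_eq_integral_vol {E : Type*} [NormedAddCommGroup E] [NormedSpace ℝ E]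
    {a b : ℝ} (hab : a ≤ b) (f : ℝ → E) : ∫ x in a..b, f x = ∫ x, f x ∂(vol a b) := by
  rw [intervalIntegral.integral_of_le hab, integral_Ioc_eq_integral_Ioo]

theorem intervalIntegrable_iff_vol {E : Type*} [NormedAddCommGroup E]
    {a b : ℝ} (hab : a ≤ b) {f : ℝ → E} :
    IntervalIntegrable f volume a b ↔ Integrable f (vol a b) := by
  rw [intervalIntegrable_iff_integrableOn_Ioo_of_le hab]; rfl

theorem vol_mono {a b c d : ℝ} (hca : c ≤ a) (hbd : b ≤ d) : vol a b ≤ vol c d :=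
  Measure.restrict_mono (Ioo_subset_Ioo hca hbd) le_rfl

/-- Fubini's theorem on the triangle `a ≤ y ≤ x ≤ b`. -/
theorem integral_triangle_swap {a b : ℝ} (hab : a ≤ b) {F : ℝ → ℝ → ℂ}
    (hF : Integrable (Function.uncurry F) ((vol a b).prod (vol a b))) :
    ∫ x in a..b, ∫ y in a..x, F x y = ∫ y in a..b, ∫ x in y..b, F x y := by
  have hs : MeasurableSet {p : ℝ × ℝ | p.2 < p.1} := by
    exact measurableSet_lt measurable_snd measurable_fst
  have key := integral_integral_swap (μ := vol a b) (ν := vol a b)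
    (f := fun x y => Set.indicator {p : ℝ × ℝ | p.2 < p.1} (Function.uncurry F) (x, y))
    (hF.indicator hs)
  rw [intervalIntegral_eq_integral_vol hab, intervalIntegral_eq_integral_vol hab]
  have e1 : ∫ x, (∫ y in a..x, F x y) ∂(vol a b) = ∫ x, ∫ y, Set.indicator {p : ℝ × ℝ | p.2 < p.1}
      (Function.uncurry F) (x, y) ∂(vol a b) ∂(vol a b) := by
    refine integral_congr_ae ((ae_restrict_mem measurableSet_Ioo).mono fun x hx => ?_)
    dsimp only
    rw [intervalIntegral_eq_integral_vol hx.1.le]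
    have : vol a x = (vol a b).restrict (Iio x) := by
      rw [vol, vol, Measure.restrict_restrict measurableSet_Iio]
      congr 1; ext y; simp only [mem_Ioo, mem_inter_iff, mem_Iio]
      exact ⟨fun h => ⟨h.2, h.1, h.2.trans hx.2⟩, fun h => ⟨h.2.1, h.1⟩⟩
    rw [this, ← integral_indicator measurableSet_Iio]
    rfl
  have e2 : ∫ y, (∫ x in y..b, F x y) ∂(vol a b) = ∫ y, ∫ x, Set.indicator {p : ℝ × ℝ | p.2 < p.1}
      (Function.uncurry F) (x, y) ∂(vol a b) ∂(vol a b) := by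
    refine integral_congr_ae ((ae_restrict_mem measurableSet_Ioo).mono fun y hy => ?_)
    dsimp only
    rw [intervalIntegral_eq_integral_vol hy.2.le]
    have : vol y b = (vol a b).restrict (Ioi y) := by
      rw [vol, vol, Measure.restrict_restrict measurableSet_Ioi]
      congr 1; ext x; simp only [mem_Ioo, mem_inter_iff, mem_Ioi]
      exact ⟨fun h => ⟨h.1, hy.1.trans h.1, h.2⟩, fun h => ⟨h.1, h.2.2⟩⟩
    rw [this, ← integral_indicator measurableSet_Ioi]
    rfl
  rw [e1, e2, key]

theorem integrable_mul_prod {a b : ℝ} {f g : ℝ → ℂ} (hf : Integrable f (vol a b))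
    (hg : Integrable g (vol a b)) :
    Integrable (Function.uncurry fun x y => f x * g y) ((vol a b).prod (vol a b)) :=
  hf.mul_prod hg

theorem continuousOn_primitive {a b : ℝ} {f : ℝ → ℂ} (hab : a ≤ b)
    (hf : IntervalIntegrable f volume a b) (A : ℂ) :
    ContinuousOn (fun x => A + ∫ s in a..x, f s) (Icc a b) := by
  refine continuousOn_const.add ?_
  have := intervalIntegral.continuousOn_primitive_interval (a := a) (b := b) (f := f)
    (μ := volume) ((intervalIntegrable_iff_integrableOn_Icc_of_le hab).1 hf |>.mono_set
      (by rw [uIcc_of_le hab]))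
  rwa [uIcc_of_le hab] at this

/-- The product rule for primitives of integrable functions. -/
theorem primitive_mul_primitive {a b : ℝ} (hab : a ≤ b) {f g : ℝ → ℂ} (A B : ℂ)
    (hf : IntervalIntegrable f volume a b) (hg : IntervalIntegrable g volume a b) :
    (A + ∫ s in a..b, f s) * (B + ∫ s in a..b, g s) = A * B +
      ∫ x in a..b, (f x * (B + ∫ s in a..x, g s) + (A + ∫ s in a..x, f s) * g x) := by
  have hswap := integral_triangle_swap hab
    (integrable_mul_prod ((intervalIntegrable_iff_vol hab).1 hf)
      ((intervalIntegrable_iff_vol hab).1 hg))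
  have cf := continuousOn_primitive hab hf 0
  have cg := continuousOn_primitive hab hg 0
  simp only [zero_add] at cf cg
  rw [← uIcc_of_le hab] at cf cg
  have i1 : IntervalIntegrable (fun x => f x * ∫ s in a..x, g s) volume a b :=
    hf.mul_continuousOn cg
  have i2 : IntervalIntegrable (fun x => (∫ s in a..x, f s) * g x) volume a b :=
    hg.continuousOn_mul cf
  have e : ∀ x, f x * (B + ∫ s in a..x, g s) + (A + ∫ s in a..x, f s) * g x =
      (B * f x + A * g x) + (f x * (∫ s in a..x, g s) + (∫ s in a..x, f s) * g x) :=
    fun x => by ring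
  simp_rw [e]
  rw [intervalIntegral.integral_add ((hf.const_mul B).add (hg.const_mul A)) (i1.add i2),
    intervalIntegral.integral_add (hf.const_mul B) (hg.const_mul A),
    intervalIntegral.integral_add i1 i2, intervalIntegral.integral_const_mul,
    intervalIntegral.integral_const_mul]
  have h1 : ∫ x in a..b, f x * ∫ s in a..x, g s = ∫ y in a..b, (∫ x in y..b, f x) * g y := by
    simp_rw [intervalIntegral.integral_const_mul, intervalIntegral.integral_mul_const] at hswap
    exact hswap
  have h2 : (∫ y in a..b, (∫ x in y..b, f x) * g y) + ∫ y in a..b, (∫ x in a..y, f x) * g y =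
      (∫ x in a..b, f x) * ∫ y in a..b, g y := by
    rw [← intervalIntegral.integral_add _ i2, ← intervalIntegral.integral_const_mul]
    · refine intervalIntegral.integral_congr fun y hy => ?_
      rw [uIcc_of_le hab] at hy
      have := intervalIntegral.integral_add_adjacent_intervals (a := a) (b := y) (c := b)
        (f := f) (μ := volume)
        (hf.mono_set (by rw [uIcc_of_le hab, uIcc_of_le hy.1]; exact Icc_subset_Icc_right hy.2))
        (hf.mono_set (by rw [uIcc_of_le hab, uIcc_of_le hy.2]; exact Icc_subset_Icc_left hy.1))
      rw [← this]; ring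
    · refine hg.continuousOn_mul ?_
      have : (fun y => ∫ x in y..b, f x) = fun y => -∫ x in b..y, f x := by
        ext y; rw [intervalIntegral.integral_symm]
      rw [this]
      refine ContinuousOn.neg ?_
      have := intervalIntegral.continuousOn_primitive_interval' (a := b) (b₁ := a) (b₂ := b)
        (f := f) (μ := volume) hf right_mem_uIcc
      exact this
  rw [h1, h2]; ring

/-- A primitive of an integrable function has that function as its weak derivative. -/
theorem hasWeakDeriv_primitive {a b : ℝ} (hab : a < b) {v : ℝ → ℂ} (c : ℂ)
    (hv : Integrable v (vol a b)) : HasWeakDeriv a b (fun x => c + ∫ s in a..x, v s) v := by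
  have hv' := (intervalIntegrable_iff_vol hab.le).2 hv
  have hcont := continuousOn_primitive hab.le hv' c
  refine ⟨?_, hv, fun ψ hψ hψc hψs => ?_⟩
  · rw [← intervalIntegrable_iff_vol hab.le]
    exact ContinuousOn.intervalIntegrable (by rwa [uIcc_of_le hab.le])
  have hcd : Continuous (deriv ψ) := hψ.continuous_deriv (by simp)
  have hd : ∀ x, HasDerivAt (fun x => (ψ x : ℂ)) ((deriv ψ x : ℝ) : ℂ) x := fun x =>
    ((hψ.differentiable (by simp) x).hasDerivAt).ofReal_comp
  have hcd' : Continuous (fun x => ((deriv ψ x : ℝ) : ℂ)) := Complex.continuous_ofReal.comp hcd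
  have hψ0 : ∀ x, x ∉ Ioo a b → ψ x = 0 := fun x hx =>
    image_eq_zero_of_notMem_tsupport fun h => hx (hψs h)
  have hprim : ∀ x, ((0 : ℂ) + ∫ s in a..x, ((deriv ψ s : ℝ) : ℂ)) = ψ x := fun x => by
    rw [intervalIntegral.integral_eq_sub_of_hasDerivAt (fun y _ => hd y)
      (hcd'.intervalIntegrable _ _), hψ0 a (by simp)]; simp
  have key := primitive_mul_primitive hab.le (f := fun s => ((deriv ψ s : ℝ) : ℂ)) (g := v) 0 c
    (hcd'.intervalIntegrable _ _) hv'
  simp only [hprim] at key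
  rw [hψ0 b (by simp)] at key
  have i1 : IntervalIntegrable (fun x => ((deriv ψ x : ℝ) : ℂ) * (c + ∫ s in a..x, v s))
      volume a b :=
    (ContinuousOn.intervalIntegrable (by rw [uIcc_of_le hab.le]; exact hcd'.continuousOn.mul hcont))
  have i2 : IntervalIntegrable (fun x => (ψ x : ℂ) * v x) volume a b :=
    hv'.continuousOn_mul (Complex.continuous_ofReal.comp hψ.continuous).continuousOn
  rw [intervalIntegral.integral_add i1 i2] at key
  simp only [Complex.real_smul]
  rw [← intervalIntegral_eq_integral_vol hab.le, ← intervalIntegral_eq_integral_vol hab.le]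
  simp only [Complex.ofReal_zero, zero_mul, zero_add] at key
  exact eq_neg_of_add_eq_zero_left key.symm

theorem HasWeakDeriv.congr {a b : ℝ} {u u' v v' : ℝ → ℂ} (h : HasWeakDeriv a b u v)
    (hu : u =ᵐ[vol a b] u') (hv : v =ᵐ[vol a b] v') : HasWeakDeriv a b u' v' := by
  refine ⟨h.1.congr hu, h.2.1.congr hv, fun ψ h1 h2 h3 => ?_⟩
  rw [← integral_congr_ae (f := fun x => deriv ψ x • u x)
    (hu.mono fun x hx => by simp only [hx]), h.2.2 ψ h1 h2 h3,
    integral_congr_ae (f := fun x => ψ x • v x) (g := fun x => ψ x • v' x)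
      (hv.mono fun x hx => by simp only [hx])]

/-- du Bois-Reymond: an integrable function which annihilates the derivatives of all test functions
is a.e. constant. -/
theorem ae_const_of_integral_deriv_smul_eq_zero {a b : ℝ} (hab : a < b) {g : ℝ → ℂ}
    (hg : Integrable g (vol a b))
    (h : ∀ ψ : ℝ → ℝ, ContDiff ℝ ∞ ψ → HasCompactSupport ψ → tsupport ψ ⊆ Ioo a b →
      ∫ x, deriv ψ x • g x ∂(vol a b) = 0) : ∃ c : ℂ, g =ᵐ[vol a b] fun _ => c := by
  -- `η₀` is a fixed test function with integral one: a test function minus its integral times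
  -- `η₀` is the derivative of a test function.
  obtain ⟨η₀, hη₀c, hη₀s, hη₀t, hη₀i⟩ : ∃ η₀ : ℝ → ℝ, ContDiff ℝ ∞ η₀ ∧ HasCompactSupport η₀ ∧
      tsupport η₀ ⊆ Ioo a b ∧ ∫ x, η₀ x = 1 := by
    let B : ContDiffBump ((a + b) / 2) :=
      ⟨(b - a) / 8, (b - a) / 4, by linarith, by linarith⟩
    refine ⟨B.normed volume, B.contDiff_normed, B.hasCompactSupport_normed, ?_, B.integral_normed⟩
    rw [B.tsupport_normed_eq, Real.closedBall_eq_Icc]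
    intro x hx
    have h1 : (B.rOut : ℝ) = (b - a) / 4 := rfl
    rw [h1] at hx
    exact ⟨by linarith [hx.1], by linarith [hx.2]⟩
  set c : ℂ := ∫ x, η₀ x • g x ∂(vol a b) with hc
  refine ⟨c, ?_⟩
  have hloc : LocallyIntegrableOn (fun x => g x - c) (Ioo a b) := by
    refine IntegrableOn.locallyIntegrableOn ?_
    exact hg.sub (integrable_const c)
  have bsm : ∀ {η : ℝ → ℝ} {G : ℝ → ℂ}, Continuous η → HasCompactSupport η →
      Integrable G (vol a b) → Integrable (fun x => η x • G x) (vol a b) := by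
    intro η G hη hs hG
    obtain ⟨C, hC⟩ := hη.bounded_above_of_compact_support hs
    exact hG.bdd_smul C hη.aestronglyMeasurable (Filter.Eventually.of_forall hC)
  have hz := isOpen_Ioo.ae_eq_zero_of_integral_contDiff_smul_eq_zero (μ := volume) hloc
    (fun η hη hηs hηt => ?_)
  · rw [Filter.EventuallyEq, ae_restrict_iff' measurableSet_Ioo]
    exact hz.mono fun x hx hxm => sub_eq_zero.1 (hx hxm)
  set m := ∫ x, η x with hm
  set ρ : ℝ → ℝ := fun x => η x - m * η₀ x with hρ
  have hρc : ContDiff ℝ ∞ ρ := hη.sub (contDiff_const.mul hη₀c)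
  have hηi : Integrable η := hη.continuous.integrable_of_hasCompactSupport hηs
  have hη₀i' : Integrable η₀ := hη₀c.continuous.integrable_of_hasCompactSupport hη₀s
  have hρi : Integrable ρ := hηi.sub (hη₀i'.const_mul m)
  have hρ0 : ∫ x, ρ x = 0 := by
    rw [hρ, integral_sub hηi (hη₀i'.const_mul m), integral_const_mul, hη₀i]; simp [hm]
  obtain ⟨α, β, hα, hβ, hsub⟩ : ∃ α β, a < α ∧ β < b ∧ ∀ x, x ∉ Icc α β → ρ x = 0 := by
    have hK : IsCompact (tsupport η ∪ tsupport η₀) := IsCompact.union hηs hη₀s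
    have hKs : tsupport η ∪ tsupport η₀ ⊆ Ioo a b := union_subset hηt hη₀t
    have hz : ∀ x, x ∉ tsupport η ∪ tsupport η₀ → ρ x = 0 := fun x hx => by
      simp only [mem_union, not_or] at hx
      simp [hρ, image_eq_zero_of_notMem_tsupport hx.1, image_eq_zero_of_notMem_tsupport hx.2]
    rcases (tsupport η ∪ tsupport η₀).eq_empty_or_nonempty with he | hne
    · exact ⟨(a + b) / 2, (a + b) / 2, by linarith, by linarith, fun x _ => hz x (by simp [he])⟩
    · obtain ⟨α, hα, hα'⟩ := hK.exists_isLeast hne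
      obtain ⟨β, hβ, hβ'⟩ := hK.exists_isGreatest hne
      exact ⟨α, β, (hKs hα).1, (hKs hβ).2, fun x hx => hz x fun h => hx ⟨hα' h, hβ' h⟩⟩
  set ψ : ℝ → ℝ := fun x => ∫ s in a..x, ρ s with hψ
  have hψd : ∀ x, HasDerivAt ψ (ρ x) x := fun x =>
    intervalIntegral.integral_hasDerivAt_right (hρc.continuous.intervalIntegrable _ _)
      (hρc.continuous.stronglyMeasurableAtFilter _ _) hρc.continuous.continuousAt
  have hderiv : deriv ψ = ρ := funext fun x => (hψd x).deriv
  have hψc : ContDiff ℝ ∞ ψ :=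
    contDiff_infty_iff_deriv.2 ⟨fun x => (hψd x).differentiableAt, by rwa [hderiv]⟩
  have hψz : ∀ x, x ∉ Icc α β → ψ x = 0 := by
    intro x hx
    rw [mem_Icc, not_and_or, not_le, not_le] at hx
    rcases hx with hx | hx
    · have : ∀ s ∈ uIcc a x, ρ s = 0 := fun s hs => hsub s fun h => by
        rcases le_total a x with h' | h'
        · rw [uIcc_of_le h'] at hs; linarith [hs.2, h.1]
        · rw [uIcc_of_ge h'] at hs; linarith [hs.2, h.1]
      rw [hψ]; dsimp only
      rw [intervalIntegral.integral_congr (g := fun _ => 0) this]; simp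
    · have e1 : ψ x = ∫ s in Iic x, ρ s := by
        rw [hψ]; dsimp only
        rw [← intervalIntegral.integral_Iic_sub_Iic hρi.integrableOn hρi.integrableOn]
        rw [setIntegral_eq_zero_of_forall_eq_zero (t := Iic a)
          (fun s hs => hsub s fun h => by rw [mem_Iic] at hs; linarith [h.1])]
        simp
      rw [e1, ← hρ0]
      exact setIntegral_eq_integral_of_forall_compl_eq_zero fun s hs => hsub s fun h =>
        hs (h.2.trans hx.le)
  have hts : tsupport ψ ⊆ Icc α β :=
    closure_minimal (fun x hx => by by_contra hn; exact hx (hψz x hn)) isClosed_Icc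
  have hψs : HasCompactSupport ψ := HasCompactSupport.intro isCompact_Icc hψz
  have h0 := h ψ hψc hψs (hts.trans (Icc_subset_Ioo hα hβ))
  rw [hderiv] at h0
  have hsupp : ∫ x, η x • (g x - c) = ∫ x, η x • (g x - c) ∂(vol a b) := by
    symm
    exact setIntegral_eq_integral_of_forall_compl_eq_zero fun x hx => by
      rw [image_eq_zero_of_notMem_tsupport fun h => hx (hηt h)]; simp
  have hmi : ∫ x, η x ∂(vol a b) = m :=
    setIntegral_eq_integral_of_forall_compl_eq_zero fun x hx =>
      image_eq_zero_of_notMem_tsupport fun h => hx (hηt h)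
  rw [hsupp]
  simp only [smul_sub]
  rw [integral_sub (bsm hη.continuous hηs hg) (bsm hη.continuous hηs (integrable_const c)),
    integral_smul_const, hmi]
  simp only [hρ, sub_smul, mul_smul] at h0
  rw [integral_sub (g := fun x => m • η₀ x • g x) (bsm hη.continuous hηs hg)
    ((bsm hη₀c.continuous hη₀s hg).smul m), integral_smul, ← hc] at h0
  exact h0

/-- A function with an integrable weak derivative is a.e. equal to a primitive of it. -/
theorem HasWeakDeriv.ae_eq_primitive {a b : ℝ} (hab : a < b) {u v : ℝ → ℂ}
    (h : HasWeakDeriv a b u v) : ∃ c : ℂ, u =ᵐ[vol a b] fun x => c + ∫ s in a..x, v s := by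
  obtain ⟨hp1, -, hp3⟩ := hasWeakDeriv_primitive hab 0 h.2.1
  have bsm : ∀ {η : ℝ → ℝ} {G : ℝ → ℂ}, Continuous η → HasCompactSupport η →
      Integrable G (vol a b) → Integrable (fun x => η x • G x) (vol a b) := by
    intro η G hη hs hG
    obtain ⟨C, hC⟩ := hη.bounded_above_of_compact_support hs
    exact hG.bdd_smul C hη.aestronglyMeasurable (Filter.Eventually.of_forall hC)
  obtain ⟨c, hc⟩ := ae_const_of_integral_deriv_smul_eq_zero hab (h.1.sub hp1)
    (fun ψ h1 h2 h3 => by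
      have e1 := h.2.2 ψ h1 h2 h3
      have e2 := hp3 ψ h1 h2 h3
      have c1 : Continuous (deriv ψ) := h1.continuous_deriv (by simp)
      simp only [Pi.sub_apply, smul_sub]
      rw [integral_sub (bsm c1 h2.deriv h.1) (bsm c1 h2.deriv hp1), e1, e2, sub_self])
  refine ⟨c, hc.mono fun x hx => ?_⟩
  simp only [Pi.sub_apply, zero_add] at hx
  rw [← hx]; ring


/-! ### Integral operators in `L₂(0, 1)` -/

instance isProbabilityMeasure_vol : IsProbabilityMeasure (vol 0 1) := ⟨by simp [vol]⟩

theorem integral_mul_norm_sq_le {α : Type*} {m : MeasurableSpace α} {μ : Measure α} {f g : α → ℂ}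
    (hf : MemLp f 2 μ) (hg : MemLp g 2 μ) :
    (∫ a, ‖f a‖ * ‖g a‖ ∂μ) ^ 2 ≤ (∫ a, ‖f a‖ ^ 2 ∂μ) * ∫ a, ‖g a‖ ^ 2 ∂μ := by
  have h := integral_mul_le_Lp_mul_Lq_of_nonneg (μ := μ) (p := 2) (q := 2)
    (by exact Real.HolderConjugate.two_two) (f := fun a => ‖f a‖) (g := fun a => ‖g a‖)
    (ae_of_all _ fun a => norm_nonneg _) (ae_of_all _ fun a => norm_nonneg _)
    (by simpa using hf.norm) (by simpa using hg.norm)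
  simp only [Real.rpow_ofNat] at h
  have h1 : 0 ≤ ∫ a, ‖f a‖ ^ 2 ∂μ := integral_nonneg fun a => by positivity
  have h2 : 0 ≤ ∫ a, ‖g a‖ ^ 2 ∂μ := integral_nonneg fun a => by positivity
  have h0 : 0 ≤ ∫ a, ‖f a‖ * ‖g a‖ ∂μ := integral_nonneg fun a => by positivity
  rw [← Real.sqrt_eq_rpow, ← Real.sqrt_eq_rpow, ← Real.sqrt_mul h1] at h
  calc _ ≤ (Real.sqrt _) ^ 2 := pow_le_pow_left₀ h0 h 2
    _ = _ := Real.sq_sqrt (mul_nonneg h1 h2)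

theorem norm_integral_mul_sq_le {α : Type*} {m : MeasurableSpace α} {μ : Measure α} {f g : α → ℂ}
    (hf : MemLp f 2 μ) (hg : MemLp g 2 μ) :
    ‖∫ a, f a * g a ∂μ‖ ^ 2 ≤ (∫ a, ‖f a‖ ^ 2 ∂μ) * ∫ a, ‖g a‖ ^ 2 ∂μ := by
  refine le_trans (pow_le_pow_left₀ (norm_nonneg _) ?_ 2) (integral_mul_norm_sq_le hf hg)
  refine (norm_integral_le_integral_norm _).trans (le_of_eq ?_)
  simp_rw [norm_mul]

theorem integrable_mul_of_memLp {α : Type*} {m : MeasurableSpace α} {μ : Measure α} {f g : α → ℂ}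
    (hf : MemLp f 2 μ) (hg : MemLp g 2 μ) : Integrable (fun a => f a * g a) μ :=
  memLp_one_iff_integrable.1 (MemLp.mul' (p := 2) (q := 2) (r := 1) hg hf)

theorem norm_sq_eq_integral {α : Type*} {m : MeasurableSpace α} {μ : Measure α} (u : Lp ℂ 2 μ) :
    ‖u‖ ^ 2 = ∫ a, ‖u a‖ ^ 2 ∂μ := by
  have h := inner_self_eq_norm_sq_to_K (𝕜 := ℂ) u
  rw [L2.inner_def] at h
  have h2 : ∀ a, inner ℂ (u a) (u a) = ((‖u a‖ ^ 2 : ℝ) : ℂ) := fun a => by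
    rw [inner_self_eq_norm_sq_to_K]; simp
  simp_rw [h2] at h
  have h3 : ∫ a, ((‖u a‖ ^ 2 : ℝ) : ℂ) ∂μ = ((∫ a, ‖u a‖ ^ 2 ∂μ : ℝ) : ℂ) := integral_complex_ofReal
  rw [h3] at h
  refine Complex.ofReal_injective (Eq.trans ?_ h.symm)
  simp

theorem norm_integral_mul_le {α : Type*} {m : MeasurableSpace α} {μ : Measure α} {f : α → ℂ}
    (hf : MemLp f 2 μ) (u : Lp ℂ 2 μ) :
    ∫ a, ‖f a‖ * ‖u a‖ ∂μ ≤ Real.sqrt (∫ a, ‖f a‖ ^ 2 ∂μ) * ‖u‖ := by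
  have h := integral_mul_norm_sq_le hf (Lp.memLp u)
  rw [← norm_sq_eq_integral] at h
  rw [← Real.sqrt_sq (norm_nonneg u), ← Real.sqrt_mul (integral_nonneg fun a => by positivity)]
  exact Real.le_sqrt_of_sq_le h

theorem norm_le_of_ae_bound {u : L2 0 1} {C : ℝ} (hC : 0 ≤ C) (h : ∀ᵐ x ∂(vol 0 1), ‖u x‖ ≤ C) :
    ‖u‖ ≤ C := by
  have := Lp.norm_le_of_ae_bound hC h
  simpa [measureUnivNNReal] using this

theorem integral_norm_le_norm (u : L2 0 1) : ∫ x, ‖u x‖ ∂(vol 0 1) ≤ ‖u‖ := by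
  have := norm_integral_mul_le (μ := vol 0 1) (f := fun _ => (1 : ℂ)) (memLp_const 1) u
  simpa using this

theorem L2.integrable (u : L2 0 1) : Integrable u (vol 0 1) :=
  (Lp.memLp u).integrable (by norm_num)

/-- The bounded operator in `L₂(0, 1)` defined by a linear map `Φ` into functions such that
`|Φ u| ≤ C ‖u‖` pointwise. -/
noncomputable def opOfBound (Φ : L2 0 1 →ₗ[ℂ] (ℝ → ℂ)) (C : ℝ)
    (hm : ∀ u, AEStronglyMeasurable (Φ u) (vol 0 1))
    (hb : ∀ u, ∀ x ∈ Ioo (0 : ℝ) 1, ‖Φ u x‖ ≤ C * ‖u‖) : L2 0 1 →L[ℂ] L2 0 1 :=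
  have hmem : ∀ u, MemLp (Φ u) 2 (vol 0 1) := fun u =>
    MemLp.of_bound (hm u) (C * ‖u‖) ((ae_restrict_mem measurableSet_Ioo).mono (hb u))
  LinearMap.mkContinuous
    { toFun := fun u => (hmem u).toLp _
      map_add' := fun u v => by
        rw [← MemLp.toLp_add]; congr 1; exact map_add Φ u v
      map_smul' := fun c u => by
        rw [RingHom.id_apply, ← MemLp.toLp_const_smul]; congr 1; exact map_smul Φ c u }
    |C| (fun u => norm_le_of_ae_bound (by positivity) (by
      filter_upwards [(hmem u).coeFn_toLp, ae_restrict_mem measurableSet_Ioo] with x hx hx'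
      change ‖(hmem u).toLp _ x‖ ≤ _
      rw [hx]
      exact (hb u x hx').trans (by gcongr; exact le_abs_self C)))

theorem opOfBound_ae {Φ : L2 0 1 →ₗ[ℂ] (ℝ → ℂ)} {C : ℝ}
    {hm : ∀ u, AEStronglyMeasurable (Φ u) (vol 0 1)}
    {hb : ∀ u, ∀ x ∈ Ioo (0 : ℝ) 1, ‖Φ u x‖ ≤ C * ‖u‖} (u : L2 0 1) :
    opOfBound Φ C hm hb u =ᵐ[vol 0 1] Φ u :=
  MemLp.coeFn_toLp (MemLp.of_bound (hm u) (C * ‖u‖)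
    ((ae_restrict_mem measurableSet_Ioo).mono (hb u)))

/-- A measurable kernel which is bounded on the square `(0, 1)²`. -/
def BddKernel (a : ℝ → ℝ → ℂ) : Prop :=
  Measurable (Function.uncurry a) ∧
    ∃ C, ∀ x ∈ Ioo (0 : ℝ) 1, ∀ t ∈ Ioo (0 : ℝ) 1, ‖a x t‖ ≤ C

theorem ae_mem_square : ∀ᵐ p : ℝ × ℝ ∂((vol 0 1).prod (vol 0 1)), p.1 ∈ Ioo (0 : ℝ) 1 ∧
    p.2 ∈ Ioo (0 : ℝ) 1 := by
  rw [vol, Measure.prod_restrict]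
  exact (ae_restrict_mem (measurableSet_Ioo.prod measurableSet_Ioo)).mono fun p hp => hp

theorem BddKernel.memLp {a : ℝ → ℝ → ℂ} (h : BddKernel a) :
    MemLp (fun p : ℝ × ℝ => a p.1 p.2) 2 ((vol 0 1).prod (vol 0 1)) := by
  obtain ⟨C, hC⟩ := h.2
  exact MemLp.of_bound h.1.aestronglyMeasurable C
    (ae_mem_square.mono fun p hp => hC _ hp.1 _ hp.2)

theorem BddKernel.exists_nonneg_bound {a : ℝ → ℝ → ℂ} (h : BddKernel a) :
    ∃ C, 0 ≤ C ∧ ∀ x ∈ Ioo (0 : ℝ) 1, ∀ t ∈ Ioo (0 : ℝ) 1, ‖a x t‖ ≤ C := by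
  obtain ⟨C, hC⟩ := h.2
  exact ⟨|C|, abs_nonneg _, fun x hx t ht => (hC x hx t ht).trans (le_abs_self C)⟩

theorem BddKernel.integrable_section {a : ℝ → ℝ → ℂ} (h : BddKernel a) {x : ℝ}
    (hx : x ∈ Ioo (0 : ℝ) 1) {u : ℝ → ℂ} (hu : Integrable u (vol 0 1)) :
    Integrable (fun t => a x t * u t) (vol 0 1) := by
  obtain ⟨C, hC⟩ := h.2
  exact hu.bdd_mul (c := C) (h.1.comp (measurable_const.prodMk measurable_id)).aestronglyMeasurable
    ((ae_restrict_mem measurableSet_Ioo).mono fun t ht => hC x hx t ht)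

theorem BddKernel.comp {a b : ℝ → ℝ → ℂ} (ha : BddKernel a) (hb : BddKernel b) :
    BddKernel (fun x t => ∫ s, a x s * b s t ∂(vol 0 1)) := by
  obtain ⟨C, hC0, hC⟩ := ha.exists_nonneg_bound
  obtain ⟨D, hD0, hD⟩ := hb.exists_nonneg_bound
  refine ⟨?_, C * D, fun x hx t ht => ?_⟩
  · have hm : Measurable (fun q : (ℝ × ℝ) × ℝ => a q.1.1 q.2 * b q.2 q.1.2) :=
      (ha.1.comp ((measurable_fst.comp measurable_fst).prodMk measurable_snd)).mul
        (hb.1.comp (measurable_snd.prodMk (measurable_snd.comp measurable_fst)))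
    exact (hm.stronglyMeasurable.integral_prod_right' (ν := vol 0 1)).measurable
  · refine (norm_integral_le_of_norm_le_const (C := C * D)
      ((ae_restrict_mem measurableSet_Ioo).mono fun s hs => ?_)).trans (by simp)
    rw [norm_mul]
    exact mul_le_mul (hC x hx s hs) (hD s hs t ht) (norm_nonneg _) hC0

theorem BddKernel.exists_hasKernel {a : ℝ → ℝ → ℂ} (h : BddKernel a) :
    ∃ A : L2 0 1 →L[ℂ] L2 0 1, HasKernel A a := by
  obtain ⟨C, hC0, hC⟩ := h.exists_nonneg_bound
  -- The integral is cut off outside `(0, 1)`, where it need not converge.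
  let Φ : L2 0 1 →ₗ[ℂ] (ℝ → ℂ) :=
    { toFun := fun u => (Ioo (0 : ℝ) 1).indicator fun x => ∫ t, a x t * u t ∂(vol 0 1)
      map_add' := fun u v => by
        ext x
        by_cases hx : x ∈ Ioo (0 : ℝ) 1
        · simp only [Pi.add_apply, indicator_of_mem hx]
          rw [← integral_add (h.integrable_section hx u.integrable)
            (h.integrable_section hx v.integrable)]
          refine integral_congr_ae ((Lp.coeFn_add u v).mono fun t ht => ?_)
          simp only [ht, Pi.add_apply, mul_add]
        · simp [indicator_of_notMem hx]
      map_smul' := fun c u => by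
        ext x
        by_cases hx : x ∈ Ioo (0 : ℝ) 1
        · simp only [Pi.smul_apply, indicator_of_mem hx, RingHom.id_apply, smul_eq_mul]
          rw [← integral_const_mul]
          refine integral_congr_ae ((Lp.coeFn_smul c u).mono fun t ht => ?_)
          simp only [ht, Pi.smul_apply, smul_eq_mul]; ring
        · simp [indicator_of_notMem hx] }
  refine ⟨opOfBound Φ C (fun u => ?_) (fun u x hx => ?_), h.memLp, fun u => ?_⟩
  · have h2 : AEStronglyMeasurable (fun p : ℝ × ℝ => a p.1 p.2 * u p.2)
        ((vol 0 1).prod (vol 0 1)) :=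
      h.1.aestronglyMeasurable.mul (Lp.aestronglyMeasurable u).comp_snd
    exact h2.integral_prod_right'.indicator measurableSet_Ioo
  · change ‖(Ioo (0 : ℝ) 1).indicator (fun x => ∫ t, a x t * u t ∂(vol 0 1)) x‖ ≤ _
    rw [indicator_of_mem hx]
    calc _ ≤ ∫ t, C * ‖u t‖ ∂(vol 0 1) := by
          refine norm_integral_le_of_norm_le (u.integrable.norm.const_mul C)
            ((ae_restrict_mem measurableSet_Ioo).mono fun t ht => ?_)
          rw [norm_mul]; gcongr; exact hC x hx t ht
      _ ≤ C * ‖u‖ := by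
          rw [integral_const_mul]; gcongr; exact integral_norm_le_norm u
  · filter_upwards [opOfBound_ae (Φ := Φ) u, ae_restrict_mem measurableSet_Ioo] with x hx hx'
    rw [hx]
    exact indicator_of_mem hx' (fun x => ∫ t, a x t * u t ∂(vol 0 1))

/-- The kernel of a product of operators with bounded kernels. -/
theorem HasKernel.comp {A B : L2 0 1 →L[ℂ] L2 0 1} {a b : ℝ → ℝ → ℂ} (hA : HasKernel A a)
    (hB : HasKernel B b) (ha : BddKernel a) (hb : BddKernel b) :
    HasKernel (A * B) (fun x t => ∫ s, a x s * b s t ∂(vol 0 1)) := by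
  obtain ⟨C, hC0, hC⟩ := ha.exists_nonneg_bound
  obtain ⟨D, hD0, hD⟩ := hb.exists_nonneg_bound
  refine ⟨(ha.comp hb).memLp, fun u => ?_⟩
  filter_upwards [hA.2 (B u), ae_restrict_mem measurableSet_Ioo] with x hx hx'
  rw [mul_apply_eq_comp, hx]
  have e1 : ∫ t, a x t * B u t ∂(vol 0 1) =
      ∫ s, ∫ t, a x s * b s t * u t ∂(vol 0 1) ∂(vol 0 1) := by
    refine integral_congr_ae ((hB.2 u).mono fun s hs => ?_)
    simp only [hs, mul_assoc]
    rw [integral_const_mul]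
  rw [e1, integral_integral_swap]
  · exact integral_congr_ae (ae_of_all _ fun t => integral_mul_const _ _)
  · have h1 : Integrable (fun p : ℝ × ℝ => u p.2) ((vol 0 1).prod (vol 0 1)) :=
      u.integrable.comp_snd (vol 0 1)
    refine h1.bdd_mul (c := C * D) (f := fun p : ℝ × ℝ => a x p.1 * b p.1 p.2) ?_ ?_
    · exact ((ha.1.comp (measurable_const.prodMk measurable_fst)).mul hb.1).aestronglyMeasurable
    · refine ae_mem_square.mono fun p hp => ?_
      rw [norm_mul]
      exact mul_le_mul (hC x hx' _ hp.1) (hD _ hp.1 _ hp.2) (norm_nonneg _) hC0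

theorem HasKernel.integrable_section {A : L2 0 1 →L[ℂ] L2 0 1} {a : ℝ → ℝ → ℂ}
    (hA : HasKernel A a) : ∀ᵐ x ∂(vol 0 1), MemLp (a x) 2 (vol 0 1) := by
  have h2 : Integrable (fun p : ℝ × ℝ => ‖a p.1 p.2‖ ^ 2) ((vol 0 1).prod (vol 0 1)) :=
    (memLp_two_iff_integrable_sq_norm hA.1.1).1 hA.1
  filter_upwards [hA.1.1.prodMk_left, h2.prod_right_ae] with x h1 h3
  exact (memLp_two_iff_integrable_sq_norm h1).2 h3

theorem HasKernel.add {A B : L2 0 1 →L[ℂ] L2 0 1} {a b : ℝ → ℝ → ℂ} (hA : HasKernel A a)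
    (hB : HasKernel B b) : HasKernel (A + B) (fun x t => a x t + b x t) := by
  refine ⟨hA.1.add hB.1, fun u => ?_⟩
  filter_upwards [hA.2 u, hB.2 u, Lp.coeFn_add (A u) (B u), hA.integrable_section,
    hB.integrable_section] with x h1 h2 h3 h4 h5
  rw [add_apply, h3, Pi.add_apply, h1, h2, ← integral_add
    (integrable_mul_of_memLp h4 (Lp.memLp u)) (integrable_mul_of_memLp h5 (Lp.memLp u))]
  simp only [add_mul]

theorem HasKernel.smul {A : L2 0 1 →L[ℂ] L2 0 1} {a : ℝ → ℝ → ℂ} (c : ℂ) (hA : HasKernel A a) :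
    HasKernel (c • A) (fun x t => c * a x t) := by
  refine ⟨hA.1.const_mul c, fun u => ?_⟩
  filter_upwards [hA.2 u, Lp.coeFn_smul c (A u)] with x h1 h3
  rw [smul_apply, h3, Pi.smul_apply, h1, smul_eq_mul, ← integral_const_mul]
  simp only [mul_assoc]

theorem HasKernel.congr {A : L2 0 1 →L[ℂ] L2 0 1} {a b : ℝ → ℝ → ℂ} (hA : HasKernel A a)
    (h : ∀ᵐ p : ℝ × ℝ ∂((vol 0 1).prod (vol 0 1)), a p.1 p.2 = b p.1 p.2) : HasKernel A b := by
  refine ⟨(memLp_congr_ae h).1 hA.1, fun u => ?_⟩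
  filter_upwards [hA.2 u, Measure.ae_ae_of_ae_prod h] with x h1 h2
  rw [h1]
  exact integral_congr_ae (h2.mono fun t ht => by simp only [ht])

theorem HasKernel.ext {A B : L2 0 1 →L[ℂ] L2 0 1} {a : ℝ → ℝ → ℂ} (hA : HasKernel A a)
    (hB : HasKernel B a) : A = B := by
  ext1 u
  exact Lp.ext ((hA.2 u).trans (hB.2 u).symm)

theorem hasKernel_zero : HasKernel 0 (fun _ _ => 0) :=
  ⟨memLp_const 0, fun u => by simpa using! Lp.coeFn_zero ℂ 2 (vol 0 1)⟩

/-- The kernel of an integral operator is a.e. unique. -/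
theorem HasKernel.ae_eq {A : L2 0 1 →L[ℂ] L2 0 1} {a b : ℝ → ℝ → ℂ} (hA : HasKernel A a)
    (hB : HasKernel A b) :
    ∀ᵐ p : ℝ × ℝ ∂((vol 0 1).prod (vol 0 1)), a p.1 p.2 = b p.1 p.2 := by
  set μ := (vol 0 1).prod (vol 0 1)
  set d : ℝ × ℝ → ℂ := fun p => a p.1 p.2 - b p.1 p.2 with hd
  have hdi : Integrable d μ := (hA.1.sub hB.1).integrable (by norm_num)
  have hrect : ∀ s t : Set ℝ, MeasurableSet s → MeasurableSet t → ∫ p in s ×ˢ t, d p ∂μ = 0 := by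
    intro s t hs ht
    rw [setIntegral_prod _ hdi.integrableOn]
    refine integral_eq_zero_of_ae (ae_restrict_of_ae ?_)
    have hfin : vol 0 1 t ≠ ⊤ := measure_ne_top _ _
    filter_upwards [hA.2 (indicatorConstLp 2 ht hfin (1 : ℂ)),
      hB.2 (indicatorConstLp 2 ht hfin (1 : ℂ)), hA.integrable_section,
      hB.integrable_section] with x h1 h2 h3 h4
    have e : ∀ c : ℝ → ℂ, ∫ y, c y * indicatorConstLp 2 ht hfin (1 : ℂ) y ∂(vol 0 1) =
        ∫ y in t, c y ∂(vol 0 1) := fun c => by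
      rw [← integral_indicator ht]
      refine integral_congr_ae ((indicatorConstLp_coeFn (p := 2) (hs := ht) (hμs := hfin)
        (c := (1 : ℂ))).mono fun y hy => ?_)
      dsimp only
      rw [hy]
      by_cases hyt : y ∈ t <;> simp [hyt]
    rw [h1, e, e] at h2
    simp only [hd, Pi.zero_apply]
    rw [integral_sub (h3.integrable (by norm_num)).integrableOn
      (h4.integrable (by norm_num)).integrableOn, h2, sub_self]
  have hall : ∀ s, MeasurableSet s → ∫ p in s, d p ∂μ = 0 := by
    refine MeasurableSpace.induction_on_inter (C := fun s _ => ∫ p in s, d p ∂μ = 0)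
      generateFrom_prod.symm isPiSystem_prod (by simp) ?_ ?_ ?_
    · rintro _ ⟨s, hs, t, ht, rfl⟩
      exact hrect s t hs ht
    · intro s hs h0
      have h1 := integral_add_compl hs hdi
      have h2 := hrect univ univ .univ .univ
      rw [univ_prod_univ, setIntegral_univ] at h2
      rwa [h0, h2, zero_add] at h1
    · intro s hdis hm h0
      rw [integral_iUnion hm hdis hdi.integrableOn]
      simp [h0]
  have := hdi.ae_eq_zero_of_forall_setIntegral_eq_zero fun s hs _ => hall s hs
  exact this.mono fun p hp => sub_eq_zero.1 hp

/-! ### Uniqueness for Volterra equations -/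

/-- A square integrable solution of a homogeneous Volterra inequality with an integrable
coefficient vanishes. -/
theorem ae_eq_zero_of_volterra {g : ℝ → ℂ} {κ : ℝ → ℝ} (hg : MemLp g 2 (vol 0 1))
    (hκ : Integrable κ (vol 0 1)) (hκ0 : ∀ x, 0 ≤ κ x)
    (h : ∀ᵐ x ∂(vol 0 1), ‖g x‖ ^ 2 ≤ κ x * ∫ t in (0 : ℝ)..x, ‖g t‖ ^ 2) :
    g =ᵐ[vol 0 1] 0 := by
  have hg2 : Integrable (fun x => ‖g x‖ ^ 2) (vol 0 1) :=
    (memLp_two_iff_integrable_sq_norm hg.1).1 hg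
  have hG := (intervalIntegrable_iff_vol zero_le_one).2 hg2
  have hK := (intervalIntegrable_iff_vol zero_le_one).2 hκ
  have sub : ∀ {f : ℝ → ℝ}, IntervalIntegrable f volume 0 1 → ∀ {x y : ℝ}, 0 ≤ x → x ≤ y → y ≤ 1 →
      IntervalIntegrable f volume x y := fun hf x y h0 hxy h1 => hf.mono_set (by
    rw [uIcc_of_le hxy, uIcc_of_le zero_le_one]; exact Icc_subset_Icc h0 h1)
  set G : ℝ → ℝ := fun x => ∫ t in (0 : ℝ)..x, ‖g t‖ ^ 2 with hGdef
  have hcont : ∀ {f : ℝ → ℝ}, IntervalIntegrable f volume 0 1 →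
      ContinuousOn (fun x => ∫ t in (0 : ℝ)..x, f t) (Icc 0 1) := fun {f} hf => by
    have := intervalIntegral.continuousOn_primitive_interval' (a := 0) (b₁ := 0) (b₂ := 1)
      (f := f) (μ := volume) hf left_mem_uIcc
    rwa [uIcc_of_le zero_le_one] at this
  have hGc : ContinuousOn G (Icc 0 1) := hcont hG
  have hsubset : Icc (0 : ℝ) 1 ⊆ {x | G x = 0} := by
    refine IsClosed.Icc_subset_of_forall_exists_gt ?_ (by simp [hGdef]) ?_
    · have : {x | G x = 0} ∩ Icc 0 1 = Icc 0 1 ∩ G ⁻¹' {0} := by ext; simp [and_comm]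
      rw [this]
      exact hGc.preimage_isClosed_of_isClosed isClosed_Icc isClosed_singleton
    rintro x ⟨hx0, hx⟩ y (hy : x < y)
    have hmc := hcont hK
    obtain ⟨δ, hδ, hδ'⟩ := Metric.continuousOn_iff.1 hmc x ⟨hx.1, hx.2.le⟩ (1 / 2) (by norm_num)
    set z := min (min y 1) (x + δ / 2) with hz
    have hxz : x < z := lt_min (lt_min hy hx.2) (by linarith)
    have hz1 : z ≤ 1 := (min_le_left _ _).trans (min_le_right _ _)
    refine ⟨z, ?_, hxz, (min_le_left _ _).trans (min_le_left _ _)⟩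
    have hd := hδ' z ⟨hx.1.trans hxz.le, hz1⟩ (by
      rw [Real.dist_eq, abs_of_pos (by linarith)]
      linarith [min_le_right (min y 1) (x + δ / 2)])
    have hm : ∫ t in x..z, κ t ≤ 1 / 2 := by
      rw [Real.dist_eq, intervalIntegral.integral_interval_sub_left
        (sub hK le_rfl (hx.1.trans hxz.le) hz1) (sub hK le_rfl hx.1 hx.2.le)] at hd
      exact (le_abs_self _).trans hd.le
    have hGz : G z = ∫ t in x..z, ‖g t‖ ^ 2 := by
      have := intervalIntegral.integral_add_adjacent_intervals (sub hG le_rfl hx.1 hx.2.le)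
        (sub hG hx.1 hxz.le hz1)
      have h0 : ∫ t in (0 : ℝ)..x, ‖g t‖ ^ 2 = 0 := hx0
      rw [h0, zero_add] at this
      exact this.symm
    have hGm : ∀ t ∈ Icc x z, G t ≤ G z := fun t ht => by
      have := intervalIntegral.integral_add_adjacent_intervals
        (sub hG le_rfl (hx.1.trans ht.1) (ht.2.trans hz1)) (sub hG (hx.1.trans ht.1) ht.2 hz1)
      have h0 : 0 ≤ ∫ s in t..z, ‖g s‖ ^ 2 :=
        intervalIntegral.integral_nonneg ht.2 fun s _ => by positivity
      have : G z = G t + ∫ s in t..z, ‖g s‖ ^ 2 := this.symm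
      linarith
    have hGz0 : 0 ≤ G z := intervalIntegral.integral_nonneg (hx.1.trans hxz.le)
      fun s _ => by positivity
    have hle : ∫ t in x..z, ‖g t‖ ^ 2 ≤ ∫ t in x..z, κ t * G z := by
      rw [intervalIntegral_eq_integral_vol hxz.le, intervalIntegral_eq_integral_vol hxz.le]
      refine integral_mono_ae ((intervalIntegrable_iff_vol hxz.le).1 (sub hG hx.1 hxz.le hz1))
        (((intervalIntegrable_iff_vol hxz.le).1 (sub hK hx.1 hxz.le hz1)).mul_const _) ?_
      have hae := ae_mono (vol_mono hx.1 hz1) h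
      filter_upwards [hae, ae_restrict_mem measurableSet_Ioo] with t ht ht'
      exact ht.trans (mul_le_mul_of_nonneg_left (hGm t ⟨ht'.1.le, ht'.2.le⟩) (hκ0 t))
    rw [intervalIntegral.integral_mul_const, ← hGz] at hle
    show G z = 0
    nlinarith
  have h1 : ∫ x, ‖g x‖ ^ 2 ∂(vol 0 1) = 0 := by
    rw [← intervalIntegral_eq_integral_vol zero_le_one]
    exact hsubset ⟨zero_le_one, le_rfl⟩
  rw [integral_eq_zero_iff_of_nonneg (fun x => by positivity) hg2] at h1
  exact h1.mono fun x hx => by simpa using hx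

theorem measurePreserving_one_sub : MeasurePreserving (fun x : ℝ => 1 - x) (vol 0 1) (vol 0 1) := by
  have h := (Measure.measurePreserving_sub_left (volume : Measure ℝ) 1).restrict_preimage
    (s := Ioo 0 1) measurableSet_Ioo
  have : (fun x : ℝ => 1 - x) ⁻¹' Ioo 0 1 = Ioo 0 1 := by
    ext x; simp only [mem_preimage, mem_Ioo]; constructor <;> rintro ⟨h1, h2⟩ <;> constructor <;>
      linarith
  rwa [this] at h

/-- The mirror image of `ae_eq_zero_of_volterra`. -/
theorem ae_eq_zero_of_volterra_right {g : ℝ → ℂ} {κ : ℝ → ℝ} (hg : MemLp g 2 (vol 0 1))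
    (hκ : Integrable κ (vol 0 1)) (hκ0 : ∀ x, 0 ≤ κ x)
    (h : ∀ᵐ x ∂(vol 0 1), ‖g x‖ ^ 2 ≤ κ x * ∫ t in x..(1 : ℝ), ‖g t‖ ^ 2) :
    g =ᵐ[vol 0 1] 0 := by
  have mp := measurePreserving_one_sub
  have h1 : (fun x => g (1 - x)) =ᵐ[vol 0 1] 0 := by
    refine ae_eq_zero_of_volterra (κ := fun x => κ (1 - x)) (hg.comp_measurePreserving mp)
      (mp.integrable_comp_of_integrable hκ) (fun x => hκ0 _) ?_
    refine (mp.quasiMeasurePreserving.ae h).mono fun x hx => ?_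
    refine hx.trans (le_of_eq ?_)
    congr 1
    rw [intervalIntegral.integral_comp_sub_left (fun t => ‖g t‖ ^ 2) 1]
    simp
  refine (mp.quasiMeasurePreserving.ae h1).mono fun x hx => ?_
  simpa using hx


/-! ### Density of the cosines -/

/-- The function `x ↦ cos ν x` in `C[0, 2]`. -/
noncomputable def cosMap (ν : ℝ) : C(Icc (0 : ℝ) 2, ℂ) :=
  ⟨fun x => (Real.cos (ν * x) : ℂ), by fun_prop⟩

/-- The linear span of the cosines is a star subalgebra of `C[0, 2]`. -/
noncomputable def cosAlgebra : StarSubalgebra ℂ C(Icc (0 : ℝ) 2, ℂ) :=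
  { (Submodule.span ℂ (range cosMap)).toSubalgebra
      (Submodule.subset_span ⟨0, by ext x; simp [cosMap]⟩)
      (fun f g hf hg => by
        have h : f * g ∈ Submodule.span ℂ (range cosMap) * Submodule.span ℂ (range cosMap) :=
          Submodule.mul_mem_mul hf hg
        rw [Submodule.span_mul_span] at h
        refine (Submodule.span_le.2 ?_) h
        rintro _ ⟨_, ⟨a, rfl⟩, _, ⟨b, rfl⟩, rfl⟩
        have : cosMap a * cosMap b = (1 / 2 : ℂ) • (cosMap (a + b) + cosMap (a - b)) := by
          ext x
          simp only [cosMap, ContinuousMap.mul_apply, ContinuousMap.coe_mk,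
            ContinuousMap.smul_apply,
            ContinuousMap.add_apply, smul_eq_mul, add_mul, sub_mul, Real.cos_add, Real.cos_sub]
          push_cast; ring
        change cosMap a * cosMap b ∈ _
        rw [this]
        exact Submodule.smul_mem _ _ (Submodule.add_mem _ (Submodule.subset_span ⟨_, rfl⟩)
          (Submodule.subset_span ⟨_, rfl⟩))) with
    star_mem' := fun {f} hf => by
      change f ∈ Submodule.span ℂ (range cosMap) at hf
      change star f ∈ Submodule.span ℂ (range cosMap)
      induction hf using Submodule.span_induction with
      | mem x hx =>
        obtain ⟨a, rfl⟩ := hx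
        have : star (cosMap a) = cosMap a := by
          ext x
          simp only [cosMap, ContinuousMap.star_apply, ContinuousMap.coe_mk]
          exact Complex.conj_ofReal _
        rw [this]; exact Submodule.subset_span ⟨a, rfl⟩
      | zero => simp
      | add x y _ _ hx hy => rw [star_add]; exact Submodule.add_mem _ hx hy
      | smul a x _ hx => rw [star_smul]; exact Submodule.smul_mem _ _ hx }

/-- Stone–Weierstrass: every continuous function on `[0, 2]` is a uniform limit of finite linear
combinations of cosines. -/
theorem exists_cos_approx {φ : ℝ → ℂ} (hφ : ContinuousOn φ (Icc 0 2)) {ε : ℝ} (hε : 0 < ε) :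
    ∃ (s : Finset ℝ) (a : ℝ → ℂ), ∀ x ∈ Icc (0 : ℝ) 2,
      ‖φ x - ∑ ν ∈ s, a ν * (Real.cos (ν * x) : ℂ)‖ ≤ ε := by
  have hsep : cosAlgebra.SeparatesPoints := by
    intro x y hxy
    refine ⟨cosMap 1, ⟨cosMap 1, Submodule.subset_span ⟨1, rfl⟩, rfl⟩, fun h => hxy ?_⟩
    simp only [cosMap, ContinuousMap.coe_mk, one_mul, Complex.ofReal_inj] at h
    have hpi := Real.pi_gt_three
    exact Subtype.ext (Real.injOn_cos ⟨x.2.1, x.2.2.trans (by linarith)⟩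
      ⟨y.2.1, y.2.2.trans (by linarith)⟩ h)
  have htop := ContinuousMap.starSubalgebra_topologicalClosure_eq_top_of_separatesPoints _ hsep
  let f : C(Icc (0 : ℝ) 2, ℂ) := ⟨fun x => φ x, hφ.domRestrict⟩
  have hf : f ∈ cosAlgebra.topologicalClosure := by rw [htop]; trivial
  have hf' : f ∈ closure (cosAlgebra : Set C(Icc (0 : ℝ) 2, ℂ)) := hf
  obtain ⟨g, hg, hfg⟩ := Metric.mem_closure_iff.1 hf' ε hε
  have hg' : g ∈ Submodule.span ℂ (range cosMap) := hg
  obtain ⟨c, rfl⟩ := Finsupp.mem_span_range_iff_exists_finsupp.1 hg'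
  refine ⟨c.support, c, fun x hx => ?_⟩
  have := ContinuousMap.dist_apply_le_dist (f := f) (g := c.sum fun i a => a • cosMap i) ⟨x, hx⟩
  rw [dist_eq_norm] at this
  refine le_trans (le_of_eq ?_) (this.trans hfg.le)
  congr 1
  simp [Finsupp.sum, cosMap, f]
  rfl

theorem coeFn_sum (s : Finset ℝ) (F : ℝ → L2 0 1) :
    (∑ ν ∈ s, F ν : L2 0 1) =ᵐ[vol 0 1] ∑ ν ∈ s, (F ν : ℝ → ℂ) := by
  classical
  induction s using Finset.induction_on with
  | empty => simpa using Lp.coeFn_zero ℂ 2 (vol 0 1)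
  | insert a s ha ih =>
    rw [Finset.sum_insert ha, Finset.sum_insert ha]
    exact (Lp.coeFn_add _ _).trans (ih.mono fun x hx => by simp only [Pi.add_apply, hx])

theorem memLp_cos (ν : ℝ) : MemLp (fun x : ℝ => (Real.cos (ν * x) : ℂ)) 2 (vol 0 1) :=
  MemLp.of_bound (by fun_prop) 1 (ae_of_all _ fun x => by
    rw [Complex.norm_real]; exact Real.abs_cos_le_one _)

/-- The function `x ↦ cos ν x` in `L₂(0, 1)`. -/
noncomputable def cosL (ν : ℝ) : L2 0 1 := (memLp_cos ν).toLp _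

theorem cosL_ae (ν : ℝ) : cosL ν =ᵐ[vol 0 1] fun x => (Real.cos (ν * x) : ℂ) :=
  MemLp.coeFn_toLp _

theorem norm_cosL_sub_le (ν : ℝ) : ‖cosL ν - cosL 0‖ ≤ ν ^ 2 / 2 := by
  refine norm_le_of_ae_bound (by positivity) ?_
  filter_upwards [Lp.coeFn_sub (cosL ν) (cosL 0), cosL_ae ν, cosL_ae 0,
    ae_restrict_mem measurableSet_Ioo] with x h1 h2 h3 hx
  rw [h1, Pi.sub_apply, h2, h3, zero_mul, Real.cos_zero, ← Complex.ofReal_sub, Complex.norm_real,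
    Real.norm_eq_abs, abs_sub_comm, abs_of_nonneg (by linarith [Real.cos_le_one (ν * x)])]
  have h4 := Real.one_sub_sq_div_two_le_cos (x := ν * x)
  have : (ν * x) ^ 2 ≤ ν ^ 2 := by
    rw [mul_pow]
    exact mul_le_of_le_one_right (sq_nonneg _) (pow_le_one₀ hx.1.le hx.2.le)
  linarith

/-- Bounded operators which agree on the functions `cos ν x`, `ν ≠ 0`, are equal. -/
theorem ext_cosL {A B : L2 0 1 →L[ℂ] L2 0 1} (h : ∀ ν ≠ 0, A (cosL ν) = B (cosL ν)) : A = B := by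
  have hclosed : IsClosed {u | A u = B u} := isClosed_eq A.continuous B.continuous
  have h0 : A (cosL 0) = B (cosL 0) := by
    suffices hs : Filter.Tendsto (fun n : ℕ => cosL (1 / ((n : ℝ) + 1))) Filter.atTop
        (nhds (cosL 0)) from
      hclosed.mem_of_tendsto hs (Filter.Eventually.of_forall fun n => h _ (by positivity))
    rw [tendsto_iff_norm_sub_tendsto_zero]
    have ht := tendsto_one_div_add_atTop_nhds_zero_nat (𝕜 := ℝ)
    refine squeeze_zero (fun _ => norm_nonneg _) (fun n => norm_cosL_sub_le _) ?_
    have h2 := (ht.pow 2).div_const 2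
    rw [zero_pow two_ne_zero, zero_div] at h2
    exact h2
  have hall : ∀ ν, A (cosL ν) = B (cosL ν) := fun ν => by
    by_cases hν : ν = 0
    · rw [hν, h0]
    · exact h ν hν
  refine ContinuousLinearMap.ext fun u => ?_
  have hd : DenseRange (BoundedContinuousFunction.toLp (E := ℂ) 2 (vol 0 1) ℂ) :=
    BoundedContinuousFunction.toLp_denseRange ℂ (vol 0 1) ℂ (by norm_num)
  refine hd.induction_on (p := fun u => A u = B u) u hclosed fun g => ?_
  have hmem : BoundedContinuousFunction.toLp (E := ℂ) 2 (vol 0 1) ℂ g ∈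
      closure {u | A u = B u} := by
    rw [Metric.mem_closure_iff]
    intro ε hε
    obtain ⟨s, a, hsa⟩ := exists_cos_approx (φ := g) g.continuous.continuousOn (half_pos hε)
    refine ⟨∑ ν ∈ s, a ν • cosL ν, by simp [map_sum, hall], ?_⟩
    rw [dist_eq_norm]
    refine lt_of_le_of_lt (norm_le_of_ae_bound (half_pos hε).le ?_) (half_lt_self hε)
    have hsum : (∑ ν ∈ s, a ν • cosL ν : L2 0 1) =ᵐ[vol 0 1]
        fun x => ∑ ν ∈ s, a ν * (Real.cos (ν * x) : ℂ) := by
      have h1 := coeFn_sum s (fun ν => a ν • cosL ν)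
      have h2 : ∀ᵐ x ∂(vol 0 1), ∀ ν ∈ s, (a ν • cosL ν : L2 0 1) x =
          a ν * (Real.cos (ν * x) : ℂ) := by
        rw [Finset.eventually_all]
        intro ν _
        filter_upwards [Lp.coeFn_smul (a ν) (cosL ν), cosL_ae ν] with x h3 h4
        rw [h3, Pi.smul_apply, h4, smul_eq_mul]
      filter_upwards [h1, h2] with x h3 h4
      rw [h3, Finset.sum_apply]
      exact Finset.sum_congr rfl h4
    filter_upwards [Lp.coeFn_sub (BoundedContinuousFunction.toLp (E := ℂ) 2 (vol 0 1) ℂ g)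
      (∑ ν ∈ s, a ν • cosL ν), hsum, BoundedContinuousFunction.coeFn_toLp (p := 2) (𝕜 := ℂ)
      (vol 0 1) g, ae_restrict_mem measurableSet_Ioo] with x h1 h2 h3 hx
    rw [h1, Pi.sub_apply, h2, h3]
    exact hsa x ⟨hx.1.le, by linarith [hx.2]⟩
  rwa [hclosed.closure_eq] at hmem


/-! ### The operator `T̃_σ` as an integral equation -/

theorem intervalIntegral_congr_vol {f g : ℝ → ℂ} (h : f =ᵐ[vol 0 1] g) {x : ℝ}
    (hx : x ∈ Icc (0 : ℝ) 1) : ∫ t in (0 : ℝ)..x, f t = ∫ t in (0 : ℝ)..x, g t := by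
  rw [intervalIntegral_eq_integral_vol hx.1, intervalIntegral_eq_integral_vol hx.1]
  exact integral_congr_ae (ae_mono (vol_mono le_rfl hx.2) h)

theorem intervalIntegrable_sub {E : Type*} [NormedAddCommGroup E] {f : ℝ → E}
    (hf : Integrable f (vol 0 1)) {x y : ℝ}
    (hx : x ∈ Icc (0 : ℝ) 1) (hy : y ∈ Icc (0 : ℝ) 1) : IntervalIntegrable f volume x y := by
  refine ((intervalIntegrable_iff_vol zero_le_one).2 hf).mono_set ?_
  rw [uIcc_of_le zero_le_one]
  exact uIcc_subset_Icc hx hy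

theorem norm_intervalIntegral_le {f : ℝ → ℂ} (hf : Integrable f (vol 0 1)) {x : ℝ}
    (hx : x ∈ Icc (0 : ℝ) 1) : ‖∫ t in (0 : ℝ)..x, f t‖ ≤ ∫ t, ‖f t‖ ∂(vol 0 1) := by
  rw [intervalIntegral_eq_integral_vol hx.1]
  refine (norm_integral_le_integral_norm _).trans ?_
  exact integral_mono_measure (vol_mono le_rfl hx.2) (ae_of_all _ fun t => norm_nonneg _) hf.norm

theorem eqOn_Icc_of_ae_eq_vol {a b : ℝ} (hab : a < b) {f g : ℝ → ℂ} (h : f =ᵐ[vol a b] g)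
    (hf : ContinuousOn f (Icc a b)) (hg : ContinuousOn g (Icc a b)) : EqOn f g (Icc a b) := by
  refine Measure.eqOn_Icc_of_ae_eq volume hab.ne ?_ hf hg
  rwa [← Measure.restrict_congr_set Ioo_ae_eq_Icc]

/-- The twofold primitive of `g` which vanishes at zero with its derivative. -/
noncomputable def dblPrim (g : ℝ → ℂ) (x : ℝ) : ℂ := ∫ r in (0 : ℝ)..x, ∫ s in (0 : ℝ)..r, g s

theorem continuousOn_prim {g : ℝ → ℂ} (hg : Integrable g (vol 0 1)) :
    ContinuousOn (fun x => ∫ s in (0 : ℝ)..x, g s) (Icc 0 1) := by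
  have := continuousOn_primitive zero_le_one ((intervalIntegrable_iff_vol zero_le_one).2 hg) 0
  simpa using this

theorem integrable_prim {g : ℝ → ℂ} (hg : Integrable g (vol 0 1)) :
    Integrable (fun x => ∫ s in (0 : ℝ)..x, g s) (vol 0 1) := by
  rw [← intervalIntegrable_iff_vol zero_le_one]
  exact ContinuousOn.intervalIntegrable (by rw [uIcc_of_le zero_le_one]; exact continuousOn_prim hg)

theorem continuousOn_dblPrim {g : ℝ → ℂ} (hg : Integrable g (vol 0 1)) :
    ContinuousOn (dblPrim g) (Icc 0 1) :=
  continuousOn_prim (integrable_prim hg)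

theorem norm_dblPrim_le {g : ℝ → ℂ} (hg : Integrable g (vol 0 1)) {x : ℝ}
    (hx : x ∈ Icc (0 : ℝ) 1) : ‖dblPrim g x‖ ≤ ∫ t, ‖g t‖ ∂(vol 0 1) := by
  unfold dblPrim
  have := intervalIntegral.norm_integral_le_of_norm_le_const (a := 0) (b := x)
    (f := fun r => ∫ s in (0 : ℝ)..r, g s) (C := ∫ t, ‖g t‖ ∂(vol 0 1)) (fun r hr => by
      rw [uIoc_of_le hx.1] at hr
      exact norm_intervalIntegral_le hg ⟨hr.1.le, hr.2.trans hx.2⟩)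
  refine this.trans (mul_le_of_le_one_right (integral_nonneg fun _ => norm_nonneg _) ?_)
  rw [sub_zero, abs_of_nonneg hx.1]; exact hx.2

theorem dblPrim_congr {f g : ℝ → ℂ} (h : f =ᵐ[vol 0 1] g) {x : ℝ}
    (hx : x ∈ Icc (0 : ℝ) 1) : dblPrim f x = dblPrim g x := by
  unfold dblPrim
  refine intervalIntegral.integral_congr fun r hr => ?_
  rw [uIcc_of_le hx.1] at hr
  exact intervalIntegral_congr_vol h ⟨hr.1, hr.2.trans hx.2⟩

theorem dblPrim_add {f g : ℝ → ℂ} (hf : Integrable f (vol 0 1)) (hg : Integrable g (vol 0 1))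
    {x : ℝ} (hx : x ∈ Icc (0 : ℝ) 1) :
    dblPrim (fun t => f t + g t) x = dblPrim f x + dblPrim g x := by
  unfold dblPrim
  rw [← intervalIntegral.integral_add
    (intervalIntegrable_sub (integrable_prim hf) (left_mem_Icc.2 zero_le_one) hx)
    (intervalIntegrable_sub (integrable_prim hg) (left_mem_Icc.2 zero_le_one) hx)]
  refine intervalIntegral.integral_congr fun r hr => ?_
  rw [uIcc_of_le hx.1] at hr
  exact intervalIntegral.integral_add
    (intervalIntegrable_sub hf (left_mem_Icc.2 zero_le_one) ⟨hr.1, hr.2.trans hx.2⟩)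
    (intervalIntegrable_sub hg (left_mem_Icc.2 zero_le_one) ⟨hr.1, hr.2.trans hx.2⟩)

theorem dblPrim_const_mul (c : ℂ) (f : ℝ → ℂ) (x : ℝ) :
    dblPrim (fun t => c * f t) x = c * dblPrim f x := by
  simp [dblPrim, intervalIntegral.integral_const_mul]

/-- The operator `u ↦ ∫₀ˣ ∫₀ʳ p u` in `L₂(0, 1)`, for `p ∈ L₂(0, 1)`. -/
noncomputable def dblOp (p : ℝ → ℂ) (hp : MemLp p 2 (vol 0 1)) : L2 0 1 →L[ℂ] L2 0 1 :=
  opOfBound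
    { toFun := fun u => (Icc (0 : ℝ) 1).indicator (dblPrim fun t => p t * u t)
      map_add' := fun u v => by
        ext x
        by_cases hx : x ∈ Icc (0 : ℝ) 1
        · simp only [Pi.add_apply, indicator_of_mem hx]
          rw [← dblPrim_add (integrable_mul_of_memLp hp (Lp.memLp u))
            (integrable_mul_of_memLp hp (Lp.memLp v)) hx]
          exact dblPrim_congr ((Lp.coeFn_add u v).mono fun t ht => by
            simp only [ht, Pi.add_apply, mul_add]) hx
        · simp [indicator_of_notMem hx]
      map_smul' := fun c u => by
        ext x
        by_cases hx : x ∈ Icc (0 : ℝ) 1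
        · simp only [Pi.smul_apply, indicator_of_mem hx, RingHom.id_apply, smul_eq_mul]
          rw [← dblPrim_const_mul]
          exact dblPrim_congr ((Lp.coeFn_smul c u).mono fun t ht => by
            simp only [ht, Pi.smul_apply, smul_eq_mul]; ring) hx
        · simp [indicator_of_notMem hx] }
    (Real.sqrt (∫ a, ‖p a‖ ^ 2 ∂(vol 0 1)))
    (fun u => by
      have hc := continuousOn_dblPrim (integrable_mul_of_memLp hp (Lp.memLp u))
      have h1 : AEStronglyMeasurable (dblPrim fun t => p t * u t) (vol 0 1) :=
        (hc.mono Ioo_subset_Icc_self).aestronglyMeasurable measurableSet_Ioo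
      exact h1.indicator measurableSet_Icc)
    (fun u x hx => by
      have hx' := Ioo_subset_Icc_self hx
      simp only [LinearMap.coe_mk, AddHom.coe_mk]
      rw [indicator_of_mem hx']
      refine (norm_dblPrim_le (integrable_mul_of_memLp hp (Lp.memLp u)) hx').trans ?_
      simp_rw [norm_mul]
      exact norm_integral_mul_le hp u)

theorem dblOp_ae (p : ℝ → ℂ) (hp : MemLp p 2 (vol 0 1)) (u : L2 0 1) :
    dblOp p hp u =ᵐ[vol 0 1] dblPrim fun t => p t * u t := by
  unfold dblOp
  filter_upwards [opOfBound_ae u, ae_restrict_mem measurableSet_Ioo] with x hx hx'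
  exact hx.trans (indicator_of_mem (Ioo_subset_Icc_self hx') _)

/-- The twofold integration operator in `L₂(0, 1)`. -/
noncomputable def dblInt : L2 0 1 →L[ℂ] L2 0 1 := dblOp (fun _ => 1) (memLp_const 1)

theorem dblInt_ae (u : L2 0 1) : dblInt u =ᵐ[vol 0 1] dblPrim u := by
  have := dblOp_ae (fun _ => 1) (memLp_const 1) u
  simp only [one_mul] at this
  exact this

theorem dblOp_sub_smul (p : ℝ → ℂ) (hp : MemLp p 2 (vol 0 1)) (c : ℂ) (u : L2 0 1) :
    dblOp p hp u - c • dblInt u = dblOp (fun x => p x - c) (hp.sub (memLp_const c)) u := by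
  refine Lp.ext ?_
  filter_upwards [Lp.coeFn_sub (dblOp p hp u) (c • dblInt u), Lp.coeFn_smul c (dblInt u),
    dblOp_ae p hp u, dblInt_ae u, dblOp_ae (fun x => p x - c) (hp.sub (memLp_const c)) u,
    ae_restrict_mem measurableSet_Ioo] with x h1 h2 h3 h4 h5 hx
  have hx' := Ioo_subset_Icc_self hx
  rw [h1, Pi.sub_apply, h2, Pi.smul_apply, h3, h4, h5, smul_eq_mul]
  have e : (fun t => (p t - c) * u t) = fun t => p t * u t + (-c) * u t := by ext t; ring
  rw [e, dblPrim_add (integrable_mul_of_memLp hp (Lp.memLp u)) (u.integrable.const_mul _) hx',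
    dblPrim_const_mul]
  ring

theorem integrable_sq_norm {p : ℝ → ℂ} (hp : MemLp p 2 (vol 0 1)) :
    Integrable (fun x => ‖p x‖ ^ 2) (vol 0 1) := (memLp_two_iff_integrable_sq_norm hp.1).1 hp

/-- The homogeneous Cauchy problem has only the trivial solution. -/
theorem eq_zero_of_eq_dblOp {p : ℝ → ℂ} {hp : MemLp p 2 (vol 0 1)} {u : L2 0 1}
    (h : u = dblOp p hp u) : u = 0 := by
  have h1 : (u : ℝ → ℂ) =ᵐ[vol 0 1] 0 := by
    refine ae_eq_zero_of_volterra (Lp.memLp u)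
      (integrable_const (∫ a, ‖p a‖ ^ 2 ∂(vol 0 1)))
      (fun _ => integral_nonneg fun _ => by positivity) ?_
    have h2 := dblOp_ae p hp u
    rw [← h] at h2
    filter_upwards [h2, ae_restrict_mem measurableSet_Ioo] with x hx hx'
    have hint := integrable_mul_of_memLp hp (Lp.memLp u)
    have hle : vol 0 x ≤ vol 0 1 := vol_mono le_rfl hx'.2.le
    have hb : ‖u x‖ ≤ ∫ t, ‖p t‖ * ‖u t‖ ∂(vol 0 x) := by
      rw [hx]
      unfold dblPrim
      have := intervalIntegral.norm_integral_le_of_norm_le_const (a := 0) (b := x)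
        (f := fun r => ∫ s in (0 : ℝ)..r, p s * u s) (C := ∫ t, ‖p t‖ * ‖u t‖ ∂(vol 0 x))
        (fun r hr => by
          rw [uIoc_of_le hx'.1.le] at hr
          rw [intervalIntegral_eq_integral_vol hr.1.le]
          refine (norm_integral_le_integral_norm _).trans ?_
          simp_rw [norm_mul]
          refine integral_mono_measure (vol_mono le_rfl hr.2)
            (ae_of_all _ fun t => by positivity) ?_
          have := (hint.mono_measure hle).norm
          simpa only [norm_mul] using this)
      refine this.trans (mul_le_of_le_one_right (integral_nonneg fun _ => by positivity) ?_)
      rw [sub_zero, abs_of_nonneg hx'.1.le]; exact hx'.2.le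
    calc ‖u x‖ ^ 2 ≤ (∫ t, ‖p t‖ * ‖u t‖ ∂(vol 0 x)) ^ 2 := by gcongr
      _ ≤ _ := integral_mul_norm_sq_le (hp.mono_measure hle) ((Lp.memLp u).mono_measure hle)
      _ ≤ _ := by
        rw [intervalIntegral_eq_integral_vol hx'.1.le]
        refine mul_le_mul_of_nonneg_right ?_ (integral_nonneg fun _ => by positivity)
        exact integral_mono_measure hle (ae_of_all _ fun t => by positivity)
          (integrable_sq_norm hp)
  exact Lp.ext (h1.trans (Lp.coeFn_zero ℂ 2 (vol 0 1)).symm)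

/-- For `σ = h + ∫ q ∈ W¹₂(0, 1)`, the relation `T̃_σ y = f` means that `y'' = q y - f` and
`y'(0) = h y(0)`. -/
theorem isTildeT_iff {σ : L2 0 1} {h : ℂ} {q : ℝ → ℂ} (hq : MemLp q 2 (vol 0 1))
    (hσ : σ =ᵐ[vol 0 1] fun x => h + ∫ s in (0 : ℝ)..x, q s) (y f : L2 0 1) :
    IsTildeT σ y f ↔ ∃ c : ℂ, y =ᵐ[vol 0 1] fun x =>
      c + ∫ r in (0 : ℝ)..x, (c * h + ∫ s in (0 : ℝ)..r, (q s * y s - f s)) := by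
  have hqi : Integrable q (vol 0 1) := hq.integrable (by norm_num)
  have hqy : Integrable (fun s => q s * y s) (vol 0 1) := integrable_mul_of_memLp hq (Lp.memLp y)
  have hqyf : Integrable (fun s => q s * y s - f s) (vol 0 1) := hqy.sub f.integrable
  have h01 : (0 : ℝ) ∈ Icc (0 : ℝ) 1 := left_mem_Icc.2 zero_le_one
  have hSc := continuousOn_primitive zero_le_one ((intervalIntegrable_iff_vol zero_le_one).2 hqi) h
  have hbd : ∀ {F v : ℝ → ℂ}, ContinuousOn F (Icc 0 1) → Integrable v (vol 0 1) →
      Integrable (fun x => F x * v x) (vol 0 1) := fun {F v} hF hv => by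
    rw [← intervalIntegrable_iff_vol zero_le_one] at hv ⊢
    exact hv.continuousOn_mul (by rwa [uIcc_of_le zero_le_one])
  constructor
  · rintro ⟨y₁, w, w₁, hy, hw, hwc, hww, hw0, hf⟩
    obtain ⟨c, hc⟩ := hy.ae_eq_primitive zero_lt_one
    obtain ⟨c', hc'⟩ := hww.ae_eq_primitive zero_lt_one
    have hw₁ := hww.2.1
    have hy₁ := hy.2.1
    have heq := eqOn_Icc_of_ae_eq_vol zero_lt_one hc' hwc
      (continuousOn_primitive zero_le_one ((intervalIntegrable_iff_vol zero_le_one).2 hw₁) c')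
    have hc'0 : c' = 0 := by
      have := heq h01
      simpa [hw0] using this.symm
    subst hc'0
    have hyc := continuousOn_primitive zero_le_one
      ((intervalIntegrable_iff_vol zero_le_one).2 hy₁) c
    have hy₁' : y₁ =ᵐ[vol 0 1] fun x => c * h + ∫ s in (0 : ℝ)..x, (q s * y s - f s) := by
      filter_upwards [hw, hσ, hc, ae_restrict_mem measurableSet_Ioo] with x h1 h2 h3 hx
      have hx' := Ioo_subset_Icc_self hx
      have e1 : y₁ x = w x + σ x * y x := by rw [h1]; ring
      have e2 : w x = ∫ s in (0 : ℝ)..x, w₁ s := (heq hx').trans (zero_add _)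
      rw [e1, h2, h3, e2, primitive_mul_primitive hx.1.le h c
        (intervalIntegrable_sub hqi h01 hx') (intervalIntegrable_sub hy₁ h01 hx')]
      have hint : Integrable (fun x => q x * (c + ∫ s in (0 : ℝ)..x, y₁ s) +
          (h + ∫ s in (0 : ℝ)..x, q s) * y₁ x) (vol 0 1) := by
        refine Integrable.add ?_ (hbd hSc hy₁)
        have := hbd hyc hqi
        simpa only [mul_comm] using this
      rw [← add_assoc, add_comm _ (h * c), add_assoc, mul_comm h c, ← intervalIntegral.integral_add
        (intervalIntegrable_sub hw₁ h01 hx') (intervalIntegrable_sub hint h01 hx')]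
      congr 1
      refine intervalIntegral_congr_vol ?_ hx'
      filter_upwards [hσ, hc, hf] with s h4 h5 h6
      rw [h6, ← h4, h5]; ring
    refine ⟨c, ?_⟩
    filter_upwards [hc, ae_restrict_mem measurableSet_Ioo] with x hx hx'
    rw [hx, intervalIntegral_congr_vol hy₁' (Ioo_subset_Icc_self hx')]
  · rintro ⟨c, hc⟩
    set y₁ : ℝ → ℂ := fun x => c * h + ∫ s in (0 : ℝ)..x, (q s * y s - f s) with hy₁d
    set Y : ℝ → ℂ := fun x => c + ∫ s in (0 : ℝ)..x, y₁ s with hYd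
    set S : ℝ → ℂ := fun x => h + ∫ s in (0 : ℝ)..x, q s with hSd
    have hy₁c : ContinuousOn y₁ (Icc 0 1) :=
      continuousOn_primitive zero_le_one ((intervalIntegrable_iff_vol zero_le_one).2 hqyf) _
    have hy₁ : Integrable y₁ (vol 0 1) := by
      rw [← intervalIntegrable_iff_vol zero_le_one]
      exact ContinuousOn.intervalIntegrable (by rwa [uIcc_of_le zero_le_one])
    have hYc : ContinuousOn Y (Icc 0 1) :=
      continuousOn_primitive zero_le_one ((intervalIntegrable_iff_vol zero_le_one).2 hy₁) _
    have hw₁ : Integrable (fun x => -f x - S x * y₁ x) (vol 0 1) :=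
      f.integrable.neg.sub (hbd hSc hy₁)
    have hweq : ∀ x ∈ Icc (0 : ℝ) 1, y₁ x - S x * Y x =
        0 + ∫ s in (0 : ℝ)..x, (-f s - S s * y₁ s) := by
      intro x hx
      have hint : Integrable (fun x => q x * Y x + S x * y₁ x) (vol 0 1) := by
        refine Integrable.add ?_ (hbd hSc hy₁)
        have := hbd hYc hqi
        simpa only [mul_comm] using this
      have e := primitive_mul_primitive hx.1 h c
        (intervalIntegrable_sub hqi h01 hx) (intervalIntegrable_sub hy₁ h01 hx)
      have e' : S x * Y x = h * c + ∫ s in (0 : ℝ)..x, (q s * Y s + S s * y₁ s) := e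
      rw [e']
      have : y₁ x = c * h + ∫ s in (0 : ℝ)..x, (q s * y s - f s) := rfl
      rw [this, mul_comm c h, add_sub_add_left_eq_sub, ← intervalIntegral.integral_sub
        (intervalIntegrable_sub hqyf h01 hx) (intervalIntegrable_sub hint h01 hx), zero_add]
      refine intervalIntegral_congr_vol ?_ hx
      filter_upwards [hc] with s hs
      have : y s = Y s := hs
      rw [this]; ring
    refine ⟨y₁, fun x => y₁ x - S x * Y x, fun x => -f x - S x * y₁ x, ?_, ?_, ?_, ?_, ?_, ?_⟩
    · exact (hasWeakDeriv_primitive zero_lt_one c hy₁).congr hc.symm (ae_eq_refl _)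
    · filter_upwards [hσ, hc] with x h1 h2
      rw [h1, h2]
    · exact hy₁c.sub (hSc.mul hYc)
    · refine (hasWeakDeriv_primitive zero_lt_one 0 hw₁).congr ?_ (ae_eq_refl _)
      filter_upwards [ae_restrict_mem measurableSet_Ioo] with x hx
      exact (hweq x (Ioo_subset_Icc_self hx)).symm
    · exact (hweq 0 h01).trans (by simp)
    · filter_upwards [hσ] with x hx
      rw [hx]; ring

theorem memLp_linear (h : ℂ) : MemLp (fun x : ℝ => 1 + h * x) 2 (vol 0 1) :=
  MemLp.of_bound (by fun_prop) (1 + ‖h‖) ((ae_restrict_mem measurableSet_Ioo).mono fun x hx => by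
    refine (norm_add_le _ _).trans ?_
    rw [norm_one, norm_mul, Complex.norm_real, Real.norm_eq_abs, abs_of_pos hx.1]
    gcongr
    exact mul_le_of_le_one_right (norm_nonneg _) hx.2.le)

/-- The function `1 + h x` in `L₂(0, 1)`. -/
noncomputable def linearL (h : ℂ) : L2 0 1 := (memLp_linear h).toLp _

theorem linearL_ae (h : ℂ) : linearL h =ᵐ[vol 0 1] fun x => 1 + h * x := MemLp.coeFn_toLp _

theorem linearL_zero : linearL 0 = cosL 0 := by
  refine Lp.ext ?_
  filter_upwards [linearL_ae 0, cosL_ae 0] with x h1 h2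
  rw [h1, h2]; simp

/-- The relation `T̃_σ y = f` in terms of bounded operators. -/
theorem isTildeT_iff_eq {σ : L2 0 1} {h : ℂ} {q : ℝ → ℂ} (hq : MemLp q 2 (vol 0 1))
    (hσ : σ =ᵐ[vol 0 1] fun x => h + ∫ s in (0 : ℝ)..x, q s) (y f : L2 0 1) :
    IsTildeT σ y f ↔ ∃ c : ℂ, y = c • linearL h + dblOp q hq y - dblInt f := by
  rw [isTildeT_iff hq hσ]
  refine exists_congr fun c => ?_
  have key : (c • linearL h + dblOp q hq y - dblInt f : L2 0 1) =ᵐ[vol 0 1] fun x =>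
      c + ∫ r in (0 : ℝ)..x, (c * h + ∫ s in (0 : ℝ)..r, (q s * y s - f s)) := by
    have hqy := integrable_mul_of_memLp hq (Lp.memLp y)
    filter_upwards [Lp.coeFn_sub (c • linearL h + dblOp q hq y) (dblInt f),
      Lp.coeFn_add (c • linearL h) (dblOp q hq y), Lp.coeFn_smul c (linearL h), linearL_ae h,
      dblOp_ae q hq y, dblInt_ae f, ae_restrict_mem measurableSet_Ioo] with x h1 h2 h3 h4 h5 h6 hx
    have hx' := Ioo_subset_Icc_self hx
    rw [h1, Pi.sub_apply, h2, Pi.add_apply, h3, Pi.smul_apply, h4, h5, h6]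
    have e : dblPrim (fun t => q t * y t - f t) x =
        dblPrim (fun t => q t * y t) x - dblPrim f x := by
      have e1 : (fun t => q t * y t - f t) = fun t => q t * y t + (-1) * f t := by ext t; ring
      rw [e1, dblPrim_add hqy (f.integrable.const_mul _) hx', dblPrim_const_mul]; ring
    rw [intervalIntegral.integral_add (f := fun _ => c * h)
      (g := fun r => ∫ s in (0 : ℝ)..r, (q s * y s - f s)) intervalIntegrable_const
      (intervalIntegrable_sub (integrable_prim (hqy.sub f.integrable))
        (left_mem_Icc.2 zero_le_one) hx')]
    have e2 : ∫ r in (0 : ℝ)..x, ∫ s in (0 : ℝ)..r, (q s * y s - f s) =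
        dblPrim (fun t => q t * y t - f t) x := rfl
    rw [e2, e]
    simp only [smul_eq_mul, intervalIntegral.integral_const, sub_zero, Complex.real_smul]
    ring
  constructor
  · exact fun hy => Lp.ext (hy.trans key.symm)
  · intro hy
    refine Filter.EventuallyEq.trans (Filter.EventuallyEq.of_eq ?_) key
    exact congrArg (fun v : L2 0 1 => (v : ℝ → ℂ)) hy

theorem isTildeT_zero_iff (u f : L2 0 1) :
    IsTildeT 0 u f ↔ ∃ c : ℂ, u = c • cosL 0 - dblInt f := by
  rw [isTildeT_iff_eq (h := 0) (q := fun _ => 0) (memLp_const 0)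
    (by simpa using! Lp.coeFn_zero ℂ 2 (vol 0 1))]
  refine exists_congr fun c => ?_
  have : dblOp (fun _ => 0) (memLp_const 0) u = 0 := by
    refine Lp.ext ((dblOp_ae _ _ u).trans ?_)
    filter_upwards [Lp.coeFn_zero ℂ 2 (vol 0 1)] with x hx
    rw [hx]; simp [dblPrim]
  rw [this, linearL_zero, add_zero]

theorem cos_eq_dblPrim (ν x : ℝ) : (Real.cos (ν * x) : ℂ) =
    1 - ν ^ 2 * dblPrim (fun t => (Real.cos (ν * t) : ℂ)) x := by
  have h1 : ∀ r : ℝ, (ν : ℂ) * ∫ s in (0 : ℝ)..r, (Real.cos (ν * s) : ℂ) = Real.sin (ν * r) := by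
    intro r
    have hd : ∀ s : ℝ, HasDerivAt (fun s : ℝ => (Real.sin (ν * s) : ℂ))
        ((ν : ℂ) * (Real.cos (ν * s) : ℂ)) s := fun s => by
      have := ((Real.hasDerivAt_sin (ν * s)).comp s ((hasDerivAt_id s).const_mul ν)).ofReal_comp
      refine this.congr_deriv ?_
      push_cast; ring
    rw [← intervalIntegral.integral_const_mul, intervalIntegral.integral_eq_sub_of_hasDerivAt
      (fun s _ => hd s) (Continuous.intervalIntegrable (by fun_prop) _ _)]
    simp
  have hd : ∀ s : ℝ, HasDerivAt (fun s : ℝ => -(Real.cos (ν * s) : ℂ))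
      ((ν : ℂ) * (Real.sin (ν * s) : ℂ)) s := fun s => by
    have := ((Real.hasDerivAt_cos (ν * s)).comp s ((hasDerivAt_id s).const_mul ν)).ofReal_comp.neg
    refine this.congr_deriv ?_
    push_cast; ring
  have h2 : (ν : ℂ) ^ 2 * dblPrim (fun t => (Real.cos (ν * t) : ℂ)) x =
      ∫ r in (0 : ℝ)..x, (ν : ℂ) * (Real.sin (ν * r) : ℂ) := by
    unfold dblPrim
    rw [← intervalIntegral.integral_const_mul]
    refine intervalIntegral.integral_congr fun r _ => ?_
    simp only [← h1]; ring
  rw [h2, intervalIntegral.integral_eq_sub_of_hasDerivAt (fun s _ => hd s)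
      (Continuous.intervalIntegrable (by fun_prop) _ _)]
  simp

theorem cosL_eq (ν : ℝ) : cosL ν = cosL 0 - (ν ^ 2 : ℂ) • dblInt (cosL ν) := by
  refine Lp.ext ?_
  filter_upwards [Lp.coeFn_sub (cosL 0) ((ν ^ 2 : ℂ) • dblInt (cosL ν)),
    Lp.coeFn_smul (ν ^ 2 : ℂ) (dblInt (cosL ν)), dblInt_ae (cosL ν), cosL_ae 0, cosL_ae ν,
    ae_restrict_mem measurableSet_Ioo] with x h1 h2 h3 h4 h5 hx
  rw [h1, Pi.sub_apply, h2, Pi.smul_apply, h3, h4, h5,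
    dblPrim_congr (cosL_ae ν) (Ioo_subset_Icc_self hx), cos_eq_dblPrim ν x]
  simp

theorem cosL_ne_zero (ν : ℝ) : cosL ν ≠ 0 := by
  intro h
  have h1 : (fun x : ℝ => (Real.cos (ν * x) : ℂ)) =ᵐ[vol 0 1] fun _ => 0 := by
    refine (cosL_ae ν).symm.trans ?_
    rw [h]; exact Lp.coeFn_zero ℂ 2 (vol 0 1)
  have := eqOn_Icc_of_ae_eq_vol zero_lt_one h1 (by fun_prop) (by fun_prop)
    (left_mem_Icc.2 zero_le_one)
  simp at this

/-! ### Characterization of the transformation operator -/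

/-- The functions `z = (I + K) cos ν x` solve the Cauchy problems `z'' = (q - ν²) z`, `z(0) = 1`,
`z'(0) = h`. -/
def IntertwinesOp (h : ℂ) (q : ℝ → ℂ) (hq : MemLp q 2 (vol 0 1)) (K : L2 0 1 →L[ℂ] L2 0 1) :
    Prop :=
  ∀ ν : ℝ, cosL ν + K (cosL ν) = linearL h + dblOp q hq (cosL ν + K (cosL ν)) -
    (ν ^ 2 : ℂ) • dblInt (cosL ν + K (cosL ν))

/-- Intertwining on the cosines is enough. Write `J` for the twofold integration, `Q` for `dblOp q`
and `D = (I - Q)(I + K)`. The hypothesis for `ν = 0` gives `D 1 = 1 + h x`, and by density of the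
cosines `D J = J (I + K)`. Since `T̃_σ y = g` means `(I - Q) y = c (1 + h x) - J g` and
`T̃_0 u = f` means `u = c - J f`, the two sides of `T̃_σ (I + K) = (I + K) T̃_0` agree. -/
theorem IntertwinesOp.isTransformation {σ : L2 0 1} {h : ℂ} {q : ℝ → ℂ}
    {hq : MemLp q 2 (vol 0 1)} (hσ : σ =ᵐ[vol 0 1] fun x => h + ∫ s in (0 : ℝ)..x, q s)
    {K : L2 0 1 →L[ℂ] L2 0 1} (hK : IntertwinesOp h q hq K) (hV : IsVolterraPlus K)
    (hunit : IsUnit (1 + K)) : IsTransformation σ K := by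
  refine ⟨hV, fun u g => ?_⟩
  set D : L2 0 1 →L[ℂ] L2 0 1 := (1 - dblOp q hq) * (1 + K) with hD
  have hDa : ∀ v, D v = (v + K v) - dblOp q hq (v + K v) := fun v => rfl
  have hD1 : D (cosL 0) = linearL h := by
    have := hK 0
    rw [hDa, sub_eq_iff_eq_add]
    simpa using this
  have hDJ : D * dblInt = dblInt * (1 + K) := by
    refine ext_cosL fun ν hν => ?_
    have e1 : D (cosL ν) = linearL h - (ν ^ 2 : ℂ) • dblInt (cosL ν + K (cosL ν)) := by
      have h1 := hK ν
      rw [hDa, sub_eq_iff_eq_add]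
      refine h1.trans ?_
      abel
    have e2 : D (cosL ν) = linearL h - (ν ^ 2 : ℂ) • D (dblInt (cosL ν)) := by
      conv_lhs => rw [cosL_eq ν]
      rw [map_sub, hD1, map_smul]
    have e3 : (ν ^ 2 : ℂ) • D (dblInt (cosL ν)) =
        (ν ^ 2 : ℂ) • dblInt (cosL ν + K (cosL ν)) := by
      rw [e1] at e2; exact (sub_right_injective e2).symm
    have hν2 : (ν ^ 2 : ℂ) ≠ 0 := by exact_mod_cast pow_ne_zero 2 hν
    exact smul_right_injective _ hν2 e3
  have hDinj : Function.Injective D := by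
    rw [injective_iff_map_eq_zero]
    intro v hv
    rw [hDa, sub_eq_zero] at hv
    have h0 := eq_zero_of_eq_dblOp hv
    obtain ⟨U, hU⟩ := hunit
    have h1 : (1 + K) v = 0 := h0
    have h2 : ((↑U⁻¹ : L2 0 1 →L[ℂ] L2 0 1) * (1 + K)) v = 0 := by
      rw [mul_apply_eq_comp, h1, map_zero]
    rw [← hU, Units.inv_mul] at h2
    exact h2
  rw [isTildeT_iff_eq hq hσ]
  have hDform : ∀ c : ℂ, u + K u = c • linearL h + dblOp q hq (u + K u) - dblInt g ↔
      D u = c • linearL h - dblInt g := fun c => by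
    rw [hDa, sub_eq_iff_eq_add]
    constructor <;> intro h <;> refine h.trans ?_ <;> abel
  simp only [hDform, isTildeT_zero_iff]
  have hJK : ∀ f, D (dblInt f) = dblInt (f + K f) := fun f =>
    congrArg (fun A : L2 0 1 →L[ℂ] L2 0 1 => A f) hDJ
  constructor
  · rintro ⟨c, hc⟩
    obtain ⟨U, hU⟩ := hunit
    set f := (↑U⁻¹ : L2 0 1 →L[ℂ] L2 0 1) g
    have hg : g = f + K f := by
      have : ((1 + K) * (↑U⁻¹ : L2 0 1 →L[ℂ] L2 0 1)) g = g := by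
        rw [← hU, Units.mul_inv]; rfl
      exact this.symm
    refine ⟨f, ⟨c, hDinj ?_⟩, hg⟩
    rw [hc, map_sub, map_smul, hD1, hJK, ← hg]
  · rintro ⟨f, ⟨c, hc⟩, hg⟩
    refine ⟨c, ?_⟩
    rw [hc, map_sub, map_smul, hD1, hJK, ← hg]

theorem IsVolterraPlus.ae_norm_sq_le {A : L2 0 1 →L[ℂ] L2 0 1} {k : ℝ → ℝ → ℂ}
    (hA : HasKernel A k)
    (hk : ∀ᵐ p : ℝ × ℝ ∂((vol 0 1).prod (vol 0 1)), p.1 < p.2 → k p.1 p.2 = 0) (u : L2 0 1) :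
    ∀ᵐ x ∂(vol 0 1), ‖A u x‖ ^ 2 ≤ (∫ t, ‖k x t‖ ^ 2 ∂(vol 0 1)) *
      ∫ t in (0 : ℝ)..x, ‖u t‖ ^ 2 := by
  filter_upwards [hA.2 u, Measure.ae_ae_of_ae_prod hk, hA.integrable_section,
    ae_restrict_mem measurableSet_Ioo] with x h1 h2 h3 hx
  have hle : vol 0 x ≤ vol 0 1 := vol_mono le_rfl hx.2.le
  have e : A u x = ∫ t, k x t * u t ∂(vol 0 x) := by
    rw [h1]
    symm
    have hv : vol 0 x = (vol 0 1).restrict (Iio x) := by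
      rw [vol, vol, Measure.restrict_restrict measurableSet_Iio]
      congr 1; ext y; simp only [mem_Ioo, mem_inter_iff, mem_Iio]
      exact ⟨fun h => ⟨h.2, h.1, h.2.trans hx.2⟩, fun h => ⟨h.2.1, h.1⟩⟩
    rw [hv]
    refine setIntegral_eq_integral_of_ae_compl_eq_zero ?_
    have hne : ∀ᵐ t ∂(vol 0 1), t ≠ x := ae_restrict_of_ae (by simp [ae_iff])
    filter_upwards [h2, hne] with t ht hne' htx
    rw [ht (lt_of_le_of_ne (not_lt.1 htx) (Ne.symm hne')), zero_mul]
  rw [e]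
  refine (norm_integral_mul_sq_le (h3.mono_measure hle) ((Lp.memLp u).mono_measure hle)).trans ?_
  rw [intervalIntegral_eq_integral_vol hx.1.le]
  exact mul_le_mul_of_nonneg_right (integral_mono_measure hle
    (ae_of_all _ fun t => by positivity) (integrable_sq_norm h3))
    (integral_nonneg fun _ => by positivity)

theorem HasKernel.integrable_sq_section {A : L2 0 1 →L[ℂ] L2 0 1} {k : ℝ → ℝ → ℂ}
    (hA : HasKernel A k) : Integrable (fun x => ∫ t, ‖k x t‖ ^ 2 ∂(vol 0 1)) (vol 0 1) :=
  ((memLp_two_iff_integrable_sq_norm hA.1.1).1 hA.1).integral_prod_left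

/-- A Volterra operator has no nonzero eigenvalues. -/
theorem IsVolterraPlus.eq_zero_of_eq {A : L2 0 1 →L[ℂ] L2 0 1} (hA : IsVolterraPlus A) {u : L2 0 1}
    {c : ℂ} (hc : c ≠ 0) (h : A u = c • u) : u = 0 := by
  obtain ⟨k, hk, hk0⟩ := hA
  have h1 : (u : ℝ → ℂ) =ᵐ[vol 0 1] 0 := by
    refine ae_eq_zero_of_volterra (Lp.memLp u)
      (hk.integrable_sq_section.const_mul ((‖c‖ ^ 2)⁻¹))
      (fun x => mul_nonneg (by positivity) (integral_nonneg fun _ => by positivity)) ?_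
    filter_upwards [IsVolterraPlus.ae_norm_sq_le hk hk0 u, Lp.coeFn_smul c u] with x h2 h3
    rw [h, h3, Pi.smul_apply, norm_smul, mul_pow] at h2
    have hcp : 0 < ‖c‖ ^ 2 := by positivity
    rw [mul_assoc, ← div_eq_inv_mul, le_div_iff₀ hcp, mul_comm]
    exact h2
  exact Lp.ext (h1.trans (Lp.coeFn_zero ℂ 2 (vol 0 1)).symm)

theorem IsVolterraPlus.linearComb {A B : L2 0 1 →L[ℂ] L2 0 1} (hA : IsVolterraPlus A)
    (hB : IsVolterraPlus B) (c d : ℂ) : IsVolterraPlus (c • A + d • B) := by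
  obtain ⟨k, hk, hk0⟩ := hA
  obtain ⟨l, hl, hl0⟩ := hB
  refine ⟨_, (hk.smul c).add (hl.smul d), ?_⟩
  filter_upwards [hk0, hl0] with p h1 h2 hp
  rw [h1 hp, h2 hp]; simp

/-- The transformation operator is unique: by uniqueness for the Cauchy problem,
`(I + K') cos ν x = a (I + K) cos ν x` for some number `a`, and `a = 1` as a Volterra operator has
no nonzero eigenvalues. -/
theorem IntertwinesOp.unique {σ : L2 0 1} {h : ℂ} {q : ℝ → ℂ}
    {hq : MemLp q 2 (vol 0 1)} (hσ : σ =ᵐ[vol 0 1] fun x => h + ∫ s in (0 : ℝ)..x, q s)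
    {K K' : L2 0 1 →L[ℂ] L2 0 1} (hK : IntertwinesOp h q hq K) (hV : IsVolterraPlus K)
    (hK' : IsTransformation σ K') : K' = K := by
  refine ext_cosL fun ν _ => ?_
  have h0 : IsTildeT 0 (cosL ν) ((ν ^ 2 : ℂ) • cosL ν) := by
    rw [isTildeT_zero_iff]
    exact ⟨1, by rw [one_smul, map_smul]; exact cosL_eq ν⟩
  have h1 := (hK'.2 (cosL ν) _).2 ⟨_, h0, rfl⟩
  rw [isTildeT_iff_eq hq hσ] at h1
  obtain ⟨a, ha⟩ := h1
  set z' := cosL ν + K' (cosL ν) with hz'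
  set z := cosL ν + K (cosL ν) with hz
  have ha' : z' = a • linearL h + dblOp q hq z' - (ν ^ 2 : ℂ) • dblInt z' := by
    rw [map_smul, ← smul_add, map_smul] at ha
    exact ha
  have hzz : z = linearL h + dblOp q hq z - (ν ^ 2 : ℂ) • dblInt z := hK ν
  have hd : z' - a • z = 0 := by
    refine eq_zero_of_eq_dblOp (p := fun x => q x - (ν ^ 2 : ℂ)) (hp := hq.sub (memLp_const _)) ?_
    rw [← dblOp_sub_smul q hq]
    conv_lhs => rw [ha', hzz]
    simp only [map_sub, map_smul, smul_sub, smul_add]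
    rw [smul_comm a ((ν : ℂ) ^ 2)]
    abel
  have hev : (a • K + (-1 : ℂ) • K') (cosL ν) = (1 - a) • cosL ν := by
    rw [sub_eq_zero, hz', hz, smul_add] at hd
    rw [add_apply, smul_apply, smul_apply, neg_one_smul, sub_smul, one_smul]
    have : a • K (cosL ν) = cosL ν + K' (cosL ν) - a • cosL ν := by rw [hd]; abel
    rw [this]; abel
  have ha1 : a = 1 := by
    by_contra hne
    exact cosL_ne_zero ν ((hV.linearComb hK'.1 a (-1)).eq_zero_of_eq
      (sub_ne_zero.2 (Ne.symm hne)) hev)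
  rw [ha1, one_smul, sub_eq_zero, hz', hz] at hd
  exact add_left_cancel hd


/-! ### The Gelfand–Levitan equation and factorization -/

theorem IsVolterraMinus.ae_norm_sq_le {A : L2 0 1 →L[ℂ] L2 0 1} {k : ℝ → ℝ → ℂ}
    (hA : HasKernel A k)
    (hk : ∀ᵐ p : ℝ × ℝ ∂((vol 0 1).prod (vol 0 1)), p.2 < p.1 → k p.1 p.2 = 0) (u : L2 0 1) :
    ∀ᵐ x ∂(vol 0 1), ‖A u x‖ ^ 2 ≤ (∫ t, ‖k x t‖ ^ 2 ∂(vol 0 1)) *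
      ∫ t in x..(1 : ℝ), ‖u t‖ ^ 2 := by
  filter_upwards [hA.2 u, Measure.ae_ae_of_ae_prod hk, hA.integrable_section,
    ae_restrict_mem measurableSet_Ioo] with x h1 h2 h3 hx
  have hle : vol x 1 ≤ vol 0 1 := vol_mono hx.1.le le_rfl
  have e : A u x = ∫ t, k x t * u t ∂(vol x 1) := by
    rw [h1]
    symm
    have hv : vol x 1 = (vol 0 1).restrict (Ioi x) := by
      rw [vol, vol, Measure.restrict_restrict measurableSet_Ioi]
      congr 1; ext y; simp only [mem_Ioo, mem_inter_iff, mem_Ioi]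
      exact ⟨fun h => ⟨h.1, hx.1.trans h.1, h.2⟩, fun h => ⟨h.1, h.2.2⟩⟩
    rw [hv]
    refine setIntegral_eq_integral_of_ae_compl_eq_zero ?_
    have hne : ∀ᵐ t ∂(vol 0 1), t ≠ x := ae_restrict_of_ae (by simp [ae_iff])
    filter_upwards [h2, hne] with t ht hne' htx
    rw [ht (lt_of_le_of_ne (not_lt.1 htx) hne'), zero_mul]
  rw [e]
  refine (norm_integral_mul_sq_le (h3.mono_measure hle) ((Lp.memLp u).mono_measure hle)).trans ?_
  rw [intervalIntegral_eq_integral_vol hx.2.le]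
  exact mul_le_mul_of_nonneg_right (integral_mono_measure hle
    (ae_of_all _ fun t => by positivity) (integrable_sq_norm h3))
    (integral_nonneg fun _ => by positivity)

theorem L2.eq_zero_of_ae {u : L2 0 1} (h : (u : ℝ → ℂ) =ᵐ[vol 0 1] 0) : u = 0 :=
  Lp.ext (h.trans (Lp.coeFn_zero ℂ 2 (vol 0 1)).symm)

theorem IsVolterraMinus.eq_zero_of_add_eq_zero {A : L2 0 1 →L[ℂ] L2 0 1} (hA : IsVolterraMinus A)
    {u : L2 0 1} (h : u + A u = 0) : u = 0 := by
  obtain ⟨k, hk, hk0⟩ := hA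
  refine L2.eq_zero_of_ae (ae_eq_zero_of_volterra_right (Lp.memLp u) hk.integrable_sq_section
    (fun x => integral_nonneg fun _ => by positivity) ?_)
  filter_upwards [IsVolterraMinus.ae_norm_sq_le hk hk0 u, Lp.coeFn_neg u] with x h2 h3
  rw [← neg_eq_of_add_eq_zero_right h, h3, Pi.neg_apply, norm_neg] at h2
  exact h2

theorem IsVolterraPlus.eq_zero_of_add_eq_zero {A : L2 0 1 →L[ℂ] L2 0 1} (hA : IsVolterraPlus A)
    {u : L2 0 1} (h : u + A u = 0) : u = 0 :=
  hA.eq_zero_of_eq (c := -1) (by norm_num) (by rw [neg_one_smul, neg_eq_of_add_eq_zero_right h])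

/-- The kernel `φ(x + t) + φ(|x - t|)`. -/
def kernF (φ : ℝ → ℂ) (x t : ℝ) : ℂ := φ (x + t) + φ |x - t|

theorem kernF_comm (φ : ℝ → ℂ) (x t : ℝ) : kernF φ x t = kernF φ t x := by
  rw [kernF, kernF, add_comm x t, abs_sub_comm]

theorem continuous_kernF {φ : ℝ → ℂ} (hφ : Continuous φ) :
    Continuous (Function.uncurry (kernF φ)) := by
  unfold kernF Function.uncurry
  fun_prop

/-- The Gelfand–Levitan equation `k(x, t) + f(x, t) + ∫₀ˣ k(x, s) f(s, t) ds = 0` on the triangle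
`0 ≤ t ≤ x ≤ 1` with `f(x, t) = φ(x + t) + φ(|x - t|)`. -/
def GelfandLevitan (k : ℝ → ℝ → ℂ) (φ : ℝ → ℂ) : Prop :=
  ∀ x t, 0 ≤ t → t ≤ x → x ≤ 1 →
    k x t + kernF φ x t + ∫ s in (0 : ℝ)..x, k x s * kernF φ s t = 0

/-- The kernel of `(I + F)(I + Kᵀ) - I` below the diagonal, where `K` has the Volterra kernel `k`.
If `k` solves the Gelfand–Levitan equation, this is the kernel of `(I + K)⁻¹ - I`. -/
noncomputable def invKernel (k : ℝ → ℝ → ℂ) (φ : ℝ → ℂ) (x t : ℝ) : ℂ :=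
  kernF φ x t + ∫ s in (0 : ℝ)..t, kernF φ x s * k t s

theorem continuous_invKernel {k : ℝ → ℝ → ℂ} {φ : ℝ → ℂ} (hk : Continuous (Function.uncurry k))
    (hφ : Continuous φ) : Continuous (Function.uncurry (invKernel k φ)) := by
  have hf := continuous_kernF hφ
  refine hf.add ?_
  refine intervalIntegral.continuous_parametric_intervalIntegral_of_continuous
    (f := fun (p : ℝ × ℝ) s => kernF φ p.1 s * k p.2 s) (s := fun p : ℝ × ℝ => p.2) ?_
    continuous_snd
  exact (hf.comp ((continuous_fst.comp continuous_fst).prodMk continuous_snd)).mul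
    (hk.comp ((continuous_snd.comp continuous_fst).prodMk continuous_snd))

/-- The restriction of a kernel to the triangle `t ≤ x`. -/
noncomputable def lowerPart (a : ℝ → ℝ → ℂ) (x t : ℝ) : ℂ := if t ≤ x then a x t else 0

/-- The restriction of a kernel to the open triangle `t < x`. -/
noncomputable def strictLowerPart (a : ℝ → ℝ → ℂ) (x t : ℝ) : ℂ := if t < x then a x t else 0

theorem bddKernel_of_continuous {a : ℝ → ℝ → ℂ} (ha : Continuous (Function.uncurry a)) :
    BddKernel a := by
  obtain ⟨C, hC⟩ := (isCompact_Icc (a := ((0 : ℝ), (0 : ℝ)))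
    (b := (1, 1))).exists_bound_of_continuousOn ha.continuousOn
  exact ⟨ha.measurable, C, fun x hx t ht =>
    hC (x, t) ⟨⟨hx.1.le, ht.1.le⟩, ⟨hx.2.le, ht.2.le⟩⟩⟩

theorem BddKernel.lowerPart {a : ℝ → ℝ → ℂ} (ha : BddKernel a) : BddKernel (lowerPart a) := by
  obtain ⟨C, hC0, hC⟩ := ha.exists_nonneg_bound
  refine ⟨Measurable.ite (measurableSet_le measurable_snd measurable_fst) ha.1 measurable_const, C,
    fun x hx t ht => ?_⟩
  unfold HalfInverse.lowerPart
  split_ifs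
  · exact hC x hx t ht
  · simpa using hC0

theorem BddKernel.strictLowerPart {a : ℝ → ℝ → ℂ} (ha : BddKernel a) :
    BddKernel (strictLowerPart a) := by
  obtain ⟨C, hC0, hC⟩ := ha.exists_nonneg_bound
  refine ⟨Measurable.ite (measurableSet_lt measurable_snd measurable_fst) ha.1 measurable_const, C,
    fun x hx t ht => ?_⟩
  unfold HalfInverse.strictLowerPart
  split_ifs
  · exact hC x hx t ht
  · simpa using hC0

theorem BddKernel.transpose {a : ℝ → ℝ → ℂ} (ha : BddKernel a) :
    BddKernel (fun x t => a t x) := by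
  obtain ⟨C, hC⟩ := ha.2
  exact ⟨ha.1.comp measurable_swap, C, fun x hx t ht => hC t ht x hx⟩

theorem ae_ne_diagonal : ∀ᵐ p : ℝ × ℝ ∂((vol 0 1).prod (vol 0 1)), p.1 ≠ p.2 := by
  have hm : MeasurableSet {p : ℝ × ℝ | p.1 ≠ p.2} :=
    (measurableSet_eq_fun measurable_fst measurable_snd).compl
  have := (Measure.ae_prod_mem_iff_ae_ae_mem (μ := vol 0 1) (ν := vol 0 1) hm).2
    (ae_of_all _ fun x => by
      have : ∀ᵐ t ∂(vol 0 1), t ≠ x := ae_restrict_of_ae (by simp [ae_iff])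
      exact this.mono fun t ht => Ne.symm ht)
  exact this

theorem integral_lowerPart_mul {k : ℝ → ℝ → ℂ} {g : ℝ → ℂ} {x : ℝ} (hx : x ∈ Ioo (0 : ℝ) 1) :
    ∫ s, lowerPart k x s * g s ∂(vol 0 1) = ∫ s in (0 : ℝ)..x, k x s * g s := by
  have h1 : (fun s => lowerPart k x s * g s) = (Iic x).indicator fun s => k x s * g s := by
    ext s
    by_cases hs : s ≤ x
    · rw [indicator_of_mem (mem_Iic.2 hs), lowerPart, if_pos hs]
    · rw [indicator_of_notMem (by simpa using hs), lowerPart, if_neg hs, zero_mul]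
  rw [h1, integral_indicator measurableSet_Iic, intervalIntegral.integral_of_le hx.1.le,
    Measure.restrict_restrict measurableSet_Iic]
  congr 2
  ext s; simp only [mem_Ioo, mem_inter_iff, mem_Iic, mem_Ioc]
  exact ⟨fun h => ⟨h.2.1, h.1⟩, fun h => ⟨h.2, h.1, h.2.trans_lt hx.2⟩⟩

theorem integral_strictLowerPart_mul {m : ℝ → ℝ → ℂ} {x t : ℝ} (ht : 0 < t) (htx : t < x)
    (hx1 : x < 1) :
    ∫ s, strictLowerPart m x s * strictLowerPart m t s ∂(vol 0 1) =
      ∫ s in (0 : ℝ)..t, m x s * m t s := by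
  have h1 : (fun s => strictLowerPart m x s * strictLowerPart m t s) =
      (Iio t).indicator fun s => m x s * m t s := by
    ext s
    by_cases hs : s < t
    · rw [indicator_of_mem (mem_Iio.2 hs), strictLowerPart, if_pos (hs.trans htx),
        strictLowerPart, if_pos hs]
    · rw [indicator_of_notMem (by simpa using hs), strictLowerPart, strictLowerPart, if_neg hs,
        mul_zero]
  rw [h1, integral_indicator measurableSet_Iio, intervalIntegral_eq_integral_vol ht.le,
    Measure.restrict_restrict measurableSet_Iio]
  congr 2
  ext s; simp only [mem_Ioo, mem_inter_iff, mem_Iio]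
  exact ⟨fun h => ⟨h.2.1, h.1⟩, fun h => ⟨h.2, h.1, h.2.trans (htx.trans hx1)⟩⟩

theorem one_add_mul_one_add {R : Type*} [Ring R] (a b : R) :
    (1 + a) * (1 + b) = 1 + (a + b + a * b) := by noncomm_ring

/-- The triangular factorization `f(x, t) = m(x, t) + ∫₀ᵗ m(x, s) m(t, s) ds`, `0 ≤ t ≤ x ≤ 1`, of
the kernel `f(x, t) = φ(x + t) + φ(|x - t|)`; it says that `I + F = (I + M)(I + Mᵀ)`, where `M` has
the Volterra kernel `m`. -/
def TriangularFactor (m : ℝ → ℝ → ℂ) (φ : ℝ → ℂ) : Prop :=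
  ∀ x t, 0 ≤ t → t ≤ x → x ≤ 1 → kernF φ x t = m x t + ∫ s in (0 : ℝ)..t, m x s * m t s

/-- The Gelfand–Levitan equation gives the factorization `I + F = (I + K)⁻¹ (I + Kᵀ)⁻¹`, where
`K` has the Volterra kernel `k`, together with the kernel of `(I + K)⁻¹ - I`. The products
`(I + K)(I + F)` and `(I + F)(I + Kᵀ)` differ from `I` by operators with an upper and a lower
triangular kernel respectively, so `(I + K)(I + F)(I + Kᵀ) - I` has a kernel which is both upper
and lower triangular. -/
theorem GelfandLevitan.factorization {k : ℝ → ℝ → ℂ} {φ : ℝ → ℂ}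
    (hk : Continuous (Function.uncurry k)) (hφ : Continuous φ) (h : GelfandLevitan k φ)
    {K F : L2 0 1 →L[ℂ] L2 0 1} (hK : HasKernel K (lowerPart k)) (hF : HasKernel F (kernF φ)) :
    IsVolterraPlus K ∧ IsUnit (1 + K) ∧ Factorizable F ∧
      HasKernel (Ring.inverse (1 + K) - 1) (strictLowerPart (invKernel k φ)) ∧
      TriangularFactor (invKernel k φ) φ := by
  set m := invKernel k φ with hm
  have hmc := continuous_invKernel hk hφ
  have bk : BddKernel (lowerPart k) := (bddKernel_of_continuous hk).lowerPart
  have bm : BddKernel (strictLowerPart m) := (bddKernel_of_continuous hmc).strictLowerPart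
  have bf : BddKernel (kernF φ) := bddKernel_of_continuous (continuous_kernF hφ)
  obtain ⟨Kt, hKt⟩ := bk.transpose.exists_hasKernel
  obtain ⟨Λ, hΛ⟩ := bm.exists_hasKernel
  obtain ⟨U, hU⟩ := bm.transpose.exists_hasKernel
  have hVK : IsVolterraPlus K := ⟨_, hK, ae_of_all _ fun p hp => if_neg (not_le.2 hp)⟩
  have hVKt : IsVolterraMinus Kt := ⟨_, hKt, ae_of_all _ fun p hp => if_neg (not_le.2 hp)⟩
  have hVU : IsVolterraMinus U := ⟨_, hU, ae_of_all _ fun p hp => if_neg (not_lt.2 (le_of_lt hp))⟩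
  have e1 : (1 + F) * (1 + Kt) = 1 + Λ := by
    rw [one_add_mul_one_add, ((hF.add hKt).add (hF.comp hKt bf bk.transpose)).congr ?_ |>.ext hΛ]
    filter_upwards [ae_mem_square] with p hp
    have e : ∫ s, kernF φ p.1 s * lowerPart k p.2 s ∂(vol 0 1) =
        ∫ s in (0 : ℝ)..p.2, kernF φ p.1 s * k p.2 s := by
      simp_rw [mul_comm (kernF φ p.1 _)]
      exact integral_lowerPart_mul hp.2
    rw [e]
    unfold strictLowerPart lowerPart
    by_cases hpt : p.2 < p.1
    · rw [if_pos hpt, if_neg (not_le.2 hpt), hm, invKernel]; ring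
    · rw [if_neg hpt, if_pos (not_lt.1 hpt), ← h p.2 p.1 hp.1.1.le (not_lt.1 hpt) hp.2.2.le,
        kernF_comm φ p.2 p.1]
      have : ∫ s in (0 : ℝ)..p.2, kernF φ p.1 s * k p.2 s =
          ∫ s in (0 : ℝ)..p.2, k p.2 s * kernF φ s p.1 := by
        simp_rw [kernF_comm φ p.1, mul_comm]
      rw [this]; ring
  have e2 : (1 + K) * (1 + F) = 1 + U := by
    rw [one_add_mul_one_add, ((hK.add hF).add (hK.comp hF bk bf)).congr ?_ |>.ext hU]
    filter_upwards [ae_mem_square] with p hp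
    rw [integral_lowerPart_mul (g := fun s => kernF φ s p.2) hp.1]
    unfold strictLowerPart lowerPart
    by_cases hpt : p.1 < p.2
    · rw [if_pos hpt, if_neg (not_le.2 hpt), hm, invKernel, zero_add, kernF_comm φ p.2 p.1]
      congr 1
      simp_rw [kernF_comm φ p.2, mul_comm]
    · rw [if_neg hpt, if_pos (not_lt.1 hpt)]
      exact h p.1 p.2 hp.2.1.le (not_lt.1 hpt) hp.1.2.le
  have e3 : (1 + K) * (1 + Λ) = (1 + U) * (1 + Kt) := by rw [← e1, ← e2, mul_assoc]
  -- the left-hand side minus `1` is lower triangular, the right-hand side minus `1` is upper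
  -- triangular
  have e4 : (1 + K) * (1 + Λ) = 1 := by
    have h1 := e3
    rw [one_add_mul_one_add, one_add_mul_one_add, add_right_inj] at h1
    have k1 := (hK.add hΛ).add (hK.comp hΛ bk bm)
    have k2 := (hU.add hKt).add (hU.comp hKt bm.transpose bk.transpose)
    rw [← h1] at k2
    have hz : K + Λ + K * Λ = 0 := by
      refine (k1.congr ?_).ext hasKernel_zero
      filter_upwards [k1.ae_eq k2, ae_ne_diagonal] with p hp hne
      rcases lt_or_gt_of_ne hne with hlt | hlt
      · have : ∀ s, lowerPart k p.1 s * strictLowerPart m s p.2 = 0 := fun s => by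
          unfold strictLowerPart lowerPart
          split_ifs with h3 h4
          · exact absurd (h4.trans_le h3) (not_lt.2 hlt.le)
          all_goals simp
        simp only [this, integral_zero]
        simp [lowerPart, strictLowerPart, not_le.2 hlt, not_lt.2 hlt.le]
      · rw [hp]
        have : ∀ s, strictLowerPart m s p.1 * lowerPart k p.2 s = 0 := fun s => by
          unfold strictLowerPart lowerPart
          split_ifs with h3 h4
          · exact absurd (h3.trans_le h4) (not_lt.2 hlt.le)
          all_goals simp
        simp only [this, integral_zero]
        simp [lowerPart, strictLowerPart, not_le.2 hlt, not_lt.2 hlt.le]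
    rw [one_add_mul_one_add, hz, add_zero]
  have e4' : (1 + U) * (1 + Kt) = 1 := e3 ▸ e4
  have e5 : (1 + Λ) * (1 + K) = 1 := by
    ext1 u
    have h1 : (1 + K) (((1 + Λ) * (1 + K)) u - u) = 0 := by
      have : (1 + K) (((1 + Λ) * (1 + K)) u) = (((1 + K) * (1 + Λ)) * (1 + K)) u := rfl
      rw [map_sub, this, e4, one_mul, sub_self]
    exact sub_eq_zero.1 (hVK.eq_zero_of_add_eq_zero h1)
  have e5' : (1 + Kt) * (1 + U) = 1 := by
    ext1 u
    have h1 : (1 + U) (((1 + Kt) * (1 + U)) u - u) = 0 := by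
      have : (1 + U) (((1 + Kt) * (1 + U)) u) = (((1 + U) * (1 + Kt)) * (1 + U)) u := rfl
      rw [map_sub, this, e4', one_mul, sub_self]
    exact sub_eq_zero.1 (hVU.eq_zero_of_add_eq_zero h1)
  let uK : (L2 0 1 →L[ℂ] L2 0 1)ˣ := ⟨1 + K, 1 + Λ, e4, e5⟩
  let uKt : (L2 0 1 →L[ℂ] L2 0 1)ˣ := ⟨1 + Kt, 1 + U, e5', e4'⟩
  have i1 : Ring.inverse (1 + K) = 1 + Λ := Ring.inverse_unit uK
  have i2 : Ring.inverse (1 + Kt) = 1 + U := Ring.inverse_unit uKt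
  have e6 : 1 + F = (1 + Λ) * (1 + U) := by
    rw [← e2, ← mul_assoc, e5, one_mul]
  refine ⟨hVK, ⟨uK, rfl⟩, ⟨K, Kt, hVK, hVKt, ⟨uK, rfl⟩, ⟨uKt, rfl⟩, ?_⟩, ?_, ?_⟩
  · rw [i1, i2, e6]
  · rw [i1, add_sub_cancel_left]; exact hΛ
  · have e7 := e6
    rw [one_add_mul_one_add, add_right_inj] at e7
    have k1 := (hΛ.add hU).add (hΛ.comp hU bm bm.transpose)
    rw [← e7] at k1
    -- the identity of the kernels holds a.e. in the open triangle, hence everywhere by continuity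
    set O : Set (ℝ × ℝ) := {p | 0 < p.2 ∧ p.2 < p.1 ∧ p.1 < 1} with hO
    have hOo : IsOpen O :=
      (isOpen_lt continuous_const continuous_snd).inter
        ((isOpen_lt continuous_snd continuous_fst).inter
          (isOpen_lt continuous_fst continuous_const))
    set c₂ : ℝ × ℝ → ℂ := fun p => m p.1 p.2 + ∫ s in (0 : ℝ)..p.2, m p.1 s * m p.2 s with hc₂
    have hc₂c : Continuous c₂ := by
      refine hmc.add ?_
      refine intervalIntegral.continuous_parametric_intervalIntegral_of_continuous
        (f := fun (p : ℝ × ℝ) s => m p.1 s * m p.2 s) (s := fun p : ℝ × ℝ => p.2) ?_ continuous_snd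
      exact (hmc.comp ((continuous_fst.comp continuous_fst).prodMk continuous_snd)).mul
        (hmc.comp ((continuous_snd.comp continuous_fst).prodMk continuous_snd))
    have hc₁c := continuous_kernF hφ
    have hae : Function.uncurry (kernF φ) =ᵐ[(volume : Measure (ℝ × ℝ)).restrict O] c₂ := by
      have hsub : O ⊆ Ioo 0 1 ×ˢ Ioo 0 1 := fun p hp =>
        ⟨⟨hp.1.trans hp.2.1, hp.2.2⟩, ⟨hp.1, hp.2.1.trans hp.2.2⟩⟩
      have h8 := hF.ae_eq k1
      rw [vol, Measure.prod_restrict] at h8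
      have h9 := ae_restrict_of_ae_restrict_of_subset hsub h8
      filter_upwards [h9, ae_restrict_mem hOo.measurableSet] with p hp hpO
      simp only [Function.uncurry, hc₂]
      rw [hp, integral_strictLowerPart_mul hpO.1 hpO.2.1 hpO.2.2, strictLowerPart,
        if_pos hpO.2.1, strictLowerPart, if_neg (not_lt.2 hpO.2.1.le), add_zero]
    have hon := Measure.eqOn_open_of_ae_eq hae hOo hc₁c.continuousOn hc₂c.continuousOn
    intro x t ht htx hx
    refine hon.closure hc₁c hc₂c (x := (x, t)) ?_
    have hlim : Filter.Tendsto
        (fun ε : ℝ => ((1 - ε) * x + ε * (2 / 3), (1 - ε) * t + ε * (1 / 3)))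
        (nhdsWithin 0 (Ioi 0)) (nhds (x, t)) := by
      have hc : Continuous fun ε : ℝ => ((1 - ε) * x + ε * (2 / 3), (1 - ε) * t + ε * (1 / 3)) := by
        fun_prop
      have := hc.tendsto 0
      simp only [sub_zero, one_mul, zero_mul, add_zero] at this
      exact this.mono_left nhdsWithin_le_nhds
    refine mem_closure_of_tendsto hlim ?_
    filter_upwards [Ioo_mem_nhdsGT (zero_lt_one (α := ℝ))] with ε hε
    refine ⟨?_, ?_, ?_⟩ <;> dsimp only <;> nlinarith [hε.1, hε.2]

/-- The kernel of `(I + K)⁻¹ - I` is a triangular factor of the kernel of `F`. -/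
theorem GelfandLevitan.triangularFactor {k : ℝ → ℝ → ℂ} {φ : ℝ → ℂ}
    (hk : Continuous (Function.uncurry k)) (hφ : Continuous φ) (h : GelfandLevitan k φ) :
    TriangularFactor (invKernel k φ) φ := by
  obtain ⟨K, hK⟩ := (bddKernel_of_continuous hk).lowerPart.exists_hasKernel
  obtain ⟨F, hF⟩ := (bddKernel_of_continuous (continuous_kernF hφ)).exists_hasKernel
  exact (h.factorization hk hφ hK hF).2.2.2.2

theorem GelfandLevitan.invKernel_diagonal {k : ℝ → ℝ → ℂ} {φ : ℝ → ℂ} (h : GelfandLevitan k φ)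
    {x : ℝ} (hx : x ∈ Icc (0 : ℝ) 1) : invKernel k φ x x = -k x x := by
  rw [invKernel, eq_neg_iff_add_eq_zero, ← h x x hx.1 le_rfl hx.2]
  have : ∫ s in (0 : ℝ)..x, kernF φ x s * k x s = ∫ s in (0 : ℝ)..x, k x s * kernF φ s x := by
    simp_rw [kernF_comm φ x, mul_comm]
  rw [this]; ring

theorem TriangularFactor.diagonal {m : ℝ → ℝ → ℂ} {φ : ℝ → ℂ} (h : TriangularFactor m φ) {x : ℝ}
    (hx : x ∈ Icc (0 : ℝ) 1) : φ (2 * x) + φ 0 = m x x + ∫ t in (0 : ℝ)..x, m x t ^ 2 := by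
  have h1 := h x x hx.1 le_rfl hx.2
  rw [kernF, sub_self, abs_zero, ← two_mul] at h1
  simp_rw [h1, sq]


/-! ### From kernels to the function `φ_σ` -/

/-- The function `z = (I + K) cos ν x`, where `K` has the Volterra kernel `k`. -/
noncomputable def cosTransform (k : ℝ → ℝ → ℂ) (ν x : ℝ) : ℂ :=
  (Real.cos (ν * x) : ℂ) + ∫ t in (0 : ℝ)..x, k x t * (Real.cos (ν * t) : ℂ)

/-- The functions `z = (I + K) cos ν x` solve the Cauchy problems `z'' = (q - ν²) z`, `z(0) = 1`,
`z'(0) = h` on `[0, X]`, where `K` has the Volterra kernel `k`. -/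
def Intertwines (h : ℂ) (q : ℝ → ℂ) (k : ℝ → ℝ → ℂ) (X : ℝ) : Prop :=
  ∀ ν : ℝ, ∀ x ∈ Icc 0 X, cosTransform k ν x =
    1 + ∫ r in (0 : ℝ)..x, (h + ∫ s in (0 : ℝ)..r, (q s - ν ^ 2) * cosTransform k ν s)

theorem continuous_cosTransform {k : ℝ → ℝ → ℂ} (hk : Continuous (Function.uncurry k)) (ν : ℝ) :
    Continuous (cosTransform k ν) := by
  unfold cosTransform
  refine Continuous.add (by fun_prop) ?_
  refine intervalIntegral.continuous_parametric_intervalIntegral_of_continuous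
    (f := fun (x : ℝ) t => k x t * (Real.cos (ν * t) : ℂ)) (s := fun x : ℝ => x) ?_ continuous_id
  exact hk.mul (by fun_prop)

theorem integrable_of_continuous {z : ℝ → ℂ} (hz : Continuous z) : Integrable z (vol 0 1) := by
  rw [← intervalIntegrable_iff_vol zero_le_one]
  exact hz.intervalIntegrable _ _

theorem memLp_of_continuous {z : ℝ → ℂ} {a b : ℝ} (hz : Continuous z) :
    MemLp z 2 (vol a b) := by
  obtain ⟨C, hC⟩ := (isCompact_Icc (a := a) (b := b)).exists_bound_of_continuousOn hz.continuousOn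
  exact MemLp.of_bound hz.aestronglyMeasurable C
    ((ae_restrict_mem measurableSet_Ioo).mono fun x hx => hC x (Ioo_subset_Icc_self hx))

theorem Intertwines.intertwinesOp {h : ℂ} {q : ℝ → ℂ} {k : ℝ → ℝ → ℂ}
    (hI : Intertwines h q k 1) (hq : MemLp q 2 (vol 0 1)) (hk : Continuous (Function.uncurry k))
    {K : L2 0 1 →L[ℂ] L2 0 1} (hK : HasKernel K (lowerPart k)) : IntertwinesOp h q hq K := by
  intro ν
  have hzc := continuous_cosTransform hk ν
  have hz : (cosL ν + K (cosL ν) : L2 0 1) =ᵐ[vol 0 1] cosTransform k ν := by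
    filter_upwards [Lp.coeFn_add (cosL ν) (K (cosL ν)), cosL_ae ν, hK.2 (cosL ν),
      ae_restrict_mem measurableSet_Ioo] with x h1 h2 h3 hx
    rw [h1, Pi.add_apply, h2, h3, integral_lowerPart_mul hx, cosTransform]
    congr 1
    refine intervalIntegral_congr_vol ?_ (Ioo_subset_Icc_self hx)
    filter_upwards [cosL_ae ν] with t ht
    rw [ht]
  set Z := cosL ν + K (cosL ν) with hZ
  refine Lp.ext ?_
  filter_upwards [Lp.coeFn_sub (linearL h + dblOp q hq Z) ((ν ^ 2 : ℂ) • dblInt Z),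
    Lp.coeFn_add (linearL h) (dblOp q hq Z), Lp.coeFn_smul (ν ^ 2 : ℂ) (dblInt Z), linearL_ae h,
    dblOp_ae q hq Z, dblInt_ae Z, hz, ae_restrict_mem measurableSet_Ioo]
    with x h1 h2 h3 h4 h5 h6 h7 hx
  have hx' := Ioo_subset_Icc_self hx
  have hzi := integrable_of_continuous hzc
  have hqz : Integrable (fun t => q t * cosTransform k ν t) (vol 0 1) :=
    integrable_mul_of_memLp hq (memLp_of_continuous hzc)
  rw [h1, Pi.sub_apply, h2, Pi.add_apply, h3, Pi.smul_apply, h4, h5, h6, h7, hI ν x hx',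
    dblPrim_congr hz hx', dblPrim_congr (f := fun t => q t * Z t)
      (g := fun t => q t * cosTransform k ν t) (hz.mono fun t ht => by simp only [ht]) hx',
    smul_eq_mul]
  have e1 : (fun t => (q t - ν ^ 2) * cosTransform k ν t) = fun t =>
      q t * cosTransform k ν t + (-(ν : ℂ) ^ 2) * cosTransform k ν t := by ext t; ring
  have e2 : ∫ r in (0 : ℝ)..x, ∫ s in (0 : ℝ)..r, (q s - ν ^ 2) * cosTransform k ν s =
      dblPrim (fun t => q t * cosTransform k ν t) x - ν ^ 2 * dblPrim (cosTransform k ν) x := by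
    change dblPrim (fun t => (q t - ν ^ 2) * cosTransform k ν t) x = _
    rw [e1, dblPrim_add hqz (hzi.const_mul _) hx', dblPrim_const_mul]; ring
  rw [intervalIntegral.integral_add (f := fun _ => h)
    (g := fun r => ∫ s in (0 : ℝ)..r, (q s - ν ^ 2) * cosTransform k ν s) intervalIntegrable_const
    (intervalIntegrable_sub (integrable_prim (by
      have := hqz.add (hzi.const_mul (-(ν : ℂ) ^ 2))
      exact this.congr (ae_of_all _ fun t => by simp only [Pi.add_apply]; ring)))
      (left_mem_Icc.2 zero_le_one) hx'), e2]
  simp only [intervalIntegral.integral_const, sub_zero, Complex.real_smul]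
  ring

theorem quasiMeasurePreserving_mul {a : ℝ} (ha : a ≠ 0) :
    Measure.QuasiMeasurePreserving (fun x : ℝ => a * x) volume volume := by
  refine ⟨by fun_prop, ?_⟩
  rw [Real.map_volume_mul_left ha]
  exact Measure.smul_absolutelyContinuous

theorem ae_vol_two_mul {P : ℝ → Prop} :
    (∀ᵐ x ∂(vol 0 1), P (2 * x)) ↔ ∀ᵐ y ∂(vol 0 2), P y := by
  rw [ae_restrict_iff' measurableSet_Ioo, ae_restrict_iff' measurableSet_Ioo]
  constructor
  · intro h
    refine ((quasiMeasurePreserving_mul (a := 1 / 2) (by norm_num)).ae h).mono fun y hy hy2 => ?_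
    have := hy ⟨by linarith [hy2.1], by linarith [hy2.2]⟩
    rwa [← mul_assoc, mul_one_div_cancel two_ne_zero, one_mul] at this
  · intro h
    refine ((quasiMeasurePreserving_mul (a := 2) (by norm_num)).ae h).mono fun y hy hy2 => ?_
    exact hy ⟨by linarith [hy2.1], by linarith [hy2.2]⟩

theorem kernF_congr_ae {φ ψ : ℝ → ℂ} (hφ : Measurable φ) (hψ : Measurable ψ)
    (h : φ =ᵐ[vol 0 2] ψ) :
    ∀ᵐ p : ℝ × ℝ ∂((vol 0 1).prod (vol 0 1)), kernF φ p.1 p.2 = kernF ψ p.1 p.2 := by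
  have hm : MeasurableSet {p : ℝ × ℝ | kernF φ p.1 p.2 = kernF ψ p.1 p.2} := by
    unfold kernF
    exact measurableSet_eq_fun (by fun_prop) (by fun_prop)
  have h' : ∀ᵐ y : ℝ, y ∈ Ioo (0 : ℝ) 2 → φ y = ψ y :=
    (ae_restrict_iff' measurableSet_Ioo).1 h
  refine (Measure.ae_prod_mem_iff_ae_ae_mem (μ := vol 0 1) (ν := vol 0 1) hm).2 ?_
  filter_upwards [ae_restrict_mem measurableSet_Ioo] with x hx
  have q1 := (measurePreserving_add_left (volume : Measure ℝ) x).quasiMeasurePreserving.ae h'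
  have q2 :=
    (Measure.measurePreserving_sub_left (volume : Measure ℝ) x).quasiMeasurePreserving.ae h'
  have q3 := (measurePreserving_sub_right (volume : Measure ℝ) x).quasiMeasurePreserving.ae h'
  have hne : ∀ᵐ t ∂(vol 0 1), t ≠ x := ae_restrict_of_ae (by simp [ae_iff])
  filter_upwards [ae_restrict_of_ae q1, ae_restrict_of_ae q2, ae_restrict_of_ae q3, hne,
    ae_restrict_mem measurableSet_Ioo] with t h1 h2 h3 h4 ht
  simp only [kernF]
  rw [h1 ⟨by linarith [hx.1, ht.1], by linarith [hx.2, ht.2]⟩]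
  rcases lt_or_gt_of_ne h4 with hlt | hlt
  · rw [abs_of_pos (by linarith), h2 ⟨by linarith, by linarith [hx.2, ht.1]⟩]
  · rw [abs_of_neg (by linarith), neg_sub, h3 ⟨by linarith, by linarith [hx.1, ht.2]⟩]

/-- The data which determine `φ_σ` for `σ = h + ∫ q`: the continuous kernel `k` of the
transformation operator, with its values on the diagonal, and the continuous solution `φ` of the
Gelfand–Levitan equation. -/
structure TransformData (h : ℂ) (q : ℝ → ℂ) (k : ℝ → ℝ → ℂ) (φ : ℝ → ℂ) : Prop where
  continuous_kernel : Continuous (Function.uncurry k)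
  continuous_phi : Continuous φ
  intertwines : Intertwines h q k 1
  diagonal : ∀ x ∈ Icc (0 : ℝ) 1, k x x = (1 / 2) * ((h + ∫ s in (0 : ℝ)..x, q s) + h)
  gelfandLevitan : GelfandLevitan k φ

/-- The data give `φ_σ`, and nothing else satisfies its definition: the transformation operator is
unique and `φ(2x) + φ(0) = -k(x, x) + ∫₀ˣ l(x, t)² dt` with `k(x, x) = (σ(x) + h) / 2`. -/
theorem TransformData.isPhiOf_iff {σ : L2 0 1} {h : ℂ} {q : ℝ → ℂ} {k : ℝ → ℝ → ℂ} {φ : ℝ → ℂ}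
    (hT : TransformData h q k φ) (hq : MemLp q 2 (vol 0 1))
    (hσ : σ =ᵐ[vol 0 1] fun x => h + ∫ s in (0 : ℝ)..x, q s) (ψ : L2 0 2) :
    IsPhiOf σ ψ ↔ ψ =ᵐ[vol 0 2] φ := by
  have bk := (bddKernel_of_continuous hT.continuous_kernel).lowerPart
  obtain ⟨K, hK⟩ := bk.exists_hasKernel
  obtain ⟨F, hF⟩ := (bddKernel_of_continuous (continuous_kernF hT.continuous_phi)).exists_hasKernel
  obtain ⟨hV, hu, -, hL, hd⟩ := hT.gelfandLevitan.factorization hT.continuous_kernel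
    hT.continuous_phi hK hF
  have hI := hT.intertwines.intertwinesOp hq hT.continuous_kernel hK
  have hφ0 : φ 0 = -(1 / 2) * h := by
    have h1 := hT.gelfandLevitan 0 0 le_rfl le_rfl zero_le_one
    have h2 := hT.diagonal 0 (left_mem_Icc.2 zero_le_one)
    simp only [kernF, intervalIntegral.integral_same, add_zero, sub_self, abs_zero] at h1 h2
    rw [h2] at h1
    linear_combination (1 / 2) * h1
  have hform : ∀ l : ℝ → ℝ → ℂ, HasKernel (Ring.inverse (1 + K) - 1) l →
      ∀ᵐ x ∂(vol 0 1), φ (2 * x) = -(1 / 2) * σ x + ∫ t in (0 : ℝ)..x, l x t ^ 2 := by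
    intro l hl
    filter_upwards [Measure.ae_ae_of_ae_prod (hl.ae_eq hL), hσ,
      ae_restrict_mem measurableSet_Ioo] with x h1 h2 hx
    have e : ∫ t in (0 : ℝ)..x, l x t ^ 2 = ∫ t in (0 : ℝ)..x, invKernel k φ x t ^ 2 := by
      rw [intervalIntegral_eq_integral_vol hx.1.le, intervalIntegral_eq_integral_vol hx.1.le]
      refine integral_congr_ae ?_
      filter_upwards [ae_mono (vol_mono le_rfl hx.2.le) h1,
        ae_restrict_mem measurableSet_Ioo] with t ht ht'
      simp only [ht, strictLowerPart, if_pos ht'.2]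
    have h3 := hd.diagonal (Ioo_subset_Icc_self hx)
    rw [hT.gelfandLevitan.invKernel_diagonal (Ioo_subset_Icc_self hx),
      hT.diagonal x (Ioo_subset_Icc_self hx), hφ0] at h3
    rw [e, h2]
    linear_combination h3
  constructor
  · rintro ⟨K', l, hK', -, hl, hψ⟩
    have hKK : K' = K := hI.unique hσ hV hK'
    rw [hKK] at hl
    refine ae_vol_two_mul.1 ?_
    filter_upwards [hψ, hform l hl] with x h1 h2
    rw [h1, h2]
  · intro hψ
    refine ⟨K, _, hI.isTransformation hσ hV hu, hu, hL, ?_⟩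
    filter_upwards [ae_vol_two_mul.2 hψ, hform _ hL] with x h1 h2
    rw [h1, h2]

theorem GelfandLevitan.mem_factorizableSet {k : ℝ → ℝ → ℂ} {φ : ℝ → ℂ}
    (hk : Continuous (Function.uncurry k)) (hφ : Continuous φ) (h : GelfandLevitan k φ)
    {ψ : L2 0 2} (hψ : ψ =ᵐ[vol 0 2] φ) : ψ ∈ factorizableSet := by
  obtain ⟨K, hK⟩ := (bddKernel_of_continuous hk).lowerPart.exists_hasKernel
  obtain ⟨F, hF⟩ := (bddKernel_of_continuous (continuous_kernF hφ)).exists_hasKernel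
  refine ⟨F, ?_, (h.factorization hk hφ hK hF).2.2.1⟩
  exact hF.congr (kernF_congr_ae hφ.measurable (Lp.stronglyMeasurable ψ).measurable hψ.symm)


/-! ### Fixed points in weighted spaces of continuous functions -/

/-- A map which halves the distances measured with the weight `ρ` has a fixed point: this is the
contraction principle in the space of bounded continuous functions `u / ρ`. -/
theorem exists_fixedPoint_of_weight {X : Type*} [TopologicalSpace X] {ρ : X → ℝ}
    (hρ : Continuous ρ) (hpos : ∀ x, 0 < ρ x) (T : (X → ℂ) → X → ℂ)
    (hT : ∀ u, Continuous u → Continuous (T u)) (h0 : ∃ C, ∀ x, ‖T 0 x‖ ≤ C * ρ x)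
    (hc : ∀ u v M, Continuous u → Continuous v → (∀ x, ‖u x - v x‖ ≤ M * ρ x) →
      ∀ x, ‖T u x - T v x‖ ≤ M / 2 * ρ x) :
    ∃ u, Continuous u ∧ ∀ x, u x = T u x := by
  obtain ⟨C, hC⟩ := h0
  have hρc : Continuous fun x => (ρ x : ℂ) := by fun_prop
  have hρne : ∀ x, (ρ x : ℂ) ≠ 0 := fun x => by exact_mod_cast (hpos x).ne'
  have hsc : ∀ v : BoundedContinuousFunction X ℂ, Continuous fun x => (ρ x : ℂ) * v x :=
    fun v => hρc.mul v.continuous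
  have hd : ∀ (u v : BoundedContinuousFunction X ℂ) x,
      ‖(ρ x : ℂ) * u x - ρ x * v x‖ ≤ dist u v * ρ x := fun u v x => by
    rw [← mul_sub, norm_mul, Complex.norm_real, Real.norm_of_nonneg (hpos x).le, mul_comm]
    refine mul_le_mul_of_nonneg_right ?_ (hpos x).le
    rw [← dist_eq_norm]; exact BoundedContinuousFunction.dist_coe_le_dist x
  have hb : ∀ v : BoundedContinuousFunction X ℂ, ∀ x,
      ‖T (fun x => (ρ x : ℂ) * v x) x / ρ x‖ ≤ C + ‖v‖ / 2 := fun v x => by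
    have h1 := hc (fun x => (ρ x : ℂ) * v x) 0 ‖v‖ (hsc v) continuous_zero (fun x => by
      have := hd v 0 x
      simpa using this) x
    rw [norm_div, Complex.norm_real, Real.norm_of_nonneg (hpos x).le, div_le_iff₀ (hpos x)]
    calc _ ≤ ‖T 0 x‖ + ‖T (fun x => (ρ x : ℂ) * v x) x - T 0 x‖ := norm_le_norm_add_norm_sub' _ _
      _ ≤ _ := by linarith [hC x]
  let Ψ : BoundedContinuousFunction X ℂ → BoundedContinuousFunction X ℂ := fun v =>
    BoundedContinuousFunction.ofNormedAddCommGroup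
      (fun x => T (fun x => (ρ x : ℂ) * v x) x / ρ x)
      ((hT _ (hsc v)).div hρc hρne) (C + ‖v‖ / 2) (hb v)
  have hΨ : ContractingWith (1 / 2) Ψ := by
    refine ⟨by norm_num, LipschitzWith.of_dist_le_mul fun u v => ?_⟩
    rw [BoundedContinuousFunction.dist_le (by positivity)]
    intro x
    have h1 := hc _ _ (dist u v) (hsc u) (hsc v) (hd u v) x
    change dist (T (fun x => (ρ x : ℂ) * u x) x / (ρ x : ℂ))
      (T (fun x => (ρ x : ℂ) * v x) x / (ρ x : ℂ)) ≤ _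
    rw [dist_eq_norm, ← sub_div, norm_div, Complex.norm_real, Real.norm_of_nonneg (hpos x).le,
      div_le_iff₀ (hpos x)]
    refine h1.trans (le_of_eq ?_)
    push_cast; ring
  set v := hΨ.fixedPoint with hv
  have hfix : Ψ v = v := hΨ.fixedPoint_isFixedPt
  refine ⟨_, hsc v, fun x => ?_⟩
  have := DFunLike.congr_fun hfix x
  change T (fun x => (ρ x : ℂ) * v x) x / (ρ x : ℂ) = v x at this
  rw [div_eq_iff (hρne x)] at this
  rw [this, mul_comm]

/-- A bounded function vanishes if each of its bounds, measured with the weight `ρ`, can be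
halved. -/
theorem eq_zero_of_halving {X : Type*} {ρ : X → ℝ} {d : X → ℂ} {s : Set X}
    (hb : ∃ M, 0 ≤ M ∧ ∀ x ∈ s, ‖d x‖ ≤ M * ρ x)
    (h : ∀ M, 0 ≤ M → (∀ x ∈ s, ‖d x‖ ≤ M * ρ x) → ∀ x ∈ s, ‖d x‖ ≤ M / 2 * ρ x) :
    ∀ x ∈ s, d x = 0 := by
  obtain ⟨M, hM0, hM⟩ := hb
  have key : ∀ n : ℕ, ∀ x ∈ s, ‖d x‖ ≤ (1 / 2) ^ n * M * ρ x := by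
    intro n
    induction n with
    | zero => simpa using hM
    | succ n ih =>
      intro x hx
      refine (h _ (by positivity) ih x hx).trans (le_of_eq ?_)
      rw [pow_succ]; ring
  intro x hx
  have hlim : Filter.Tendsto (fun n : ℕ => (1 / 2 : ℝ) ^ n * M * ρ x) Filter.atTop (nhds 0) := by
    have := ((tendsto_pow_atTop_nhds_zero_of_lt_one (r := (1 / 2 : ℝ)) (by norm_num)
      (by norm_num)).mul_const M).mul_const (ρ x)
    simpa using this
  exact norm_le_zero_iff.1 (ge_of_tendsto' hlim fun n => key n x hx)

theorem integral_exp_mul_le {μ : ℝ} (hμ : 0 < μ) (x : ℝ) :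
    ∫ a in (0 : ℝ)..x, Real.exp (μ * a) ≤ Real.exp (μ * x) / μ := by
  have : ∫ a in (0 : ℝ)..x, Real.exp (μ * a) = (Real.exp (μ * x) - 1) / μ := by
    rw [intervalIntegral.integral_comp_mul_left (fun a => Real.exp a) hμ.ne', integral_exp]
    simp; field_simp
  rw [this]
  gcongr
  linarith

/-! ### Double integrals of `q(a + b) u(a, b)` -/

theorem integrable_shift {q : ℝ → ℂ} (hqi : Integrable q) (a : ℝ) :
    Integrable fun b => q (a + b) := hqi.comp_add_left a

theorem intervalIntegrable_shift {q : ℝ → ℂ} (hqi : Integrable q) (a c d : ℝ) :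
    IntervalIntegrable (fun b => q (a + b)) volume c d :=
  (integrable_shift hqi a).intervalIntegrable

theorem integral_norm_shift_le {q : ℝ → ℂ} (hqi : Integrable q) (a : ℝ) {c d : ℝ} (hcd : c ≤ d) :
    ∫ b in c..d, ‖q (a + b)‖ ≤ ∫ y, ‖q y‖ := by
  rw [intervalIntegral.integral_of_le hcd, ← integral_add_left_eq_self (fun y => ‖q y‖) a]
  exact setIntegral_le_integral (integrable_shift hqi a).norm (ae_of_all _ fun _ => norm_nonneg _)

theorem integrable_shift_prod {q : ℝ → ℂ} (hq : Measurable q) (hqi : Integrable q) (A B c d : ℝ) :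
    Integrable (fun p : ℝ × ℝ => q (p.1 + p.2))
      ((volume.restrict (uIoc A B)).prod (volume.restrict (uIoc c d))) := by
  have hm : Measurable fun p : ℝ × ℝ => q (p.1 + p.2) := hq.comp (by fun_prop)
  rw [integrable_prod_iff hm.aestronglyMeasurable]
  refine ⟨ae_of_all _ fun a => (integrable_shift hqi a).restrict, ?_⟩
  have hfin : IsFiniteMeasure (volume.restrict (uIoc A B)) := ⟨by
    rw [Measure.restrict_apply_univ, uIoc]; exact measure_Ioc_lt_top⟩
  refine Integrable.of_bound (C := ∫ y, ‖q y‖)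
    (hm.norm.aestronglyMeasurable.integral_prod_right') (ae_of_all _ fun a => ?_)
  rw [Real.norm_of_nonneg (integral_nonneg fun _ => norm_nonneg _)]
  have := setIntegral_le_integral (s := uIoc c d) (integrable_shift hqi a).norm
    (ae_of_all _ fun _ => norm_nonneg _)
  refine this.trans (le_of_eq ?_)
  exact integral_add_left_eq_self (fun y => ‖q y‖) a

theorem integrable_shift_mul_prod {q : ℝ → ℂ} (hq : Measurable q) (hqi : Integrable q)
    {u : ℝ × ℝ → ℂ} (hu : Continuous u) (A B c d : ℝ) :
    Integrable (fun p : ℝ × ℝ => q (p.1 + p.2) * u p)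
      ((volume.restrict (uIoc A B)).prod (volume.restrict (uIoc c d))) := by
  obtain ⟨C, hC⟩ := ((isCompact_uIcc (a := A) (b := B)).prod
    (isCompact_uIcc (a := c) (b := d))).exists_bound_of_continuousOn hu.continuousOn
  refine (integrable_shift_prod hq hqi A B c d).mul_bdd (c := C) hu.aestronglyMeasurable ?_
  rw [Measure.prod_restrict]
  filter_upwards [ae_restrict_mem (measurableSet_uIoc.prod measurableSet_uIoc)] with p hp
  exact hC p ⟨uIoc_subset_uIcc hp.1, uIoc_subset_uIcc hp.2⟩

theorem intervalIntegrable_shift_mul {q : ℝ → ℂ} (hqi : Integrable q) {u : ℝ → ℂ}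
    (hu : Continuous u) (a c d : ℝ) :
    IntervalIntegrable (fun b => q (a + b) * u b) volume c d :=
  (intervalIntegrable_shift hqi a c d).mul_continuousOn hu.continuousOn

theorem intervalIntegrable_integral_shift_mul {q : ℝ → ℂ} (hq : Measurable q) (hqi : Integrable q)
    {u : ℝ × ℝ → ℂ} (hu : Continuous u)
    (A B c d : ℝ) :
    IntervalIntegrable (fun a => ∫ b in c..d, q (a + b) * u (a, b)) volume A B := by
  have h1 := (integrable_shift_mul_prod hq hqi hu A B c d).integral_prod_left
  rw [intervalIntegrable_iff]
  have : (fun a => ∫ b in c..d, q (a + b) * u (a, b)) = fun a =>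
      (if c ≤ d then (1 : ℝ) else -1) • ∫ b, q (a + b) * u (a, b)
        ∂(volume.restrict (uIoc c d)) := by
    ext a; rw [intervalIntegral.intervalIntegral_eq_integral_uIoc]
  rw [this]
  exact Integrable.smul (if c ≤ d then (1 : ℝ) else -1) h1

theorem integral_integral_shift_mul_swap {q : ℝ → ℂ} (hq : Measurable q) (hqi : Integrable q)
    {u : ℝ × ℝ → ℂ} (hu : Continuous u) (A B c d : ℝ) :
    ∫ a in A..B, ∫ b in c..d, q (a + b) * u (a, b) =
      ∫ b in c..d, ∫ a in A..B, q (a + b) * u (a, b) :=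
  intervalIntegral_intervalIntegral_swap (F := fun a b => q (a + b) * u (a, b))
    (by
      rw [IntegrableOn, Measure.volume_eq_prod, ← Measure.prod_restrict]
      exact integrable_shift_mul_prod hq hqi hu A B c d)

/-- The `L₁`-norm of the increment of a primitive of `q` over a step `d - c`. -/
theorem integral_integral_norm_shift_le {q : ℝ → ℂ} (hq : Measurable q) (hqi : Integrable q)
    {A B c d : ℝ} (hAB : A ≤ B) (hcd : c ≤ d) :
    ∫ a in A..B, ∫ b in c..d, ‖q (a + b)‖ ≤ (d - c) * ∫ y, ‖q y‖ := by
  rw [intervalIntegral_intervalIntegral_swap (F := fun a b => ‖q (a + b)‖)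
    (by
      rw [IntegrableOn, Measure.volume_eq_prod, ← Measure.prod_restrict]
      exact (integrable_shift_prod hq hqi A B c d).norm)]
  calc _ ≤ ∫ b in c..d, ∫ y, ‖q y‖ := by
        refine intervalIntegral.integral_mono_on hcd ?_ intervalIntegrable_const fun b _ => ?_
        · rw [intervalIntegrable_iff]
          have := (integrable_shift_prod hq hqi A B c d).norm.integral_prod_right
          refine this.congr (ae_of_all _ fun b => ?_)
          simp only [intervalIntegral.integral_of_le hAB, uIoc_of_le hAB]
        · simp_rw [add_comm _ b]
          exact integral_norm_shift_le hqi b hAB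
    _ = _ := by rw [intervalIntegral.integral_const, smul_eq_mul]

theorem norm_integral_shift_mul_le {q : ℝ → ℂ} (hqi : Integrable q) {u : ℝ → ℂ} {M a c d : ℝ}
    (hcd : c ≤ d) (hu : ∀ b ∈ Icc c d, ‖u b‖ ≤ M) :
    ‖∫ b in c..d, q (a + b) * u b‖ ≤ M * ∫ b in c..d, ‖q (a + b)‖ := by
  rw [← intervalIntegral.integral_const_mul]
  refine intervalIntegral.norm_integral_le_of_norm_le hcd (ae_of_all _ fun b hb => ?_)
    ((intervalIntegrable_shift hqi a c d).norm.const_mul M)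
  rw [norm_mul, mul_comm]
  exact mul_le_mul_of_nonneg_right (hu b (Ioc_subset_Icc_self hb)) (norm_nonneg _)

theorem norm_integral_integral_shift_mul_le {q : ℝ → ℂ} (hqi : Integrable q) {u : ℝ × ℝ → ℂ}
    {ρ : ℝ → ℝ} (hρ : Continuous ρ) {A B c d : ℝ} (hAB : A ≤ B) (hcd : c ≤ d)
    (h : ∀ a ∈ Icc A B, ∀ b ∈ Icc c d, ‖u (a, b)‖ ≤ ρ a) :
    ‖∫ a in A..B, ∫ b in c..d, q (a + b) * u (a, b)‖ ≤
      (∫ a in A..B, ρ a) * ∫ y, ‖q y‖ := by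
  rw [← intervalIntegral.integral_mul_const]
  refine intervalIntegral.norm_integral_le_of_norm_le hAB (ae_of_all _ fun a ha => ?_)
    ((hρ.mul continuous_const).intervalIntegrable _ _)
  have ha' := Ioc_subset_Icc_self ha
  have h0 : 0 ≤ ρ a := (norm_nonneg _).trans (h a ha' c (left_mem_Icc.2 hcd))
  refine (norm_integral_shift_mul_le hqi (u := fun b => u (a, b)) hcd (h a ha')).trans ?_
  exact mul_le_mul_of_nonneg_left (integral_norm_shift_le hqi a hcd) h0

/-- The double integral is a Lipschitz function of its upper limits. -/
theorem norm_integral_integral_shift_mul_sub_le {q : ℝ → ℂ} (hq : Measurable q) (hqi : Integrable q)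
    {u : ℝ × ℝ → ℂ} (hu : Continuous u) {M X : ℝ}
    (hM : ∀ a ∈ Icc 0 X, ∀ b ∈ Icc 0 X, ‖u (a, b)‖ ≤ M) {ξ ξ' η η' : ℝ}
    (hξ : ξ ∈ Icc 0 X) (hξ' : ξ' ∈ Icc 0 X) (hη : η ∈ Icc 0 X) (hη' : η' ∈ Icc 0 X) :
    ‖(∫ a in (0 : ℝ)..ξ, ∫ b in (0 : ℝ)..η, q (a + b) * u (a, b)) -
      ∫ a in (0 : ℝ)..ξ', ∫ b in (0 : ℝ)..η', q (a + b) * u (a, b)‖ ≤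
      M * (∫ y, ‖q y‖) * (|ξ - ξ'| + |η - η'|) := by
  have h00 : (0 : ℝ) ∈ Icc 0 X := left_mem_Icc.2 (hξ.1.trans hξ.2)
  have hM0 : 0 ≤ M := (norm_nonneg _).trans (hM 0 h00 0 h00)
  have h1 : ∀ c ∈ Icc 0 X, ∀ x ∈ Icc 0 X, ∀ y ∈ Icc 0 X, x ≤ y →
      ‖(∫ a in (0 : ℝ)..y, ∫ b in (0 : ℝ)..c, q (a + b) * u (a, b)) -
        ∫ a in (0 : ℝ)..x, ∫ b in (0 : ℝ)..c, q (a + b) * u (a, b)‖ ≤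
        M * (∫ y, ‖q y‖) * (y - x) := by
    intro c hc x hx y hy hxy
    rw [intervalIntegral.integral_interval_sub_left
      (intervalIntegrable_integral_shift_mul hq hqi hu _ _ _ _)
      (intervalIntegrable_integral_shift_mul hq hqi hu _ _ _ _)]
    refine (norm_integral_integral_shift_mul_le hqi (ρ := fun _ => M) continuous_const hxy hc.1
      fun a ha b hb => hM a ⟨hx.1.trans ha.1, ha.2.trans hy.2⟩ b ⟨hb.1, hb.2.trans hc.2⟩).trans
      (le_of_eq ?_)
    rw [intervalIntegral.integral_const, smul_eq_mul]; ring
  have h2 : ∀ c ∈ Icc 0 X, ∀ x ∈ Icc 0 X, ∀ y ∈ Icc 0 X, x ≤ y →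
      ‖(∫ a in (0 : ℝ)..c, ∫ b in (0 : ℝ)..y, q (a + b) * u (a, b)) -
        ∫ a in (0 : ℝ)..c, ∫ b in (0 : ℝ)..x, q (a + b) * u (a, b)‖ ≤
        M * (∫ y, ‖q y‖) * (y - x) := by
    intro c hc x hx y hy hxy
    rw [← intervalIntegral.integral_sub
      (intervalIntegrable_integral_shift_mul hq hqi hu _ _ _ _)
      (intervalIntegrable_integral_shift_mul hq hqi hu _ _ _ _)]
    have e : ∀ a, (∫ b in (0 : ℝ)..y, q (a + b) * u (a, b)) -
        ∫ b in (0 : ℝ)..x, q (a + b) * u (a, b) = ∫ b in x..y, q (a + b) * u (a, b) := fun a =>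
      intervalIntegral.integral_interval_sub_left
        (intervalIntegrable_shift_mul hqi (by fun_prop) _ _ _)
        (intervalIntegrable_shift_mul hqi (by fun_prop) _ _ _)
    simp only [e]
    have hint : IntervalIntegrable (fun a => ∫ b in x..y, ‖q (a + b)‖) volume 0 c := by
      rw [intervalIntegrable_iff]
      have := (integrable_shift_prod hq hqi 0 c x y).norm.integral_prod_left
      refine this.congr (ae_of_all _ fun b => ?_)
      simp only [intervalIntegral.integral_of_le hxy, uIoc_of_le hxy]
    calc _ ≤ ∫ a in (0 : ℝ)..c, M * ∫ b in x..y, ‖q (a + b)‖ := by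
          refine intervalIntegral.norm_integral_le_of_norm_le hc.1 (ae_of_all _ fun a ha => ?_)
            (hint.const_mul M)
          exact norm_integral_shift_mul_le hqi (u := fun b => u (a, b)) hxy fun b hb =>
            hM a ⟨ha.1.le, ha.2.trans hc.2⟩ b ⟨hx.1.trans hb.1, hb.2.trans hy.2⟩
      _ ≤ M * ((y - x) * ∫ y, ‖q y‖) := by
          rw [intervalIntegral.integral_const_mul]
          exact mul_le_mul_of_nonneg_left (integral_integral_norm_shift_le hq hqi hc.1 hxy) hM0
      _ = _ := by ring
  have h1' : ‖(∫ a in (0 : ℝ)..ξ, ∫ b in (0 : ℝ)..η, q (a + b) * u (a, b)) -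
      ∫ a in (0 : ℝ)..ξ', ∫ b in (0 : ℝ)..η, q (a + b) * u (a, b)‖ ≤
      M * (∫ y, ‖q y‖) * |ξ - ξ'| := by
    rcases le_total ξ ξ' with hle | hle
    · rw [norm_sub_rev, abs_sub_comm, abs_of_nonneg (sub_nonneg.2 hle)]
      exact h1 η hη ξ hξ ξ' hξ' hle
    · rw [abs_of_nonneg (sub_nonneg.2 hle)]
      exact h1 η hη ξ' hξ' ξ hξ hle
  have h2' : ‖(∫ a in (0 : ℝ)..ξ', ∫ b in (0 : ℝ)..η, q (a + b) * u (a, b)) -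
      ∫ a in (0 : ℝ)..ξ', ∫ b in (0 : ℝ)..η', q (a + b) * u (a, b)‖ ≤
      M * (∫ y, ‖q y‖) * |η - η'| := by
    rcases le_total η η' with hle | hle
    · rw [norm_sub_rev, abs_sub_comm, abs_of_nonneg (sub_nonneg.2 hle)]
      exact h2 ξ' hξ' η hη η' hη' hle
    · rw [abs_of_nonneg (sub_nonneg.2 hle)]
      exact h2 ξ' hξ' η' hη' η hη hle
  calc _ ≤ _ := norm_sub_le_norm_sub_add_norm_sub _
        (∫ a in (0 : ℝ)..ξ', ∫ b in (0 : ℝ)..η, q (a + b) * u (a, b)) _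
    _ ≤ _ := by rw [mul_add]; exact add_le_add h1' h2'


/-! ### The Goursat problem -/

/-- The retraction of the real line onto `[0, X]`. -/
noncomputable def clamp (X x : ℝ) : ℝ := max 0 (min x X)

theorem continuous_clamp (X : ℝ) : Continuous (clamp X) := by unfold clamp; fun_prop

theorem clamp_mem {X : ℝ} (hX : 0 ≤ X) (x : ℝ) : clamp X x ∈ Icc 0 X :=
  ⟨le_max_left _ _, max_le hX (min_le_right _ _)⟩

theorem clamp_of_mem {X x : ℝ} (hx : x ∈ Icc 0 X) : clamp X x = x := by
  rw [clamp, min_eq_left hx.2, max_eq_right hx.1]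

theorem exists_bound_square {u : ℝ × ℝ → ℂ} (hu : Continuous u) (X : ℝ) :
    ∃ M, 0 ≤ M ∧ ∀ a ∈ Icc 0 X, ∀ b ∈ Icc 0 X, ‖u (a, b)‖ ≤ M := by
  obtain ⟨C, hC⟩ := ((isCompact_Icc (a := (0 : ℝ)) (b := X)).prod
    (isCompact_Icc (a := (0 : ℝ)) (b := X))).exists_bound_of_continuousOn hu.continuousOn
  exact ⟨max C 0, le_max_right _ _, fun a ha b hb => (hC (a, b) ⟨ha, hb⟩).trans (le_max_left _ _)⟩

/-- `w` solves the Goursat problem `w_{ξη} = q(ξ + η) w` on `[0, X]²` in the integrated form; the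
values on the sides of the square are given by `S`. -/
def Goursat (S q : ℝ → ℂ) (X : ℝ) (w : ℝ × ℝ → ℂ) : Prop :=
  ∀ ξ ∈ Icc 0 X, ∀ η ∈ Icc 0 X, w (ξ, η) = (1 / 2) * S ξ + (1 / 2) * S η +
    ∫ a in (0 : ℝ)..ξ, ∫ b in (0 : ℝ)..η, q (a + b) * w (a, b)

/-- With the weight `exp (μ ξ)`, for `μ = 2 ‖q‖₁ + 1`, the integral operator of the Goursat problem
halves distances. -/
theorem norm_goursat_integral_le {q : ℝ → ℂ} (hqi : Integrable q) {u : ℝ × ℝ → ℂ}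
    {M ξ η : ℝ} (hM : 0 ≤ M) (hξ : 0 ≤ ξ) (hη : 0 ≤ η)
    (h : ∀ a ∈ Icc 0 ξ, ∀ b ∈ Icc 0 η,
      ‖u (a, b)‖ ≤ M * Real.exp ((2 * (∫ y, ‖q y‖) + 1) * a)) :
    ‖∫ a in (0 : ℝ)..ξ, ∫ b in (0 : ℝ)..η, q (a + b) * u (a, b)‖ ≤
      M / 2 * Real.exp ((2 * (∫ y, ‖q y‖) + 1) * ξ) := by
  set Q := ∫ y, ‖q y‖ with hQ
  have hQ0 : 0 ≤ Q := integral_nonneg fun _ => norm_nonneg _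
  have hμ : 0 < 2 * Q + 1 := by linarith
  have h1 := norm_integral_integral_shift_mul_le hqi
    (ρ := fun a => M * Real.exp ((2 * Q + 1) * a)) (by fun_prop) hξ hη h
  refine h1.trans ?_
  rw [intervalIntegral.integral_const_mul, ← hQ]
  calc M * (∫ a in (0 : ℝ)..ξ, Real.exp ((2 * Q + 1) * a)) * Q
      ≤ M * (Real.exp ((2 * Q + 1) * ξ) / (2 * Q + 1)) * Q := by
        gcongr; exact integral_exp_mul_le hμ ξ
    _ = (Q / (2 * Q + 1)) * (M * Real.exp ((2 * Q + 1) * ξ)) := by ring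
    _ ≤ (1 / 2) * (M * Real.exp ((2 * Q + 1) * ξ)) := by
        refine mul_le_mul_of_nonneg_right ?_ (by positivity)
        rw [div_le_iff₀ hμ]; linarith
    _ = _ := by ring

/-- The Goursat problem is solvable. The arguments are retracted to `[0, X]`, so that the fixed
point is sought among functions on the whole plane. -/
theorem exists_goursat {S q : ℝ → ℂ} (hS : Continuous S) (hq : Measurable q)
    (hqi : Integrable q) {X : ℝ} (hX : 0 ≤ X) :
    ∃ w : ℝ × ℝ → ℂ, Continuous w ∧ Goursat S q X w := by
  set μ := 2 * (∫ y, ‖q y‖) + 1 with hμ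
  have hcl := continuous_clamp X
  obtain ⟨w, hw, hfix⟩ := exists_fixedPoint_of_weight
    (ρ := fun p : ℝ × ℝ => Real.exp (μ * clamp X p.1)) (by fun_prop) (fun _ => Real.exp_pos _)
    (fun u p => (1 / 2) * S (clamp X p.1) + (1 / 2) * S (clamp X p.2) +
      ∫ a in (0 : ℝ)..clamp X p.1, ∫ b in (0 : ℝ)..clamp X p.2, q (a + b) * u (a, b))
    (fun u hu => by
      refine Continuous.add (by fun_prop) ?_
      obtain ⟨M, hM0, hM⟩ := exists_bound_square hu X
      refine continuous_iff_continuousAt.2 fun p₀ => ?_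
      refine tendsto_iff_norm_sub_tendsto_zero.2 (squeeze_zero (fun _ => norm_nonneg _) (fun p =>
        norm_integral_integral_shift_mul_sub_le hq hqi hu hM (clamp_mem hX p.1)
          (clamp_mem hX p₀.1) (clamp_mem hX p.2) (clamp_mem hX p₀.2)) ?_)
      have hc : Continuous fun p : ℝ × ℝ => M * (∫ y, ‖q y‖) *
          (|clamp X p.1 - clamp X p₀.1| + |clamp X p.2 - clamp X p₀.2|) := by fun_prop
      have := hc.tendsto p₀
      simpa using this)
    (by
      obtain ⟨C, hC⟩ := (isCompact_Icc (a := 0) (b := X)).exists_bound_of_continuousOn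
        hS.continuousOn
      have hC0 : 0 ≤ C := (norm_nonneg _).trans (hC 0 (left_mem_Icc.2 hX))
      refine ⟨C, fun p => ?_⟩
      simp only [Pi.zero_apply, mul_zero, intervalIntegral.integral_zero, add_zero]
      have h1 := hC _ (clamp_mem hX p.1)
      have h2 := hC _ (clamp_mem hX p.2)
      have h3 : 1 ≤ Real.exp (μ * clamp X p.1) := Real.one_le_exp (mul_nonneg
        (by have : 0 ≤ ∫ y, ‖q y‖ := integral_nonneg fun _ => norm_nonneg _
            linarith) (clamp_mem hX p.1).1)
      calc _ ≤ ‖(1 / 2 : ℂ) * S (clamp X p.1)‖ + ‖(1 / 2 : ℂ) * S (clamp X p.2)‖ :=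
            norm_add_le _ _
        _ ≤ C := by
            rw [norm_mul, norm_mul]; norm_num; linarith
        _ ≤ _ := le_mul_of_one_le_right hC0 h3)
    (fun u v M hu hv h p => by
      have hM0 : 0 ≤ M := by
        have := (norm_nonneg _).trans (h p)
        exact nonneg_of_mul_nonneg_left this (Real.exp_pos _)
      have e : ∀ a, (∫ b in (0 : ℝ)..clamp X p.2, q (a + b) * u (a, b)) -
          (∫ b in (0 : ℝ)..clamp X p.2, q (a + b) * v (a, b)) =
          ∫ b in (0 : ℝ)..clamp X p.2, q (a + b) * (u - v) (a, b) := fun a => by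
        rw [← intervalIntegral.integral_sub (intervalIntegrable_shift_mul hqi (by fun_prop) _ _ _)
          (intervalIntegrable_shift_mul hqi (by fun_prop) _ _ _)]
        simp only [Pi.sub_apply, mul_sub]
      rw [add_sub_add_left_eq_sub, ← intervalIntegral.integral_sub
        (intervalIntegrable_integral_shift_mul hq hqi hu _ _ _ _)
        (intervalIntegrable_integral_shift_mul hq hqi hv _ _ _ _)]
      simp only [e]
      refine norm_goursat_integral_le hqi hM0 (clamp_mem hX p.1).1 (clamp_mem hX p.2).1
        fun a ha b hb => ?_
      have := h (a, b)
      rwa [clamp_of_mem ⟨ha.1, ha.2.trans (clamp_mem hX p.1).2⟩] at this)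
  refine ⟨w, hw, fun ξ hξ η hη => ?_⟩
  have := hfix (ξ, η)
  rwa [clamp_of_mem hξ, clamp_of_mem hη] at this

/-- A solution of the Goursat problem is symmetric, by uniqueness for the homogeneous problem. -/
theorem Goursat.symm {S q : ℝ → ℂ} (hq : Measurable q) (hqi : Integrable q) {X : ℝ}
    {w : ℝ × ℝ → ℂ} (hw : Continuous w) (h : Goursat S q X w) {ξ η : ℝ} (hξ : ξ ∈ Icc 0 X)
    (hη : η ∈ Icc 0 X) : w (ξ, η) = w (η, ξ) := by
  set d : ℝ × ℝ → ℂ := fun p => w p - w p.swap with hd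
  have hdc : Continuous d := by fun_prop
  have heq : ∀ ξ ∈ Icc 0 X, ∀ η ∈ Icc 0 X,
      d (ξ, η) = ∫ a in (0 : ℝ)..ξ, ∫ b in (0 : ℝ)..η, q (a + b) * d (a, b) := by
    intro ξ hξ η hη
    have e : ∀ a, ∫ b in (0 : ℝ)..η, q (a + b) * d (a, b) =
        (∫ b in (0 : ℝ)..η, q (a + b) * w (a, b)) -
          ∫ b in (0 : ℝ)..η, q (a + b) * w (b, a) := fun a => by
      rw [← intervalIntegral.integral_sub (intervalIntegrable_shift_mul hqi (by fun_prop) _ _ _)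
        (intervalIntegrable_shift_mul hqi (by fun_prop) _ _ _)]
      simp only [hd, Prod.swap_prod_mk, mul_sub]
    simp only [e]
    rw [intervalIntegral.integral_sub (intervalIntegrable_integral_shift_mul hq hqi hw _ _ _ _)
      (intervalIntegrable_integral_shift_mul hq hqi (u := fun p => w (p.2, p.1))
        (by fun_prop) _ _ _ _),
      integral_integral_shift_mul_swap hq hqi (u := fun p => w (p.2, p.1)) (by fun_prop)]
    simp only [hd, Prod.swap_prod_mk, h ξ hξ η hη, h η hη ξ hξ]
    simp_rw [add_comm]
    ring
  have hz := eq_zero_of_halving (d := d) (s := Icc 0 X ×ˢ Icc 0 X)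
    (ρ := fun p : ℝ × ℝ => Real.exp ((2 * (∫ y, ‖q y‖) + 1) * p.1))
    (by
      obtain ⟨M, hM0, hM⟩ := exists_bound_square hdc X
      refine ⟨M, hM0, fun p hp => (hM p.1 hp.1 p.2 hp.2).trans
        (le_mul_of_one_le_right hM0 (Real.one_le_exp (mul_nonneg ?_ hp.1.1)))⟩
      have : 0 ≤ ∫ y, ‖q y‖ := integral_nonneg fun _ => norm_nonneg _
      linarith)
    (fun M hM0 hM p hp => by
      rw [← Prod.mk.eta (p := p), heq p.1 hp.1 p.2 hp.2]
      exact norm_goursat_integral_le hqi hM0 hp.1.1 hp.2.1 fun a ha b hb =>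
        hM (a, b) ⟨⟨ha.1, ha.2.trans hp.1.2⟩, ⟨hb.1, hb.2.trans hp.2.2⟩⟩)
    (ξ, η) ⟨hξ, hη⟩
  exact sub_eq_zero.1 hz

/-- The second difference over the square `[η, ξ]²` of a function `W` with the mixed derivative
`q(a + b) W` is the integral of this derivative. -/
def SquareIdentity (q : ℝ → ℂ) (W : ℝ × ℝ → ℂ) : Prop :=
  ∀ ξ ∈ Icc (0 : ℝ) 1, ∀ η ∈ Icc (0 : ℝ) 1, η ≤ ξ →
    W (ξ, ξ) + W (η, η) - W (ξ, η) - W (η, ξ) =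
      ∫ a in η..ξ, ∫ b in η..ξ, q (a + b) * W (a, b)

theorem Goursat.squareIdentity {S q : ℝ → ℂ} (hq : Measurable q) (hqi : Integrable q) {X : ℝ}
    (hX : 1 ≤ X) {w : ℝ × ℝ → ℂ} (hw : Continuous w) (h : Goursat S q X w) :
    SquareIdentity q w := by
  intro ξ hξ η hη _
  have hξ' : ξ ∈ Icc 0 X := ⟨hξ.1, hξ.2.trans hX⟩
  have hη' : η ∈ Icc 0 X := ⟨hη.1, hη.2.trans hX⟩
  rw [h ξ hξ' ξ hξ', h η hη' η hη', h ξ hξ' η hη', h η hη' ξ hξ']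
  have e : ∀ a, ∫ b in η..ξ, q (a + b) * w (a, b) =
      (∫ b in (0 : ℝ)..ξ, q (a + b) * w (a, b)) - ∫ b in (0 : ℝ)..η, q (a + b) * w (a, b) :=
    fun a => (intervalIntegral.integral_interval_sub_left
        (intervalIntegrable_shift_mul hqi (by fun_prop) _ _ _)
        (intervalIntegrable_shift_mul hqi (by fun_prop) _ _ _)).symm
  have I := fun A B c d => intervalIntegrable_integral_shift_mul hq hqi hw A B c d
  rw [← intervalIntegral.integral_interval_sub_left (I 0 ξ η ξ) (I 0 η η ξ)]
  simp only [e]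
  rw [intervalIntegral.integral_sub (I _ _ _ _) (I _ _ _ _),
    intervalIntegral.integral_sub (I _ _ _ _) (I _ _ _ _)]
  ring

/-- A symmetric function which satisfies the square identity and vanishes on the diagonal is
zero. The weight `exp (μ |a - b|)` makes the contributions of both variables small. -/
theorem SquareIdentity.eq_zero {q : ℝ → ℂ} (hqi : Integrable q)
    {D : ℝ × ℝ → ℂ} (hD : Continuous D) (h : SquareIdentity q D)
    (hs : ∀ ξ ∈ Icc (0 : ℝ) 1, ∀ η ∈ Icc (0 : ℝ) 1, D (ξ, η) = D (η, ξ))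
    (hd : ∀ ξ ∈ Icc (0 : ℝ) 1, D (ξ, ξ) = 0) {ξ η : ℝ} (hξ : ξ ∈ Icc (0 : ℝ) 1)
    (hη : η ∈ Icc (0 : ℝ) 1) : D (ξ, η) = 0 := by
  set Q := ∫ y, ‖q y‖ with hQ
  have hQ0 : 0 ≤ Q := integral_nonneg fun _ => norm_nonneg _
  set μ := 2 * Q + 1 with hμd
  have hμ : 0 < μ := by linarith
  refine eq_zero_of_halving (d := D) (s := Icc (0 : ℝ) 1 ×ˢ Icc (0 : ℝ) 1)
    (ρ := fun p : ℝ × ℝ => Real.exp (μ * |p.1 - p.2|)) ?_ ?_ (ξ, η) ⟨hξ, hη⟩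
  · obtain ⟨M, hM0, hM⟩ := exists_bound_square hD 1
    exact ⟨M, hM0, fun p hp => (hM p.1 hp.1 p.2 hp.2).trans
      (le_mul_of_one_le_right hM0 (Real.one_le_exp (by positivity)))⟩
  · intro M hM0 hM
    have key : ∀ ξ ∈ Icc (0 : ℝ) 1, ∀ η ∈ Icc (0 : ℝ) 1, η ≤ ξ →
        ‖D (ξ, η)‖ ≤ M / 2 * Real.exp (μ * (ξ - η)) := by
      intro ξ hξ η hη hle
      have h1 := h ξ hξ η hη hle
      rw [hd ξ hξ, hd η hη, ← hs ξ hξ η hη] at h1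
      have h2 : D (ξ, η) = -(1 / 2) * ∫ a in η..ξ, ∫ b in η..ξ, q (a + b) * D (a, b) := by
        rw [← h1]; ring
      have h3 := norm_integral_integral_shift_mul_le hqi (u := D)
        (ρ := fun a => M * (Real.exp (μ * (ξ - a)) + Real.exp (μ * (a - η)))) (by fun_prop)
        hle hle (fun a ha b hb => by
          refine (hM (a, b) ⟨⟨hη.1.trans ha.1, ha.2.trans hξ.2⟩,
            ⟨hη.1.trans hb.1, hb.2.trans hξ.2⟩⟩).trans (mul_le_mul_of_nonneg_left ?_ hM0)
          rcases le_total a b with hab | hab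
          · rw [abs_sub_comm, abs_of_nonneg (sub_nonneg.2 hab)]
            refine le_add_of_le_of_nonneg (Real.exp_le_exp.2 ?_) (Real.exp_nonneg _)
            exact mul_le_mul_of_nonneg_left (by linarith [hb.2]) hμ.le
          · rw [abs_of_nonneg (sub_nonneg.2 hab)]
            refine le_add_of_nonneg_of_le (Real.exp_nonneg _) (Real.exp_le_exp.2 ?_)
            exact mul_le_mul_of_nonneg_left (by linarith [hb.1]) hμ.le)
      have h4 : ∫ a in η..ξ, Real.exp (μ * (ξ - a)) ≤ Real.exp (μ * (ξ - η)) / μ := by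
        rw [intervalIntegral.integral_comp_sub_left (fun a => Real.exp (μ * a)), sub_self]
        exact integral_exp_mul_le hμ _
      have h5 : ∫ a in η..ξ, Real.exp (μ * (a - η)) ≤ Real.exp (μ * (ξ - η)) / μ := by
        rw [intervalIntegral.integral_comp_sub_right (fun a => Real.exp (μ * a)), sub_self]
        exact integral_exp_mul_le hμ _
      rw [intervalIntegral.integral_const_mul, intervalIntegral.integral_add
        (Continuous.intervalIntegrable (by fun_prop) _ _)
        (Continuous.intervalIntegrable (by fun_prop) _ _), ← hQ] at h3
      rw [h2, norm_mul]
      have hn : ‖(-(1 / 2) : ℂ)‖ = 1 / 2 := by norm_num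
      rw [hn]
      calc 1 / 2 * _ ≤ 1 / 2 * (M * (Real.exp (μ * (ξ - η)) / μ +
            Real.exp (μ * (ξ - η)) / μ) * Q) := by
            refine mul_le_mul_of_nonneg_left (h3.trans ?_) (by norm_num)
            gcongr
        _ = (Q / μ) * (M * Real.exp (μ * (ξ - η))) := by ring
        _ ≤ (1 / 2) * (M * Real.exp (μ * (ξ - η))) := by
            refine mul_le_mul_of_nonneg_right ?_ (by positivity)
            rw [div_le_iff₀ hμ]; linarith
        _ = _ := by ring
    rintro ⟨ξ, η⟩ ⟨hξ, hη⟩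
    simp only at hξ hη ⊢
    rcases le_total η ξ with hle | hle
    · rw [abs_of_nonneg (sub_nonneg.2 hle)]; exact key ξ hξ η hη hle
    · rw [abs_sub_comm, abs_of_nonneg (sub_nonneg.2 hle), hs ξ hξ η hη]; exact key η hη ξ hξ hle


/-! ### The kernel of the transformation operator -/

/-- The solution `sin (ν x) / ν` of `s'' + ν² s = 0`, `s(0) = 0`, `s'(0) = 1`. -/
noncomputable def sn (ν x : ℝ) : ℝ := if ν = 0 then x else Real.sin (ν * x) / ν

theorem hasDerivAt_sn (ν x : ℝ) : HasDerivAt (sn ν) (Real.cos (ν * x)) x := by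
  unfold sn
  split_ifs with h
  · rw [h, zero_mul, Real.cos_zero]; exact hasDerivAt_id x
  · have := ((Real.hasDerivAt_sin (ν * x)).comp x ((hasDerivAt_id x).const_mul ν)).div_const ν
    convert! this using 1
    field_simp

theorem hasDerivAt_cos_mul (ν x : ℝ) :
    HasDerivAt (fun x => Real.cos (ν * x)) (-(ν ^ 2 * sn ν x)) x := by
  have := (Real.hasDerivAt_cos (ν * x)).comp x ((hasDerivAt_id x).const_mul ν)
  convert! this using 1
  unfold sn
  split_ifs with h
  · simp [h]
  · field_simp

theorem continuous_sn (ν : ℝ) : Continuous (sn ν) :=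
  continuous_iff_continuousAt.2 fun x => (hasDerivAt_sn ν x).continuousAt

theorem sn_zero (ν : ℝ) : sn ν 0 = 0 := by simp [sn]

theorem sn_sub (ν x y : ℝ) :
    sn ν (x - y) = sn ν x * Real.cos (ν * y) - Real.cos (ν * x) * sn ν y := by
  unfold sn
  split_ifs with h
  · simp [h]
  · rw [mul_sub, Real.sin_sub]; ring

theorem cos_sq_add_sn_sq (ν x : ℝ) : Real.cos (ν * x) ^ 2 + ν ^ 2 * sn ν x ^ 2 = 1 := by
  unfold sn
  split_ifs with h
  · simp [h]
  · rw [← Real.cos_sq_add_sin_sq (ν * x)]; field_simp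

theorem sn_eq_integral (ν x : ℝ) :
    (sn ν x : ℂ) = 0 + ∫ t in (0 : ℝ)..x, (Real.cos (ν * t) : ℂ) := by
  rw [intervalIntegral.integral_eq_sub_of_hasDerivAt (f := fun t => (sn ν t : ℂ))
    (fun t _ => (hasDerivAt_sn ν t).ofReal_comp) (Continuous.intervalIntegrable (by fun_prop) _ _),
    sn_zero]
  simp

theorem cos_eq_integral (ν x : ℝ) :
    (Real.cos (ν * x) : ℂ) = 1 + ∫ t in (0 : ℝ)..x, -(ν ^ 2 * sn ν t : ℂ) := by
  have hc := continuous_sn ν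
  have h : ∫ t in (0 : ℝ)..x, -(ν ^ 2 * sn ν t : ℂ) =
      (Real.cos (ν * x) : ℂ) - (Real.cos (ν * 0) : ℂ) :=
    intervalIntegral.integral_eq_sub_of_hasDerivAt (f := fun t => (Real.cos (ν * t) : ℂ))
      (fun t _ => by
        have := (hasDerivAt_cos_mul ν t).ofReal_comp
        push_cast at this ⊢
        exact this) (Continuous.intervalIntegrable (by fun_prop) _ _)
  rw [h]; simp

/-- The primitive of a cosine, in the form of a product. -/
theorem integral_cos_two_mul_sub (ν x c d : ℝ) :
    ∫ ξ in c..d, (Real.cos (ν * (2 * ξ - x)) : ℂ) =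
      sn ν (d - c) * Real.cos (ν * (c + d - x)) := by
  have h : ∫ ξ in c..d, (Real.cos (ν * (2 * ξ - x)) : ℂ) =
      ((sn ν (2 * d - x) / 2 : ℝ) : ℂ) - ((sn ν (2 * c - x) / 2 : ℝ) : ℂ) :=
    intervalIntegral.integral_eq_sub_of_hasDerivAt (f := fun ξ => ((sn ν (2 * ξ - x) / 2 : ℝ) : ℂ))
      (fun ξ _ => by
        refine HasDerivAt.ofReal_comp (f := fun ξ => sn ν (2 * ξ - x) / 2) ?_
        have := ((hasDerivAt_sn ν (2 * ξ - x)).comp ξ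
          (((hasDerivAt_id ξ).const_mul 2).sub_const x)).div_const 2
        convert! this using 1
        simp) (Continuous.intervalIntegrable (by fun_prop) _ _)
  rw [h, ← Complex.ofReal_sub, ← Complex.ofReal_mul]
  congr 1
  unfold sn
  split_ifs with h0
  · simp [h0]; ring
  · have e1 : ν * (2 * d - x) = ν * (d - c) + ν * (c + d - x) := by ring
    have e2 : ν * (2 * c - x) = ν * (c + d - x) - ν * (d - c) := by ring
    rw [e1, e2, Real.sin_add, Real.sin_sub]
    ring

/-- Variation of constants: a solution of the integral equation with the kernel
`sin (ν (x - y)) / ν` is a solution of the Cauchy problem `z'' = g - ν² z`, `z(0) = 1`,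
`z'(0) = h`. -/
theorem cauchy_of_variation {ν X : ℝ} {h : ℂ} {g z : ℝ → ℂ}
    (hg : IntervalIntegrable g volume 0 X)
    (hz : ∀ x ∈ Icc 0 X, z x = Real.cos (ν * x) + h * sn ν x +
      ∫ y in (0 : ℝ)..x, sn ν (x - y) * g y) :
    ∀ x ∈ Icc 0 X, z x = 1 + ∫ r in (0 : ℝ)..x, (h + ∫ s in (0 : ℝ)..r, (g s - ν ^ 2 * z s)) := by
  have hsc := continuous_sn ν
  have hgx : ∀ x ∈ Icc 0 X, IntervalIntegrable g volume 0 x := fun x hx =>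
    hg.mono_set (by
      rw [uIcc_of_le hx.1, uIcc_of_le (hx.1.trans hx.2)]
      exact Icc_subset_Icc_right hx.2)
  have hcg : ∀ x ∈ Icc 0 X, IntervalIntegrable (fun y => (Real.cos (ν * y) : ℂ) * g y) volume 0 x :=
    fun x hx => (hgx x hx).continuousOn_mul (by fun_prop)
  have hsg : ∀ x ∈ Icc 0 X, IntervalIntegrable (fun y => (sn ν y : ℂ) * g y) volume 0 x :=
    fun x hx => (hgx x hx).continuousOn_mul (by fun_prop)
  set A : ℝ → ℂ := fun x => 0 + ∫ y in (0 : ℝ)..x, (Real.cos (ν * y) : ℂ) * g y with hA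
  set B : ℝ → ℂ := fun x => 0 + ∫ y in (0 : ℝ)..x, (sn ν y : ℂ) * g y with hB
  have hAc : ∀ x ∈ Icc 0 X, ContinuousOn A (Icc 0 x) := fun x hx =>
    continuousOn_primitive hx.1 (hcg x hx) 0
  have hBc : ∀ x ∈ Icc 0 X, ContinuousOn B (Icc 0 x) := fun x hx =>
    continuousOn_primitive hx.1 (hsg x hx) 0
  have hcts : ∀ x ∈ Icc 0 X, ∀ {F : ℝ → ℂ}, ContinuousOn F (Icc 0 x) →
      IntervalIntegrable F volume 0 x := fun x hx F hF =>
    ContinuousOn.intervalIntegrable (by rwa [uIcc_of_le hx.1])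
  have hz' : ∀ x ∈ Icc 0 X, z x = Real.cos (ν * x) + h * sn ν x + (sn ν x * A x -
      Real.cos (ν * x) * B x) := by
    intro x hx
    rw [hz x hx, hA, hB]
    simp only [zero_add]
    rw [← intervalIntegral.integral_const_mul, ← intervalIntegral.integral_const_mul,
      ← intervalIntegral.integral_sub ((hcg x hx).const_mul _) ((hsg x hx).const_mul _)]
    congr 1
    refine intervalIntegral.integral_congr fun y _ => ?_
    simp only [sn_sub]
    push_cast
    ring
  have ic : ∀ x, IntervalIntegrable (fun t => (Real.cos (ν * t) : ℂ)) volume 0 x := fun x =>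
    Continuous.intervalIntegrable (by fun_prop) _ _
  have is : ∀ x, IntervalIntegrable (fun t => -(ν ^ 2 * sn ν t : ℂ)) volume 0 x := fun x =>
    Continuous.intervalIntegrable (by fun_prop) _ _
  -- the derivative of `z`
  set z₁ : ℝ → ℂ := fun r => -(ν ^ 2 * sn ν r) + h * Real.cos (ν * r) +
    (Real.cos (ν * r) * A r + ν ^ 2 * (sn ν r * B r)) with hz₁
  have step1 : ∀ x ∈ Icc 0 X, z x = 1 + ∫ r in (0 : ℝ)..x, z₁ r := by
    intro x hx
    have p1 := primitive_mul_primitive hx.1 0 0 (ic x) (hcg x hx)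
    have p2 := primitive_mul_primitive hx.1 1 0 (is x) (hsg x hx)
    simp only [← sn_eq_integral, ← cos_eq_integral] at p1 p2
    change (sn ν x : ℂ) * A x = 0 * 0 + ∫ r in (0 : ℝ)..x, ((Real.cos (ν * r) : ℂ) * A r +
      sn ν r * (Real.cos (ν * r) * g r)) at p1
    change (Real.cos (ν * x) : ℂ) * B x = 1 * 0 + ∫ r in (0 : ℝ)..x,
      (-(ν ^ 2 * sn ν r : ℂ) * B r + Real.cos (ν * r) * (sn ν r * g r)) at p2
    have j1 : IntervalIntegrable (fun r => (Real.cos (ν * r) : ℂ) * A r +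
        sn ν r * (Real.cos (ν * r) * g r)) volume 0 x :=
      (hcts x hx (ContinuousOn.mul (by fun_prop) (hAc x hx))).add
        ((hcg x hx).continuousOn_mul (by fun_prop))
    have j2 : IntervalIntegrable (fun r => -(ν ^ 2 * sn ν r : ℂ) * B r +
        Real.cos (ν * r) * (sn ν r * g r)) volume 0 x :=
      (hcts x hx (ContinuousOn.mul (by fun_prop) (hBc x hx))).add
        ((hsg x hx).continuousOn_mul (by fun_prop))
    rw [hz' x hx, p1, p2, cos_eq_integral, sn_eq_integral]
    simp only [zero_add, mul_zero]
    rw [← intervalIntegral.integral_sub j1 j2, ← intervalIntegral.integral_const_mul, add_assoc,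
      add_assoc, ← intervalIntegral.integral_add ((ic x).const_mul h) (j1.sub j2),
      ← intervalIntegral.integral_add (is x) (((ic x).const_mul h).add (j1.sub j2))]
    congr 1
    refine intervalIntegral.integral_congr fun r _ => ?_
    simp only [hz₁]
    ring
  have step2 : ∀ x ∈ Icc 0 X, z₁ x = h + ∫ s in (0 : ℝ)..x, (g s - ν ^ 2 * z s) := by
    intro x hx
    have p1 := primitive_mul_primitive hx.1 1 0 (is x) (hcg x hx)
    have p2 := primitive_mul_primitive hx.1 0 0 (ic x) (hsg x hx)
    simp only [← sn_eq_integral, ← cos_eq_integral] at p1 p2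
    change (Real.cos (ν * x) : ℂ) * A x = 1 * 0 + ∫ r in (0 : ℝ)..x,
      (-(ν ^ 2 * sn ν r : ℂ) * A r + Real.cos (ν * r) * (Real.cos (ν * r) * g r)) at p1
    change (sn ν x : ℂ) * B x = 0 * 0 + ∫ r in (0 : ℝ)..x, ((Real.cos (ν * r) : ℂ) * B r +
      sn ν r * (sn ν r * g r)) at p2
    have j1 : IntervalIntegrable (fun r => -(ν ^ 2 * sn ν r : ℂ) * A r +
        Real.cos (ν * r) * (Real.cos (ν * r) * g r)) volume 0 x :=
      (hcts x hx (ContinuousOn.mul (by fun_prop) (hAc x hx))).add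
        ((hcg x hx).continuousOn_mul (by fun_prop))
    have j2 : IntervalIntegrable (fun r => (Real.cos (ν * r) : ℂ) * B r +
        sn ν r * (sn ν r * g r)) volume 0 x :=
      (hcts x hx (ContinuousOn.mul (by fun_prop) (hBc x hx))).add
        ((hsg x hx).continuousOn_mul (by fun_prop))
    simp only [hz₁]
    rw [p1, p2, cos_eq_integral, sn_eq_integral]
    simp only [zero_add, mul_zero]
    have e : ∫ s in (0 : ℝ)..x, (g s - ν ^ 2 * z s) = ∫ s in (0 : ℝ)..x,
        (-(ν ^ 2 : ℂ) * Real.cos (ν * s) + (h * -(ν ^ 2 * sn ν s) +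
        ((-(ν ^ 2 * sn ν s : ℂ) * A s + Real.cos (ν * s) * (Real.cos (ν * s) * g s)) +
        ν ^ 2 * ((Real.cos (ν * s) : ℂ) * B s + sn ν s * (sn ν s * g s))))) := by
      refine intervalIntegral.integral_congr fun s hs => ?_
      rw [uIcc_of_le hx.1] at hs
      simp only [hz' s ⟨hs.1, hs.2.trans hx.2⟩]
      have hp : (Real.cos (ν * s) : ℂ) ^ 2 + ν ^ 2 * (sn ν s : ℂ) ^ 2 = 1 := by
        exact_mod_cast cos_sq_add_sn_sq ν s
      linear_combination -(g s) * hp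
    rw [e, intervalIntegral.integral_add ((ic x).const_mul _)
        (((is x).const_mul h).add (j1.add (j2.const_mul _))),
      intervalIntegral.integral_add ((is x).const_mul h) (j1.add (j2.const_mul _)),
      intervalIntegral.integral_add j1 (j2.const_mul _)]
    simp only [intervalIntegral.integral_const_mul]
    ring
  intro x hx
  rw [step1 x hx]
  congr 1
  refine intervalIntegral.integral_congr fun r hr => ?_
  rw [uIcc_of_le hx.1] at hr
  exact step2 r ⟨hr.1, hr.2.trans hx.2⟩

/-- The kernel of the transformation operator: the solution of the Goursat problem in the variables
`x = ξ + η`, `t = ξ - η`. -/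
noncomputable def goursatKernel (w : ℝ × ℝ → ℂ) (x t : ℝ) : ℂ := w ((x + t) / 2, (x - t) / 2)

theorem continuous_goursatKernel {w : ℝ × ℝ → ℂ} (hw : Continuous w) :
    Continuous (Function.uncurry (goursatKernel w)) := by
  unfold goursatKernel Function.uncurry
  fun_prop

/-- In the characteristic variables the integral over `(0, x)` becomes one over a full segment,
because `w` is symmetric. -/
theorem integral_goursatKernel_mul_cos {w : ℝ × ℝ → ℂ} (hw : Continuous w)
    {X : ℝ} (hs : ∀ ξ ∈ Icc 0 X, ∀ η ∈ Icc 0 X, w (ξ, η) = w (η, ξ)) (ν : ℝ) {x : ℝ}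
    (hx : x ∈ Icc 0 X) :
    ∫ t in (0 : ℝ)..x, goursatKernel w x t * (Real.cos (ν * t) : ℂ) =
      ∫ ξ in (0 : ℝ)..x, w (ξ, x - ξ) * (Real.cos (ν * (2 * ξ - x)) : ℂ) := by
  set F : ℝ → ℂ := fun ξ => w (ξ, x - ξ) * (Real.cos (ν * (2 * ξ - x)) : ℂ) with hF
  have hFc : Continuous F := by fun_prop
  have h1 : ∫ t in (0 : ℝ)..x, goursatKernel w x t * (Real.cos (ν * t) : ℂ) =
      2 * ∫ ξ in (x / 2)..x, F ξ := by
    have e : ∀ t, goursatKernel w x t * (Real.cos (ν * t) : ℂ) = F (t / 2 + x / 2) := fun t => by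
      simp only [hF, goursatKernel]
      congr 3 <;> ring_nf
    simp only [e]
    rw [intervalIntegral.integral_comp_div_add (fun ξ => F ξ) two_ne_zero, zero_div, zero_add,
      add_halves, Complex.real_smul]
    norm_cast
  have h2 : ∫ ξ in (0 : ℝ)..(x / 2), F ξ = ∫ ξ in (x / 2)..x, F ξ := by
    have e : ∫ ξ in (x / 2)..x, F ξ = ∫ ξ in (x / 2)..x, F (x - ξ) := by
      refine intervalIntegral.integral_congr fun ξ hξ => ?_
      rw [uIcc_of_le (by linarith [hx.1])] at hξ
      have m1 : ξ ∈ Icc 0 X := ⟨by linarith [hξ.1, hx.1], hξ.2.trans hx.2⟩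
      have m2 : x - ξ ∈ Icc 0 X := ⟨by linarith [hξ.2], by linarith [hξ.1, hx.1, hx.2]⟩
      simp only [hF, sub_sub_cancel]
      rw [hs _ m1 _ m2, ← Real.cos_neg (ν * (2 * (x - ξ) - x))]
      congr 3; ring
    rw [e, intervalIntegral.integral_comp_sub_left]
    congr 1 <;> ring
  rw [h1, ← intervalIntegral.integral_add_adjacent_intervals (a := 0) (b := x / 2) (c := x)
    (hFc.intervalIntegrable _ _) (hFc.intervalIntegrable _ _), h2]
  ring

theorem integral_mul_cos_shift {q : ℝ → ℂ} (hqi : Integrable q) (h : ℂ) (ν : ℝ) {x : ℝ}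
    (hx : 0 ≤ x) :
    ∫ ξ in (0 : ℝ)..x, (h + ∫ s in (0 : ℝ)..ξ, q s) * (Real.cos (ν * (2 * ξ - x)) : ℂ) =
      h * sn ν x + ∫ y in (0 : ℝ)..x, sn ν (x - y) * (q y * Real.cos (ν * y)) := by
  have hc : Continuous fun ξ : ℝ => (Real.cos (ν * (2 * ξ - x)) : ℂ) := by fun_prop
  have hprim := continuousOn_primitive hx (hqi.intervalIntegrable) 0
  simp only [zero_add] at hprim
  have i2 : IntervalIntegrable (fun ξ => (∫ s in (0 : ℝ)..ξ, q s) *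
      (Real.cos (ν * (2 * ξ - x)) : ℂ)) volume 0 x :=
    ContinuousOn.intervalIntegrable (by
      rw [uIcc_of_le hx]; exact hprim.mul hc.continuousOn)
  simp only [add_mul]
  rw [intervalIntegral.integral_add ((hc.intervalIntegrable _ _).const_mul h) i2,
    intervalIntegral.integral_const_mul, integral_cos_two_mul_sub]
  congr 1
  · rw [sub_zero, zero_add, sub_self, mul_zero, Real.cos_zero, Complex.ofReal_one, mul_one]
  · have := integral_triangle_swap hx (F := fun ξ s => (Real.cos (ν * (2 * ξ - x)) : ℂ) * q s)
      (integrable_mul_prod ((intervalIntegrable_iff_vol hx).1 (hc.intervalIntegrable _ _))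
        hqi.restrict)
    simp only [intervalIntegral.integral_const_mul, intervalIntegral.integral_mul_const,
      integral_cos_two_mul_sub] at this
    simp only [mul_comm (∫ s in (0 : ℝ)..(_ : ℝ), q s)]
    rw [this]
    refine intervalIntegral.integral_congr fun y _ => ?_
    simp only [add_sub_cancel_right]
    ring

/-- Fubini's theorem for the integral term of the Goursat problem: integrating the cosine over
`ξ ∈ (a, x - b)` gives `sin (ν (x - a - b)) / ν · cos ν (a - b)`, which depends on `y = a + b`. -/
theorem integral_goursat_integral_mul_cos {q : ℝ → ℂ} (hq : Measurable q) (hqi : Integrable q)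
    {w : ℝ × ℝ → ℂ} (hw : Continuous w) (ν : ℝ) {x : ℝ} (hx : 0 ≤ x) :
    ∫ ξ in (0 : ℝ)..x, (∫ a in (0 : ℝ)..ξ, ∫ b in (0 : ℝ)..(x - ξ), q (a + b) * w (a, b)) *
        (Real.cos (ν * (2 * ξ - x)) : ℂ) =
      ∫ y in (0 : ℝ)..x, sn ν (x - y) * (q y *
        ∫ a in (0 : ℝ)..y, w (a, y - a) * (Real.cos (ν * (2 * a - y)) : ℂ)) := by
  have hsc := continuous_sn ν
  obtain ⟨M, hM0, hM⟩ := exists_bound_square hw x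
  -- the first exchange: `ξ` and `a`
  have hF1 : Integrable (Function.uncurry fun ξ a =>
      (∫ b in (0 : ℝ)..(x - ξ), q (a + b) * w (a, b)) * (Real.cos (ν * (2 * ξ - x)) : ℂ))
      ((vol 0 x).prod (vol 0 x)) := by
    have hmeas : StronglyMeasurable fun p : ℝ × ℝ =>
        ∫ b, indicator {r : (ℝ × ℝ) × ℝ | 0 < r.2 ∧ r.2 < x - r.1.1}
          (fun r : (ℝ × ℝ) × ℝ => q (r.1.2 + r.2) * w (r.1.2, r.2)) (p, b) := by
      refine StronglyMeasurable.integral_prod_right' (ν := volume)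
        (f := indicator {r : (ℝ × ℝ) × ℝ | 0 < r.2 ∧ r.2 < x - r.1.1}
          (fun r : (ℝ × ℝ) × ℝ => q (r.1.2 + r.2) * w (r.1.2, r.2))) ?_
      refine Measurable.stronglyMeasurable (Measurable.indicator ?_ ?_)
      · exact (hq.comp (by fun_prop)).mul (hw.measurable.comp (by fun_prop))
      · exact (measurableSet_lt measurable_const measurable_snd).inter (measurableSet_lt
          measurable_snd (measurable_const.sub (measurable_fst.comp measurable_fst)))
    have hae : (fun p : ℝ × ℝ => ∫ b, indicator {r : (ℝ × ℝ) × ℝ | 0 < r.2 ∧ r.2 < x - r.1.1}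
          (fun r : (ℝ × ℝ) × ℝ => q (r.1.2 + r.2) * w (r.1.2, r.2)) (p, b))
        =ᵐ[(vol 0 x).prod (vol 0 x)] fun p =>
          ∫ b in (0 : ℝ)..(x - p.1), q (p.2 + b) * w (p.2, b) := by
      rw [Measure.prod_restrict]
      filter_upwards [ae_restrict_mem (measurableSet_Ioo.prod measurableSet_Ioo)] with p hp
      rw [intervalIntegral_eq_integral_vol (by linarith [hp.1.2]), vol,
        ← integral_indicator measurableSet_Ioo]
      rfl
    refine Integrable.of_bound (C := M * ∫ y, ‖q y‖) ((hmeas.aestronglyMeasurable.congr hae).mul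
      (Continuous.aestronglyMeasurable (by fun_prop))) ?_
    rw [Measure.prod_restrict]
    filter_upwards [ae_restrict_mem (measurableSet_Ioo.prod measurableSet_Ioo)] with p hp
    have hle : 0 ≤ x - p.1 := by linarith [hp.1.2]
    simp only [Function.uncurry]
    rw [norm_mul, Complex.norm_real]
    refine (mul_le_of_le_one_right (norm_nonneg _) (Real.abs_cos_le_one _)).trans ?_
    refine (norm_integral_shift_mul_le hqi (u := fun b => w (p.2, b)) hle fun b hb =>
      hM p.2 ⟨hp.2.1.le, hp.2.2.le⟩ b ⟨hb.1, hb.2.trans (by linarith [hp.1.1])⟩).trans ?_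
    exact mul_le_mul_of_nonneg_left (integral_norm_shift_le hqi _ hle) hM0
  have s1 := integral_triangle_swap hx hF1
  simp only [intervalIntegral.integral_mul_const] at s1
  rw [s1]
  -- the second exchange: `ξ` and `b`
  have s2 : ∀ a ∈ uIcc 0 x, ∫ ξ in a..x, (∫ b in (0 : ℝ)..(x - ξ), q (a + b) * w (a, b)) *
      (Real.cos (ν * (2 * ξ - x)) : ℂ) =
      ∫ y in a..x, sn ν (x - y) * (q y * (w (a, y - a) * (Real.cos (ν * (2 * a - y)) : ℂ))) := by
    intro a ha
    rw [uIcc_of_le hx] at ha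
    have hxa : 0 ≤ x - a := by linarith [ha.2]
    have r1 := intervalIntegral.integral_comp_sub_left (a := 0) (b := x - a)
      (fun ξ => (∫ b in (0 : ℝ)..(x - ξ), q (a + b) * w (a, b)) *
        (Real.cos (ν * (2 * ξ - x)) : ℂ)) x
    rw [sub_zero, sub_sub_cancel] at r1
    rw [← r1]
    simp only [sub_sub_cancel]
    have ci : IntervalIntegrable (fun r : ℝ => (Real.cos (ν * (2 * (x - r) - x)) : ℂ)) volume 0
      (x - a) := Continuous.intervalIntegrable (by fun_prop) _ _
    have s3 := integral_triangle_swap hxa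
      (F := fun r b => (Real.cos (ν * (2 * (x - r) - x)) : ℂ) * (q (a + b) * w (a, b)))
      (integrable_mul_prod ((intervalIntegrable_iff_vol hxa).1 ci)
        ((intervalIntegrable_iff_vol hxa).1 (intervalIntegrable_shift_mul hqi
          (u := fun b => w (a, b)) (by fun_prop) a 0 (x - a))))
    simp only [intervalIntegral.integral_const_mul, intervalIntegral.integral_mul_const] at s3
    simp only [mul_comm _ (Real.cos _ : ℂ)]
    rw [s3]
    have r2 := intervalIntegral.integral_comp_sub_right (a := a) (b := x)
      (fun b => (∫ r in b..(x - a), (Real.cos (ν * (2 * (x - r) - x)) : ℂ)) *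
        (q (a + b) * w (a, b))) a
    rw [sub_self] at r2
    rw [← r2]
    refine intervalIntegral.integral_congr fun y _ => ?_
    simp only [add_sub_cancel]
    have r3 : ∫ r in (y - a)..(x - a), (Real.cos (ν * (2 * (x - r) - x)) : ℂ) =
        sn ν (x - y) * Real.cos (ν * (2 * a - y)) := by
      rw [intervalIntegral.integral_comp_sub_left (fun r => (Real.cos (ν * (2 * r - x)) : ℂ)),
        integral_cos_two_mul_sub]
      congr 3 <;> ring_nf
    rw [r3]
    ring
  rw [intervalIntegral.integral_congr s2]
  -- the third exchange: `a` and `y = a + b`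
  have hF3 : Integrable (Function.uncurry fun y a => sn ν (x - y) *
      (q y * (w (a, y - a) * (Real.cos (ν * (2 * a - y)) : ℂ)))) ((vol 0 x).prod (vol 0 x)) := by
    have hu : Continuous fun p : ℝ × ℝ => (sn ν (x - p.1) : ℂ) *
        (w (p.2, p.1 - p.2) * (Real.cos (ν * (2 * p.2 - p.1)) : ℂ)) := by fun_prop
    obtain ⟨C, -, hC⟩ := exists_bound_square hu x
    have h1 : Integrable (fun p : ℝ × ℝ => q p.1) ((vol 0 x).prod (vol 0 x)) :=
      hqi.restrict.comp_fst _
    have h2 := h1.mul_bdd (c := C) (g := fun p : ℝ × ℝ => (sn ν (x - p.1) : ℂ) *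
        (w (p.2, p.1 - p.2) * (Real.cos (ν * (2 * p.2 - p.1)) : ℂ))) hu.aestronglyMeasurable (by
      rw [Measure.prod_restrict]
      filter_upwards [ae_restrict_mem (measurableSet_Ioo.prod measurableSet_Ioo)] with p hp
      exact hC p.1 (Ioo_subset_Icc_self hp.1) p.2 (Ioo_subset_Icc_self hp.2))
    refine h2.congr (ae_of_all _ fun p => ?_)
    simp only [Function.uncurry]
    ring
  rw [← integral_triangle_swap hx hF3]
  simp only [intervalIntegral.integral_const_mul]

/-- The solution `w` of the Goursat problem gives the kernel of a transformation operator: the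
cosine transform of the equation for `w` is the variation of constants formula. -/
theorem Goursat.intertwines {h : ℂ} {q : ℝ → ℂ} (hq : Measurable q) (hqi : Integrable q) {X : ℝ}
    {w : ℝ × ℝ → ℂ} (hw : Continuous w)
    (hG : Goursat (fun x => h + ∫ s in (0 : ℝ)..x, q s) q X w) :
    Intertwines h q (goursatKernel w) X := by
  intro ν
  have hkc := continuous_goursatKernel hw
  have hzc := continuous_cosTransform hkc ν
  set S : ℝ → ℂ := fun x => h + ∫ s in (0 : ℝ)..x, q s with hS
  have hSc : Continuous S :=
    continuous_const.add
      (intervalIntegral.continuous_primitive (fun a b => hqi.intervalIntegrable) 0)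
  have hsc := continuous_sn ν
  have hzI : ∀ x ∈ Icc 0 X, cosTransform (goursatKernel w) ν x = Real.cos (ν * x) +
      ∫ ξ in (0 : ℝ)..x, w (ξ, x - ξ) * (Real.cos (ν * (2 * ξ - x)) : ℂ) := fun x hx => by
    rw [cosTransform, integral_goursatKernel_mul_cos hw
      (fun ξ hξ η hη => hG.symm hq hqi hw hξ hη) ν hx]
  have hvar : ∀ x ∈ Icc 0 X, cosTransform (goursatKernel w) ν x =
      Real.cos (ν * x) + h * sn ν x +
        ∫ y in (0 : ℝ)..x, sn ν (x - y) * (q y * cosTransform (goursatKernel w) ν y) := by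
    intro x hx
    rw [hzI x hx, add_assoc]
    congr 1
    set c : ℝ → ℂ := fun ξ => (Real.cos (ν * (2 * ξ - x)) : ℂ) with hc
    have hcc : Continuous c := by fun_prop
    have hRc : ContinuousOn (fun ξ => ∫ a in (0 : ℝ)..ξ, ∫ b in (0 : ℝ)..(x - ξ),
        q (a + b) * w (a, b)) (Icc 0 x) := by
      have : ContinuousOn (fun ξ => w (ξ, x - ξ) - ((1 / 2) * S ξ + (1 / 2) * S (x - ξ)))
          (Icc 0 x) := by fun_prop
      refine this.congr fun ξ hξ => ?_
      simp only
      rw [hG ξ ⟨hξ.1, hξ.2.trans hx.2⟩ (x - ξ) ⟨by linarith [hξ.2], by linarith [hξ.1, hx.2]⟩]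
      ring
    have e1 : ∫ ξ in (0 : ℝ)..x, w (ξ, x - ξ) * c ξ = ∫ ξ in (0 : ℝ)..x, ((1 / 2) * (S ξ * c ξ) +
        (1 / 2) * (S (x - ξ) * c ξ) + (∫ a in (0 : ℝ)..ξ, ∫ b in (0 : ℝ)..(x - ξ),
          q (a + b) * w (a, b)) * c ξ) := by
      refine intervalIntegral.integral_congr fun ξ hξ => ?_
      rw [uIcc_of_le hx.1] at hξ
      rw [hG ξ ⟨hξ.1, hξ.2.trans hx.2⟩ (x - ξ) ⟨by linarith [hξ.2], by linarith [hξ.1, hx.2]⟩]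
      ring
    have e2 : ∫ ξ in (0 : ℝ)..x, S (x - ξ) * c ξ = ∫ ξ in (0 : ℝ)..x, S ξ * c ξ := by
      have := intervalIntegral.integral_comp_sub_left (a := 0) (b := x) (fun ξ => S ξ * c ξ) x
      rw [sub_self, sub_zero] at this
      rw [← this]
      refine intervalIntegral.integral_congr fun ξ _ => ?_
      simp only [hc]
      rw [← Real.cos_neg (ν * (2 * (x - ξ) - x))]
      congr 3; ring
    have iR : IntervalIntegrable (fun ξ => (∫ a in (0 : ℝ)..ξ, ∫ b in (0 : ℝ)..(x - ξ),
          q (a + b) * w (a, b)) * c ξ) volume 0 x :=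
      ContinuousOn.intervalIntegrable (by rw [uIcc_of_le hx.1]; exact hRc.mul hcc.continuousOn)
    have iS : IntervalIntegrable (fun ξ => (1 / 2 : ℂ) * (S ξ * c ξ)) volume 0 x :=
      Continuous.intervalIntegrable (by fun_prop) _ _
    have iS' : IntervalIntegrable (fun ξ => (1 / 2 : ℂ) * (S (x - ξ) * c ξ)) volume 0 x :=
      Continuous.intervalIntegrable (by fun_prop) _ _
    have hI : ContinuousOn (fun y => ∫ ξ in (0 : ℝ)..y, w (ξ, y - ξ) *
        (Real.cos (ν * (2 * ξ - y)) : ℂ)) (Icc 0 X) := by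
      have : ContinuousOn (fun y => cosTransform (goursatKernel w) ν y - Real.cos (ν * y))
          (Icc 0 X) := by fun_prop
      refine this.congr fun y hy => ?_
      simp only
      rw [hzI y hy]; ring
    have iq : IntervalIntegrable q volume 0 x := hqi.intervalIntegrable
    rw [e1, intervalIntegral.integral_add (iS.add iS') iR, intervalIntegral.integral_add iS iS',
      intervalIntegral.integral_const_mul, intervalIntegral.integral_const_mul, e2,
      integral_mul_cos_shift hqi h ν hx.1, integral_goursat_integral_mul_cos hq hqi hw ν hx.1,
      ← add_mul, add_halves, one_mul, add_assoc]
    congr 1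
    rw [← intervalIntegral.integral_add]
    · refine intervalIntegral.integral_congr fun y hy => ?_
      rw [uIcc_of_le hx.1] at hy
      rw [hzI y ⟨hy.1, hy.2.trans hx.2⟩]
      ring
    · exact (iq.mul_continuousOn (by fun_prop)).continuousOn_mul (by fun_prop)
    · refine (iq.mul_continuousOn ?_).continuousOn_mul (by fun_prop)
      rw [uIcc_of_le hx.1]
      exact hI.mono (Icc_subset_Icc_right hx.2)
  intro x hx
  rw [cauchy_of_variation (g := fun y => q y * cosTransform (goursatKernel w) ν y)
    (hqi.intervalIntegrable.mul_continuousOn hzc.continuousOn) hvar x hx]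
  simp only [sub_mul]

theorem Goursat.diagonal {h : ℂ} {q : ℝ → ℂ} {X : ℝ} {w : ℝ × ℝ → ℂ}
    (hG : Goursat (fun x => h + ∫ s in (0 : ℝ)..x, q s) q X w) {x : ℝ} (hx : x ∈ Icc 0 X) :
    goursatKernel w x x = (1 / 2) * ((h + ∫ s in (0 : ℝ)..x, q s) + h) := by
  have := hG x hx 0 (left_mem_Icc.2 (hx.1.trans hx.2))
  rw [goursatKernel, add_self_div_two, sub_self, zero_div, this]
  simp only [intervalIntegral.integral_same, intervalIntegral.integral_zero, add_zero]
  ring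


/-! ### The Gelfand–Levitan equation for the transformation operator -/

theorem SquareIdentity.add {q : ℝ → ℂ} (hq : Measurable q) (hqi : Integrable q) {U V : ℝ × ℝ → ℂ}
    (hUc : Continuous U) (hVc : Continuous V) (hU : SquareIdentity q U) (hV : SquareIdentity q V) :
    SquareIdentity q fun p => U p + V p := by
  intro ξ hξ η hη hle
  have e : ∀ a, ∫ b in η..ξ, q (a + b) * (U (a, b) + V (a, b)) =
      (∫ b in η..ξ, q (a + b) * U (a, b)) + ∫ b in η..ξ, q (a + b) * V (a, b) := fun a => by
    rw [← intervalIntegral.integral_add (intervalIntegrable_shift_mul hqi (by fun_prop) _ _ _)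
      (intervalIntegrable_shift_mul hqi (by fun_prop) _ _ _)]
    simp only [mul_add]
  simp only [e]
  rw [intervalIntegral.integral_add (intervalIntegrable_integral_shift_mul hq hqi hUc _ _ _ _)
    (intervalIntegrable_integral_shift_mul hq hqi hVc _ _ _ _), ← hU ξ hξ η hη hle,
    ← hV ξ hξ η hη hle]
  ring

theorem SquareIdentity.const_mul {q : ℝ → ℂ} {U : ℝ × ℝ → ℂ} (hU : SquareIdentity q U) (c : ℂ) :
    SquareIdentity q fun p => c * U p := by
  intro ξ hξ η hη hle
  have e : ∀ a b, q (a + b) * (c * U (a, b)) = c * (q (a + b) * U (a, b)) := fun a b => by ring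
  simp only [e, intervalIntegral.integral_const_mul]
  rw [← hU ξ hξ η hη hle]
  ring

theorem SquareIdentity.sum {q : ℝ → ℂ} (hq : Measurable q) (hqi : Integrable q) {ι : Type*}
    {U : ι → ℝ × ℝ → ℂ} (hUc : ∀ i, Continuous (U i)) (hU : ∀ i, SquareIdentity q (U i))
    (s : Finset ι) : SquareIdentity q fun p => ∑ i ∈ s, U i p := by
  classical
  induction s using Finset.induction_on with
  | empty => intro ξ _ η _ _; simp
  | insert i s hi ih =>
    simp only [Finset.sum_insert hi]
    exact (hU i).add hq hqi (hUc i) (continuous_finsetSum _ fun j _ => hUc j) ih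

/-- The square identity is preserved by uniform limits. -/
theorem SquareIdentity.of_approx {q : ℝ → ℂ} (hq : Measurable q) (hqi : Integrable q)
    {W : ℝ × ℝ → ℂ} (hW : Continuous W)
    (h : ∀ ε > 0, ∃ V, Continuous V ∧ SquareIdentity q V ∧
      ∀ a ∈ Icc (0 : ℝ) 1, ∀ b ∈ Icc (0 : ℝ) 1, ‖W (a, b) - V (a, b)‖ ≤ ε) :
    SquareIdentity q W := by
  intro ξ hξ η hη hle
  set Q := ∫ y, ‖q y‖ with hQ
  have hQ0 : 0 ≤ Q := integral_nonneg fun _ => norm_nonneg _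
  have key : ∀ ε > 0, ‖(W (ξ, ξ) + W (η, η) - W (ξ, η) - W (η, ξ)) -
      ∫ a in η..ξ, ∫ b in η..ξ, q (a + b) * W (a, b)‖ ≤ ε * (4 + Q) := by
    intro ε hε
    obtain ⟨V, hVc, hV, hWV⟩ := h ε hε
    have e : ∀ a, (∫ b in η..ξ, q (a + b) * W (a, b)) - (∫ b in η..ξ, q (a + b) * V (a, b)) =
        ∫ b in η..ξ, q (a + b) * (W - V) (a, b) := fun a => by
      rw [← intervalIntegral.integral_sub (intervalIntegrable_shift_mul hqi (by fun_prop) _ _ _)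
        (intervalIntegrable_shift_mul hqi (by fun_prop) _ _ _)]
      simp only [Pi.sub_apply, mul_sub]
    have h1 : (∫ a in η..ξ, ∫ b in η..ξ, q (a + b) * W (a, b)) -
        (∫ a in η..ξ, ∫ b in η..ξ, q (a + b) * V (a, b)) =
        ∫ a in η..ξ, ∫ b in η..ξ, q (a + b) * (W - V) (a, b) := by
      rw [← intervalIntegral.integral_sub
        (intervalIntegrable_integral_shift_mul hq hqi hW _ _ _ _)
        (intervalIntegrable_integral_shift_mul hq hqi hVc _ _ _ _)]
      simp only [e]
    have h2 := norm_integral_integral_shift_mul_le hqi (u := W - V) (ρ := fun _ => ε)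
      continuous_const hle hle fun a ha b hb =>
        hWV a ⟨hη.1.trans ha.1, ha.2.trans hξ.2⟩ b ⟨hη.1.trans hb.1, hb.2.trans hξ.2⟩
    rw [intervalIntegral.integral_const, smul_eq_mul, ← h1, ← hQ] at h2
    have h3 : (ξ - η) * ε * Q ≤ ε * Q := by
      have : (ξ - η) * ε ≤ ε := mul_le_of_le_one_left hε.le (by linarith [hξ.2, hη.1])
      gcongr
    have h4 := hV ξ hξ η hη hle
    rw [← h4] at h2
    have n1 := hWV ξ hξ ξ hξ
    have n2 := hWV η hη η hη
    have n3 := hWV ξ hξ η hη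
    have n4 := hWV η hη ξ hξ
    set I := ∫ a in η..ξ, ∫ b in η..ξ, q (a + b) * W (a, b) with hI
    have e5 : W (ξ, ξ) + W (η, η) - W (ξ, η) - W (η, ξ) - I =
        (W (ξ, ξ) - V (ξ, ξ)) + (W (η, η) - V (η, η)) - (W (ξ, η) - V (ξ, η)) -
          (W (η, ξ) - V (η, ξ)) - (I - (V (ξ, ξ) + V (η, η) - V (ξ, η) - V (η, ξ))) := by ring
    rw [e5]
    refine (norm_sub_le _ _).trans ?_
    have m1 := norm_sub_le ((W (ξ, ξ) - V (ξ, ξ)) + (W (η, η) - V (η, η)) - (W (ξ, η) - V (ξ, η)))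
      (W (η, ξ) - V (η, ξ))
    have m2 := norm_sub_le ((W (ξ, ξ) - V (ξ, ξ)) + (W (η, η) - V (η, η))) (W (ξ, η) - V (ξ, η))
    have m3 := norm_add_le (W (ξ, ξ) - V (ξ, ξ)) (W (η, η) - V (η, η))
    nlinarith
  rw [← sub_eq_zero, ← norm_le_zero_iff]
  refine le_of_forall_pos_le_add fun ε hε => ?_
  have := key (ε / (4 + Q)) (by positivity)
  rwa [div_mul_cancel₀ _ (by positivity), ← zero_add ε] at this

theorem eq_add_integral_of_primitive {X : ℝ} {F f : ℝ → ℂ} {c : ℂ}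
    (hf : ∀ x ∈ Icc 0 X, IntervalIntegrable f volume 0 x)
    (hF : ∀ x ∈ Icc 0 X, F x = c + ∫ s in (0 : ℝ)..x, f s) (a : ℝ) {b b' : ℝ}
    (hb : a + b ∈ Icc 0 X) (hb' : a + b' ∈ Icc 0 X) :
    F (a + b') = F (a + b) + ∫ s in b..b', f (a + s) := by
  rw [hF _ hb, hF _ hb', intervalIntegral.integral_comp_add_left (fun s => f s),
    ← intervalIntegral.integral_interval_sub_left (hf _ hb') (hf _ hb)]
  ring

/-- The function `z(a + b) cos ν (a - b)` has the mixed derivative `q(a + b) z(a + b) cos ν (a - b)`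
if `z'' = (q - ν²) z`. -/
theorem squareIdentity_mul_cos {h : ℂ} {q : ℝ → ℂ} (hqi : Integrable q) {z : ℝ → ℂ}
    (hzc : Continuous z) {ν : ℝ}
    (hz : ∀ x ∈ Icc (0 : ℝ) 2,
      z x = 1 + ∫ r in (0 : ℝ)..x, (h + ∫ s in (0 : ℝ)..r, (q s - ν ^ 2) * z s)) :
    SquareIdentity q fun p => z (p.1 + p.2) * (Real.cos (ν * (p.1 - p.2)) : ℂ) := by
  intro ξ hξ η hη hle
  have hsc := continuous_sn ν
  set g : ℝ → ℂ := fun s => (q s - ν ^ 2) * z s with hg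
  have hgi : ∀ a b, IntervalIntegrable g volume a b := fun a b =>
    (hqi.intervalIntegrable.sub intervalIntegrable_const).mul_continuousOn hzc.continuousOn
  set z₁ : ℝ → ℂ := fun r => h + ∫ s in (0 : ℝ)..r, g s with hz₁
  have hz₁c : Continuous z₁ :=
    continuous_const.add (intervalIntegral.continuous_primitive (fun a b => hgi a b) 0)
  have dc : ∀ c b b' : ℝ, (Real.cos (ν * (c - b')) : ℂ) =
      Real.cos (ν * (c - b)) + ∫ s in b..b', (ν ^ 2 * sn ν (c - s) : ℂ) := by
    intro c b b'
    have : ∫ s in b..b', (ν ^ 2 * sn ν (c - s) : ℂ) =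
        (Real.cos (ν * (c - b')) : ℂ) - Real.cos (ν * (c - b)) :=
      intervalIntegral.integral_eq_sub_of_hasDerivAt (f := fun s => (Real.cos (ν * (c - s)) : ℂ))
        (fun s _ => by
          have :=
            ((hasDerivAt_cos_mul ν (c - s)).comp s ((hasDerivAt_id s).const_sub c)).ofReal_comp
          convert! this using 1
          push_cast; ring) (Continuous.intervalIntegrable (by fun_prop) _ _)
    rw [this]; ring
  have ds : ∀ c b b' : ℝ, (sn ν (c - b') : ℂ) =
      sn ν (c - b) + ∫ s in b..b', -(Real.cos (ν * (c - s)) : ℂ) := by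
    intro c b b'
    have : ∫ s in b..b', -(Real.cos (ν * (c - s)) : ℂ) = (sn ν (c - b') : ℂ) - sn ν (c - b) :=
      intervalIntegral.integral_eq_sub_of_hasDerivAt (f := fun s => (sn ν (c - s) : ℂ))
        (fun s _ => by
          have := ((hasDerivAt_sn ν (c - s)).comp s ((hasDerivAt_id s).const_sub c)).ofReal_comp
          convert! this using 1
          push_cast; ring) (Continuous.intervalIntegrable (by fun_prop) _ _)
    rw [this]; ring
  have mem : ∀ a ∈ Icc η ξ, ∀ b ∈ Icc η ξ, a + b ∈ Icc (0 : ℝ) 2 := fun a ha b hb =>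
    ⟨by linarith [ha.1, hb.1, hη.1], by linarith [ha.2, hb.2, hξ.2]⟩
  have hηm : η ∈ Icc η ξ := left_mem_Icc.2 hle
  have hξm : ξ ∈ Icc η ξ := right_mem_Icc.2 hle
  have dz : ∀ a ∈ Icc η ξ, ∀ b ∈ Icc η ξ, z (a + b) = z (a + η) + ∫ s in η..b, z₁ (a + s) :=
    fun a ha b hb => eq_add_integral_of_primitive (X := 2)
      (fun x _ => hz₁c.intervalIntegrable _ _) hz a (mem a ha η hηm) (mem a ha b hb)
  have dz₁ : ∀ a ∈ Icc η ξ, ∀ b ∈ Icc η ξ, z₁ (a + b) = z₁ (a + η) + ∫ s in η..b, g (a + s) :=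
    fun a ha b hb => eq_add_integral_of_primitive (X := 2) (fun x _ => hgi _ _)
      (fun x _ => rfl) a (mem a ha η hηm) (mem a ha b hb)
  have hgs : ∀ a c d, IntervalIntegrable (fun s => g (a + s)) volume c d := fun a c d =>
    ((intervalIntegrable_shift hqi a c d).sub intervalIntegrable_const).mul_continuousOn
      (by fun_prop)
  -- the derivative with respect to the first variable
  set V : ℝ → ℝ → ℂ := fun a b => z₁ (a + b) * Real.cos (ν * (a - b)) -
    ν ^ 2 * (z (a + b) * sn ν (a - b)) with hV
  have inner : ∀ a ∈ Icc η ξ,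
      ∫ b in η..ξ, q (a + b) * (z (a + b) * (Real.cos (ν * (a - b)) : ℂ)) = V a ξ - V a η := by
    intro a ha
    have p1 := primitive_mul_primitive hle (z₁ (a + η)) (Real.cos (ν * (a - η)) : ℂ)
      (hgs a η ξ) (g := fun s => (ν ^ 2 * sn ν (a - s) : ℂ))
      (Continuous.intervalIntegrable (by fun_prop) _ _)
    have p2 := primitive_mul_primitive hle (z (a + η)) (sn ν (a - η) : ℂ)
      (f := fun s => z₁ (a + s)) (g := fun s => -(Real.cos (ν * (a - s)) : ℂ))
      (Continuous.intervalIntegrable (by fun_prop) _ _)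
      (Continuous.intervalIntegrable (by fun_prop) _ _)
    rw [← dz₁ a ha ξ hξm, ← dc a η ξ] at p1
    rw [← dz a ha ξ hξm, ← ds a η ξ] at p2
    have e1 : ∫ x in η..ξ, (g (a + x) * ((Real.cos (ν * (a - η)) : ℂ) +
        ∫ s in η..x, (ν ^ 2 * sn ν (a - s) : ℂ)) + (z₁ (a + η) + ∫ s in η..x, g (a + s)) *
        (ν ^ 2 * sn ν (a - x))) = ∫ x in η..ξ, (g (a + x) * Real.cos (ν * (a - x)) +
          z₁ (a + x) * (ν ^ 2 * sn ν (a - x))) := by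
      refine intervalIntegral.integral_congr fun x hx => ?_
      rw [uIcc_of_le hle] at hx
      rw [← dz₁ a ha x hx, ← dc a η x]
    have e2 : ∫ x in η..ξ, (z₁ (a + x) * ((sn ν (a - η) : ℂ) +
        ∫ s in η..x, -(Real.cos (ν * (a - s)) : ℂ)) + (z (a + η) + ∫ s in η..x, z₁ (a + s)) *
        -(Real.cos (ν * (a - x)) : ℂ)) = ∫ x in η..ξ, (z₁ (a + x) * sn ν (a - x) +
          z (a + x) * -(Real.cos (ν * (a - x)) : ℂ)) := by
      refine intervalIntegral.integral_congr fun x hx => ?_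
      rw [uIcc_of_le hle] at hx
      rw [← dz a ha x hx, ← ds a η x]
    rw [e1] at p1
    rw [e2] at p2
    simp only [hV]
    rw [p1, p2, mul_add, add_sub_add_comm, add_sub_right_comm, sub_self, zero_add]
    have i1 : IntervalIntegrable (fun x => g (a + x) * Real.cos (ν * (a - x)) +
          z₁ (a + x) * (ν ^ 2 * sn ν (a - x))) volume η ξ :=
      ((hgs a η ξ).mul_continuousOn (by fun_prop)).add
        (Continuous.intervalIntegrable (by fun_prop) _ _)
    have i2 : IntervalIntegrable (fun x => z₁ (a + x) * sn ν (a - x) +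
          z (a + x) * -(Real.cos (ν * (a - x)) : ℂ)) volume η ξ :=
      Continuous.intervalIntegrable (by fun_prop) _ _
    rw [← intervalIntegral.integral_const_mul, ← intervalIntegral.integral_sub i1
      (i2.const_mul _)]
    refine intervalIntegral.integral_congr fun x _ => ?_
    simp only [hg]
    ring
  have outer : ∀ b ∈ Icc η ξ, ∫ a in η..ξ, V a b =
      z (ξ + b) * Real.cos (ν * (ξ - b)) - z (η + b) * Real.cos (ν * (η - b)) := by
    intro b hb
    have p1 := primitive_mul_primitive hle (z (b + η)) (Real.cos (ν * (b - η)) : ℂ)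
      (f := fun s => z₁ (b + s)) (g := fun s => (ν ^ 2 * sn ν (b - s) : ℂ))
      (Continuous.intervalIntegrable (by fun_prop) _ _)
      (Continuous.intervalIntegrable (by fun_prop) _ _)
    rw [← dz b hb ξ hξm, ← dc b η ξ] at p1
    have sym : ∀ x y : ℝ, (Real.cos (ν * (x - y)) : ℂ) = Real.cos (ν * (y - x)) := fun x y => by
      rw [← Real.cos_neg]; congr 2; ring
    rw [add_comm ξ, add_comm η, sym ξ, sym η, p1, add_sub_cancel_left]
    refine intervalIntegral.integral_congr fun x hx => ?_
    rw [uIcc_of_le hle] at hx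
    simp only [hV]
    rw [← dz b hb x hx, ← dc b η x, add_comm x, sym x]
    have : sn ν (x - b) = -sn ν (b - x) := by
      unfold sn
      split_ifs
      · ring
      · rw [← neg_sub b x, mul_neg, Real.sin_neg, neg_div]
    rw [this]
    push_cast
    ring
  have hVc : ∀ b, Continuous fun a => V a b := fun b => by fun_prop
  have e : ∫ a in η..ξ, ∫ b in η..ξ, q (a + b) * (z (a + b) * (Real.cos (ν * (a - b)) : ℂ)) =
      ∫ a in η..ξ, (V a ξ - V a η) :=
    intervalIntegral.integral_congr fun a ha => inner a (by rwa [uIcc_of_le hle] at ha)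
  simp only
  rw [e, intervalIntegral.integral_sub ((hVc ξ).intervalIntegrable _ _)
    ((hVc η).intervalIntegrable _ _), outer ξ hξm, outer η hηm]
  ring

/-- The left-hand side of the Gelfand–Levitan equation without its first term. -/
noncomputable def levitanSum (k : ℝ → ℝ → ℂ) (φ : ℝ → ℂ) (x t : ℝ) : ℂ :=
  kernF φ x t + ∫ s in (0 : ℝ)..x, k x s * kernF φ s t

theorem continuous_levitanSum {k : ℝ → ℝ → ℂ} {φ : ℝ → ℂ}
    (hk : Continuous (Function.uncurry k)) (hφ : Continuous φ) :
    Continuous (Function.uncurry (levitanSum k φ)) := by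
  have hf := continuous_kernF hφ
  refine hf.add ?_
  refine intervalIntegral.continuous_parametric_intervalIntegral_of_continuous
    (f := fun (p : ℝ × ℝ) s => k p.1 s * kernF φ s p.2) (s := fun p : ℝ × ℝ => p.1) ?_
    continuous_fst
  exact (hk.comp ((continuous_fst.comp continuous_fst).prodMk continuous_snd)).mul
    (hf.comp (continuous_snd.prodMk (continuous_snd.comp continuous_fst)))

theorem kernF_even {φ : ℝ → ℂ} (hφ : ∀ y, φ (-y) = φ y) (x t : ℝ) :
    kernF φ x t = φ (x + t) + φ (x - t) := by
  rw [kernF]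
  rcases abs_choice (x - t) with h | h <;> rw [h]
  rw [hφ]

theorem kernF_neg_right {φ : ℝ → ℂ} (hφ : ∀ y, φ (-y) = φ y) (x t : ℝ) :
    kernF φ x (-t) = kernF φ x t := by
  rw [kernF_even hφ, kernF_even hφ, sub_neg_eq_add, ← sub_eq_add_neg, add_comm]

/-- For even `φ` and arguments in the triangle `|t| ≤ x`, `s ≤ x` all values of `φ` are taken on
`[0, x + |t|]`. -/
theorem norm_kernF_sub_le {φ ψ : ℝ → ℂ} (hφ : ∀ y, φ (-y) = φ y) (hψ : ∀ y, ψ (-y) = ψ y) {ε : ℝ}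
    (h : ∀ y ∈ Icc (0 : ℝ) 2, ‖φ y - ψ y‖ ≤ ε) {s t : ℝ} (h1 : s + t ∈ Icc (-2 : ℝ) 2)
    (h2 : s - t ∈ Icc (-2 : ℝ) 2) : ‖kernF φ s t - kernF ψ s t‖ ≤ 2 * ε := by
  have h' : ∀ y ∈ Icc (-2 : ℝ) 2, ‖φ y - ψ y‖ ≤ ε := fun y hy => by
    rcases le_total 0 y with h0 | h0
    · exact h y ⟨h0, hy.2⟩
    · rw [← hφ y, ← hψ y]; exact h (-y) ⟨by linarith, by linarith [hy.1]⟩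
  rw [kernF_even hφ, kernF_even hψ, add_sub_add_comm]
  refine (norm_add_le _ _).trans ?_
  linarith [h' _ h1, h' _ h2]

theorem kernF_cosSum (s : Finset ℝ) (a : ℝ → ℂ) (x t : ℝ) :
    kernF (fun y => ∑ ν ∈ s, a ν * (Real.cos (ν * y) : ℂ)) x t =
      ∑ ν ∈ s, 2 * a ν * ((Real.cos (ν * x) : ℂ) * (Real.cos (ν * t) : ℂ)) := by
  rw [kernF_even (fun y => by simp only [mul_neg, Real.cos_neg])]
  rw [← Finset.sum_add_distrib]
  refine Finset.sum_congr rfl fun ν _ => ?_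
  rw [mul_add, mul_sub, Real.cos_add, Real.cos_sub]
  push_cast
  ring

/-- On cosines the Gelfand–Levitan sum is the product `(I + K) cos ν x · cos ν t`. -/
theorem levitanSum_cosSum {k : ℝ → ℝ → ℂ} (hk : Continuous (Function.uncurry k))
    (s : Finset ℝ) (a : ℝ → ℂ) (x t : ℝ) :
    levitanSum k (fun y => ∑ ν ∈ s, a ν * (Real.cos (ν * y) : ℂ)) x t =
      ∑ ν ∈ s, 2 * a ν * (cosTransform k ν x * (Real.cos (ν * t) : ℂ)) := by
  have hkx : Continuous (k x) := hk.comp (Continuous.prodMk_right x)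
  simp only [levitanSum, kernF_cosSum, Finset.mul_sum]
  rw [intervalIntegral.integral_finsetSum
    (fun ν _ => Continuous.intervalIntegrable (by fun_prop) _ _), ← Finset.sum_add_distrib]
  refine Finset.sum_congr rfl fun ν _ => ?_
  have e : ∀ r, k x r * (2 * a ν * ((Real.cos (ν * r) : ℂ) * (Real.cos (ν * t) : ℂ))) =
      (2 * a ν * (Real.cos (ν * t) : ℂ)) * (k x r * (Real.cos (ν * r) : ℂ)) := fun r => by ring
  simp only [e, intervalIntegral.integral_const_mul, cosTransform]
  ring

theorem norm_levitanSum_sub_le {k : ℝ → ℝ → ℂ} (hk : Continuous (Function.uncurry k))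
    {φ ψ : ℝ → ℂ} (hφ : Continuous φ) (hψ : Continuous ψ) (he : ∀ y, φ (-y) = φ y)
    (hψe : ∀ y, ψ (-y) = ψ y) {C ε : ℝ} (hC0 : 0 ≤ C)
    (hC : ∀ a ∈ Icc (0 : ℝ) 2, ∀ b ∈ Icc (0 : ℝ) 2, ‖k a b‖ ≤ C)
    (h : ∀ y ∈ Icc (0 : ℝ) 2, ‖φ y - ψ y‖ ≤ ε) {α β : ℝ} (hα : α ∈ Icc (0 : ℝ) 1)
    (hβ : β ∈ Icc (0 : ℝ) 1) :
    ‖levitanSum k φ (α + β) (α - β) - levitanSum k ψ (α + β) (α - β)‖ ≤ (2 + 4 * C) * ε := by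
  have hε : 0 ≤ ε := (norm_nonneg _).trans (h 0 (left_mem_Icc.2 zero_le_two))
  set x := α + β with hx
  set t := α - β with ht
  have hx0 : 0 ≤ x := add_nonneg hα.1 hβ.1
  have hx2 : x ≤ 2 := by linarith [hα.2, hβ.2]
  have hb : ∀ r ∈ Icc 0 x, ‖kernF φ r t - kernF ψ r t‖ ≤ 2 * ε := fun r hr =>
    norm_kernF_sub_le he hψe h
      ⟨by linarith [hr.1, hα.1, hβ.2], by linarith [hr.2, hα.2]⟩
      ⟨by linarith [hr.1, hα.2, hβ.1], by linarith [hr.2, hα.1, hβ.2]⟩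
  have hkx : Continuous (k x) := hk.comp (Continuous.prodMk_right x)
  have hfφ : Continuous fun r => kernF φ r t :=
    (continuous_kernF hφ).comp (Continuous.prodMk_left t)
  have hfψ : Continuous fun r => kernF ψ r t :=
    (continuous_kernF hψ).comp (Continuous.prodMk_left t)
  rw [levitanSum, levitanSum, add_sub_add_comm, ← intervalIntegral.integral_sub
    (Continuous.intervalIntegrable (by fun_prop) _ _)
    (Continuous.intervalIntegrable (by fun_prop) _ _)]
  have h1 : ‖∫ r in (0 : ℝ)..x, (k x r * kernF φ r t - k x r * kernF ψ r t)‖ ≤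
      C * (2 * ε) * |x - 0| := by
    refine intervalIntegral.norm_integral_le_of_norm_le_const fun r hr => ?_
    rw [uIoc_of_le hx0] at hr
    rw [← mul_sub, norm_mul]
    exact mul_le_mul (hC x ⟨hx0, hx2⟩ r ⟨hr.1.le, hr.2.trans hx2⟩) (hb r (Ioc_subset_Icc_self hr))
      (norm_nonneg _) hC0
  rw [sub_zero, abs_of_nonneg hx0] at h1
  have h2 : C * (2 * ε) * x ≤ C * (2 * ε) * 2 := by gcongr
  calc _ ≤ _ := norm_add_le _ _
    _ ≤ 2 * ε + C * (2 * ε) * 2 := add_le_add (hb x ⟨hx0, le_rfl⟩) (h1.trans h2)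
    _ = _ := by ring

/-- If `k` is the kernel of a transformation operator, then the Gelfand–Levitan sum has the mixed
derivative `q(a + b) W`: by linearity and approximation this reduces to cosines. -/
theorem Intertwines.squareIdentity_levitanSum {h : ℂ} {q : ℝ → ℂ} (hq : Measurable q)
    (hqi : Integrable q) {k : ℝ → ℝ → ℂ} (hk : Continuous (Function.uncurry k))
    (hI : Intertwines h q k 2) {φ : ℝ → ℂ} (hφ : Continuous φ) (he : ∀ y, φ (-y) = φ y) :
    SquareIdentity q fun p => levitanSum k φ (p.1 + p.2) (p.1 - p.2) := by
  have hc : ∀ {φ : ℝ → ℂ}, Continuous φ →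
      Continuous fun p : ℝ × ℝ => levitanSum k φ (p.1 + p.2) (p.1 - p.2) := fun {φ} hφ =>
    (continuous_levitanSum hk hφ).comp (by fun_prop :
      Continuous fun p : ℝ × ℝ => (p.1 + p.2, p.1 - p.2))
  obtain ⟨C, hC0, hC⟩ := exists_bound_square (u := Function.uncurry k) hk 2
  refine SquareIdentity.of_approx hq hqi (hc hφ) fun ε hε => ?_
  obtain ⟨s, a, hsa⟩ := exists_cos_approx hφ.continuousOn (ε := ε / (2 + 4 * C)) (by positivity)
  set ψ : ℝ → ℂ := fun y => ∑ ν ∈ s, a ν * (Real.cos (ν * y) : ℂ) with hψd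
  have hψ : Continuous ψ := by fun_prop
  have hψe : ∀ y, ψ (-y) = ψ y := fun y => by simp only [hψd, mul_neg, Real.cos_neg]
  refine ⟨_, hc hψ, ?_, fun α hα β hβ => ?_⟩
  · simp only [hψd, levitanSum_cosSum hk]
    refine SquareIdentity.sum hq hqi (fun ν => ?_) (fun ν => ?_) s
    · have := continuous_cosTransform hk ν
      fun_prop
    · exact (squareIdentity_mul_cos hqi (continuous_cosTransform hk ν) (hI ν)).const_mul _
  · refine (norm_levitanSum_sub_le hk hφ hψ he hψe hC0 hC hsa hα hβ).trans (le_of_eq ?_)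
    field_simp

/-- The Volterra equation which determines `φ`: the Gelfand–Levitan equation for `t = 0`. -/
theorem exists_levitan_phi {k : ℝ → ℝ → ℂ} (hk : Continuous (Function.uncurry k)) {X : ℝ}
    (hX : 0 ≤ X) :
    ∃ ψ : ℝ → ℂ, Continuous ψ ∧
      ∀ x ∈ Icc 0 X, ψ x = -k x 0 - ∫ t in (0 : ℝ)..x, k x t * ψ t := by
  obtain ⟨C, hC0, hC⟩ := exists_bound_square (u := Function.uncurry k) hk X
  set μ := 2 * C + 1 with hμd
  have hμ : 0 < μ := by linarith
  have hcl := continuous_clamp X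
  have hk' : ∀ {f g : ℝ × ℝ → ℝ}, Continuous f → Continuous g → Continuous fun p => k (f p) (g p) :=
    fun hf hg => hk.comp (hf.prodMk hg)
  obtain ⟨ψ, hψ, hfix⟩ := exists_fixedPoint_of_weight
    (ρ := fun x : ℝ => Real.exp (μ * clamp X x)) (by fun_prop) (fun _ => Real.exp_pos _)
    (fun u x => -k (clamp X x) 0 - ∫ t in (0 : ℝ)..clamp X x, k (clamp X x) t * u t)
    (fun u hu => by
      refine Continuous.sub (Continuous.neg (hk.comp (hcl.prodMk continuous_const))) ?_
      refine intervalIntegral.continuous_parametric_intervalIntegral_of_continuous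
        (f := fun x t => k (clamp X x) t * u t) (s := fun x => clamp X x) ?_ hcl
      exact (hk.comp ((hcl.comp continuous_fst).prodMk continuous_snd)).mul
        (hu.comp continuous_snd))
    ⟨C, fun x => by
      simp only [Pi.zero_apply, mul_zero, intervalIntegral.integral_zero, sub_zero, norm_neg]
      exact (hC _ (clamp_mem hX x) 0 (left_mem_Icc.2 hX)).trans (le_mul_of_one_le_right hC0
        (Real.one_le_exp (mul_nonneg hμ.le (clamp_mem hX x).1)))⟩
    (fun u v M hu hv h x => by
      have hM0 : 0 ≤ M := nonneg_of_mul_nonneg_left ((norm_nonneg _).trans (h x)) (Real.exp_pos _)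
      set y := clamp X x with hy
      have hym := clamp_mem hX x
      rw [← hy] at hym
      have hky : Continuous (k y) := hk.comp (Continuous.prodMk_right y)
      rw [sub_sub_sub_cancel_left, norm_sub_rev, ← intervalIntegral.integral_sub
        (Continuous.intervalIntegrable (by fun_prop) _ _)
        (Continuous.intervalIntegrable (by fun_prop) _ _)]
      have h1 : ‖∫ t in (0 : ℝ)..y, (k y t * u t - k y t * v t)‖ ≤
          ∫ t in (0 : ℝ)..y, C * (M * Real.exp (μ * t)) := by
        refine intervalIntegral.norm_integral_le_of_norm_le hym.1 (ae_of_all _ fun t ht => ?_)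
          (Continuous.intervalIntegrable (by fun_prop) _ _)
        have ht' : t ∈ Icc 0 X := ⟨ht.1.le, ht.2.trans hym.2⟩
        have h2 := h t
        rw [clamp_of_mem ht'] at h2
        rw [← mul_sub, norm_mul]
        exact mul_le_mul (hC y hym t ht') h2 (norm_nonneg _) hC0
      refine h1.trans ?_
      rw [intervalIntegral.integral_const_mul, intervalIntegral.integral_const_mul]
      calc C * (M * ∫ t in (0 : ℝ)..y, Real.exp (μ * t)) ≤ C * (M * (Real.exp (μ * y) / μ)) := by
            gcongr; exact integral_exp_mul_le hμ y
        _ = (C / μ) * (M * Real.exp (μ * y)) := by ring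
        _ ≤ (1 / 2) * (M * Real.exp (μ * y)) := by
            refine mul_le_mul_of_nonneg_right ?_ (by positivity)
            rw [div_le_iff₀ hμ]; linarith
        _ = _ := by ring)
  refine ⟨ψ, hψ, fun x hx => ?_⟩
  have := hfix x
  rwa [clamp_of_mem hx] at this

/-- The Gelfand–Levitan equation: its two sides agree for `t = 0`, and both satisfy the square
identity in the variables `x = ξ + η`, `t = ξ - η`. -/
theorem Goursat.gelfandLevitan {h : ℂ} {q : ℝ → ℂ} (hq : Measurable q) (hqi : Integrable q)
    {w : ℝ × ℝ → ℂ} (hw : Continuous w)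
    (hG : Goursat (fun x => h + ∫ s in (0 : ℝ)..x, q s) q 2 w) {φ : ℝ → ℂ} (hφ : Continuous φ)
    (he : ∀ y, φ (-y) = φ y)
    (h0 : ∀ x ∈ Icc (0 : ℝ) 2, goursatKernel w x 0 + levitanSum (goursatKernel w) φ x 0 = 0) :
    GelfandLevitan (goursatKernel w) φ := by
  have hk := continuous_goursatKernel hw
  set D : ℝ × ℝ → ℂ := fun p => w p + levitanSum (goursatKernel w) φ (p.1 + p.2) (p.1 - p.2)
    with hDd
  have hGc : Continuous fun p : ℝ × ℝ => levitanSum (goursatKernel w) φ (p.1 + p.2) (p.1 - p.2) :=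
    (continuous_levitanSum hk hφ).comp (by fun_prop :
      Continuous fun p : ℝ × ℝ => (p.1 + p.2, p.1 - p.2))
  have hDc : Continuous D := hw.add hGc
  have hD : SquareIdentity q D := (hG.squareIdentity hq hqi one_le_two hw).add hq hqi hw hGc
    ((hG.intertwines hq hqi hw).squareIdentity_levitanSum hq hqi hk hφ he)
  have hsub : ∀ {a : ℝ}, a ∈ Icc (0 : ℝ) 1 → a ∈ Icc (0 : ℝ) 2 := fun ha =>
    ⟨ha.1, ha.2.trans one_le_two⟩
  intro x t ht htx hx
  have hz := hD.eq_zero hqi hDc (fun ξ hξ η hη => by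
      simp only [hDd]
      rw [hG.symm hq hqi hw (hsub hξ) (hsub hη), add_comm ξ η, ← neg_sub η ξ]
      simp only [levitanSum, kernF_neg_right he])
    (fun ξ hξ => by
      have := h0 (ξ + ξ) ⟨by linarith [hξ.1], by linarith [hξ.2]⟩
      rw [goursatKernel, add_zero, sub_zero, add_self_div_two] at this
      simp only [hDd, sub_self]
      exact this)
    (ξ := (x + t) / 2) (η := (x - t) / 2) ⟨by linarith, by linarith⟩ ⟨by linarith, by linarith⟩
  simp only [hDd] at hz
  have e1 : (x + t) / 2 + (x - t) / 2 = x := by ring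
  have e2 : (x + t) / 2 - (x - t) / 2 = t := by ring
  rw [e1, e2, levitanSum, ← add_assoc] at hz
  exact hz


/-! ### Lipschitz functions and increments of primitives -/

theorem exists_primitive_of_lipschitz_real {a b L : ℝ} (hL : 0 ≤ L) {f : ℝ → ℝ}
    (h : ∀ x ∈ Icc a b, ∀ y ∈ Icc a b, x ≤ y → |f y - f x| ≤ L * (y - x)) :
    ∃ v : ℝ → ℝ, Measurable v ∧ (∀ x, |v x| ≤ L) ∧
      ∀ x ∈ Icc a b, f x = f a + ∫ s in a..x, v s := by
  have hlip : LipschitzOnWith ⟨L, hL⟩ f (Icc a b) := by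
    refine LipschitzOnWith.of_dist_le_mul fun x hx y hy => ?_
    rw [Real.dist_eq, Real.dist_eq]
    rcases le_total x y with hle | hle
    · rw [abs_sub_comm, abs_sub_comm x, abs_of_nonneg (sub_nonneg.2 hle)]; exact h x hx y hy hle
    · rw [abs_of_nonneg (sub_nonneg.2 hle)]; exact h y hy x hx hle
  refine ⟨indicator (Ioo a b) (deriv f), (measurable_deriv f).indicator measurableSet_Ioo,
    fun x => ?_, fun x hx => ?_⟩
  · by_cases hx : x ∈ Ioo a b
    · rw [indicator_of_mem hx]
      have := norm_deriv_le_of_lipschitzOn (Icc_mem_nhds hx.1 hx.2) hlip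
      exact this
    · rw [indicator_of_notMem hx, abs_zero]; exact hL
  · have h1 := (hlip.mono (s := uIcc a x) (by
      rw [uIcc_of_le hx.1]; exact Icc_subset_Icc_right hx.2)).absolutelyContinuousOnInterval
    have h2 := h1.integral_deriv_eq_sub
    have h3 : ∫ s in a..x, indicator (Ioo a b) (deriv f) s = ∫ s in a..x, deriv f s := by
      rw [intervalIntegral_eq_integral_vol hx.1, intervalIntegral_eq_integral_vol hx.1]
      refine integral_congr_ae ((ae_restrict_mem measurableSet_Ioo).mono fun s hs => ?_)
      have hs' : s ∈ Ioo a b := ⟨hs.1, hs.2.trans_le hx.2⟩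
      simp only [indicator_of_mem hs']
    rw [h3, h2]; ring

/-- A Lipschitz function is a primitive of a bounded function. -/
theorem exists_primitive_of_lipschitz {a b L : ℝ} (hL : 0 ≤ L) {f : ℝ → ℂ}
    (h : ∀ x ∈ Icc a b, ∀ y ∈ Icc a b, x ≤ y → ‖f y - f x‖ ≤ L * (y - x)) :
    ∃ v : ℝ → ℂ, Measurable v ∧ (∀ x, ‖v x‖ ≤ L + L) ∧
      ∀ x ∈ Icc a b, f x = f a + ∫ s in a..x, v s := by
  obtain ⟨v₁, m₁, b₁, e₁⟩ := exists_primitive_of_lipschitz_real hL (f := fun x => (f x).re)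
    (fun x hx y hy hle => by
      rw [← Complex.sub_re]; exact (Complex.abs_re_le_norm _).trans (h x hx y hy hle))
  obtain ⟨v₂, m₂, b₂, e₂⟩ := exists_primitive_of_lipschitz_real hL (f := fun x => (f x).im)
    (fun x hx y hy hle => by
      rw [← Complex.sub_im]; exact (Complex.abs_im_le_norm _).trans (h x hx y hy hle))
  refine ⟨fun x => v₁ x + v₂ x * Complex.I, by fun_prop, fun x => ?_, fun x hx => ?_⟩
  · refine (norm_add_le _ _).trans ?_
    rw [norm_mul, Complex.norm_I, mul_one, Complex.norm_real, Complex.norm_real]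
    exact add_le_add (b₁ x) (b₂ x)
  · have hi : ∀ {v : ℝ → ℝ}, Measurable v → (∀ x, |v x| ≤ L) →
        IntervalIntegrable (fun s => (v s : ℂ)) volume a x := fun {v} hm hb => by
      rw [intervalIntegrable_iff_vol hx.1]
      exact Integrable.of_bound (by fun_prop) L (ae_of_all _ fun s => by
        rw [Complex.norm_real]; exact hb s)
    rw [intervalIntegral.integral_add (hi m₁ b₁) ((hi m₂ b₂).mul_const _),
      intervalIntegral.integral_mul_const, intervalIntegral.integral_ofReal,
      intervalIntegral.integral_ofReal, ← Complex.re_add_im (f x), e₁ x hx, e₂ x hx]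
    have := Complex.re_add_im (f a)
    push_cast
    linear_combination this

theorem continuous_primitive_add {q : ℝ → ℂ} (hqi : Integrable q) (c : ℂ) :
    Continuous fun x => c + ∫ s in (0 : ℝ)..x, q s :=
  continuous_const.add (intervalIntegral.continuous_primitive (fun _ _ => hqi.intervalIntegrable) 0)

/-- The increments of a primitive `S` of `q ∈ L₁` are small in the norm of `L₁`. -/
theorem integral_norm_primitive_shift_le {q : ℝ → ℂ} (hq : Measurable q) (hqi : Integrable q)
    {S : ℝ → ℂ} {c : ℂ} (hS : ∀ x, S x = c + ∫ s in (0 : ℝ)..x, q s) {A B δ : ℝ} (hAB : A ≤ B)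
    (hδ : 0 ≤ δ) : ∫ t in A..B, ‖S (t + δ) - S t‖ ≤ δ * ∫ y, ‖q y‖ := by
  have hSc : Continuous S := by
    have := continuous_primitive_add hqi c
    rwa [← funext hS] at this
  have hint : IntervalIntegrable (fun a => ∫ b in (0 : ℝ)..δ, ‖q (a + b)‖) volume A B := by
    rw [intervalIntegrable_iff]
    refine (integrable_shift_prod hq hqi A B 0 δ).norm.integral_prod_left.congr
      (ae_of_all _ fun b => ?_)
    simp only [intervalIntegral.integral_of_le hδ, uIoc_of_le hδ]
  calc _ ≤ ∫ t in A..B, ∫ b in (0 : ℝ)..δ, ‖q (t + b)‖ := by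
        refine intervalIntegral.integral_mono_on hAB
          (Continuous.intervalIntegrable (by fun_prop) _ _) hint fun t _ => ?_
        have e : S (t + δ) - S t = ∫ b in (0 : ℝ)..δ, q (t + b) := by
          rw [hS, hS, add_sub_add_left_eq_sub, intervalIntegral.integral_interval_sub_left
            hqi.intervalIntegrable hqi.intervalIntegrable,
            intervalIntegral.integral_comp_add_left (fun s => q s), add_zero]
        rw [e]
        exact intervalIntegral.norm_integral_le_integral_norm hδ
    _ ≤ _ := by
        have := integral_integral_norm_shift_le hq hqi hAB hδ
        rwa [sub_zero] at this

theorem integral_norm_primitive_affine_le {q : ℝ → ℂ} (hq : Measurable q) (hqi : Integrable q)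
    {S : ℝ → ℂ} {c : ℂ} (hS : ∀ x, S x = c + ∫ s in (0 : ℝ)..x, q s) {A B α y y' : ℝ}
    (hAB : A ≤ B) (hα : α ≠ 0) (hy : y ≤ y') :
    ∫ t in A..B, ‖S (α * t + y') - S (α * t + y)‖ ≤ |α|⁻¹ * ((y' - y) * ∫ y, ‖q y‖) := by
  have e : ∀ t, ‖S (α * t + y') - S (α * t + y)‖ =
      (fun s => ‖S (s + (y' - y)) - S s‖) (α * t + y) := fun t => by
    simp only
    rw [add_assoc, add_sub_cancel]
  simp only [e]
  rw [intervalIntegral.integral_comp_mul_add (fun s => ‖S (s + (y' - y)) - S s‖) hα, smul_eq_mul]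
  rcases lt_or_gt_of_ne hα with h | h
  · rw [intervalIntegral.integral_symm, abs_of_neg h, inv_neg, mul_neg, ← neg_mul]
    refine mul_le_mul_of_nonneg_left (integral_norm_primitive_shift_le hq hqi hS ?_
      (sub_nonneg.2 hy)) (by rw [← inv_neg]; exact inv_nonneg.2 (by linarith))
    nlinarith
  · rw [abs_of_pos h]
    refine mul_le_mul_of_nonneg_left (integral_norm_primitive_shift_le hq hqi hS ?_
      (sub_nonneg.2 hy)) (by positivity)
    nlinarith

/-- The integral `∫₀ˣ F(x, t) dt` is Lipschitz in `x` if `F(x, ·)` is Lipschitz in `x` with respect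
to the norm of `L₁(0, x)`. -/
theorem norm_volterra_integral_sub_le {F : ℝ → ℝ → ℂ} (hF : ∀ x, Continuous (F x))
    {C L X : ℝ} (hC : ∀ x ∈ Icc 0 X, ∀ t ∈ Icc 0 x, ‖F x t‖ ≤ C)
    (hL : ∀ x ∈ Icc 0 X, ∀ x' ∈ Icc 0 X, x ≤ x' →
      ∫ t in (0 : ℝ)..x, ‖F x' t - F x t‖ ≤ L * (x' - x)) :
    ∀ x ∈ Icc 0 X, ∀ x' ∈ Icc 0 X, x ≤ x' →
      ‖(∫ t in (0 : ℝ)..x', F x' t) - ∫ t in (0 : ℝ)..x, F x t‖ ≤ (C + L) * (x' - x) := by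
  intro x hx x' hx' hle
  have hFx := hF x
  have hFx' := hF x'
  rw [← intervalIntegral.integral_add_adjacent_intervals (b := x) (hFx'.intervalIntegrable _ _)
    (hFx'.intervalIntegrable _ _), add_sub_right_comm, ← intervalIntegral.integral_sub
    (hFx'.intervalIntegrable _ _) (hFx.intervalIntegrable _ _)]
  have h1 := intervalIntegral.norm_integral_le_of_norm_le_const (a := x) (b := x') (f := F x')
    (C := C) fun t ht => by
      rw [uIoc_of_le hle] at ht
      exact hC x' hx' t ⟨hx.1.trans ht.1.le, ht.2⟩
  rw [abs_of_nonneg (sub_nonneg.2 hle)] at h1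
  have h2 := (intervalIntegral.norm_integral_le_integral_norm (f := fun t => F x' t - F x t)
    hx.1).trans (hL x hx x' hx' hle)
  refine (norm_add_le _ _).trans ?_
  linarith

/-! ### Existence of the transformation operator -/

/-- The kernel of the transformation operator need not be Lipschitz in `x`, but it is in the norm of
`L₁`. -/
theorem Goursat.integral_norm_kernel_sub_le {h : ℂ} {q : ℝ → ℂ} (hq : Measurable q)
    (hqi : Integrable q) {w : ℝ × ℝ → ℂ} (hw : Continuous w)
    (hG : Goursat (fun x => h + ∫ s in (0 : ℝ)..x, q s) q 2 w) {M : ℝ}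
    (hM : ∀ a ∈ Icc (0 : ℝ) 2, ∀ b ∈ Icc (0 : ℝ) 2, ‖w (a, b)‖ ≤ M) {x x' : ℝ}
    (hx : x ∈ Icc (0 : ℝ) 2) (hx' : x' ∈ Icc (0 : ℝ) 2) (hle : x ≤ x') :
    ∫ t in (0 : ℝ)..x, ‖goursatKernel w x' t - goursatKernel w x t‖ ≤
      (1 + 2 * M) * (∫ y, ‖q y‖) * (x' - x) := by
  set Q := ∫ y, ‖q y‖ with hQ
  have hQ0 : 0 ≤ Q := integral_nonneg fun _ => norm_nonneg _
  have hM0 : 0 ≤ M := (norm_nonneg _).trans (hM x hx x hx)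
  set S : ℝ → ℂ := fun x => h + ∫ s in (0 : ℝ)..x, q s with hS
  have hSc : Continuous S := continuous_primitive_add hqi h
  have hk := continuous_goursatKernel hw
  have hkx : ∀ x, Continuous (goursatKernel w x) := fun x => hk.comp (Continuous.prodMk_right x)
  have hk1 := hkx x
  have hk2 := hkx x'
  have hpt : ∀ t ∈ Icc 0 x, ‖goursatKernel w x' t - goursatKernel w x t‖ ≤
      (1 / 2) * ‖S (1 / 2 * t + x' / 2) - S (1 / 2 * t + x / 2)‖ +
        (1 / 2) * ‖S (-(1 / 2) * t + x' / 2) - S (-(1 / 2) * t + x / 2)‖ + M * Q * (x' - x) := by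
    intro t ht
    have m : ∀ r ∈ Icc x x', (r + t) / 2 ∈ Icc (0 : ℝ) 2 ∧ (r - t) / 2 ∈ Icc (0 : ℝ) 2 :=
      fun r hr => ⟨⟨by linarith [ht.1, hr.1, hx.1], by linarith [ht.2, hr.2, hr.1, hx'.2]⟩,
        ⟨by linarith [ht.2, hr.1], by linarith [ht.1, hr.2, hx'.2]⟩⟩
    obtain ⟨a1, a2⟩ := m x ⟨le_rfl, hle⟩
    obtain ⟨b1, b2⟩ := m x' ⟨hle, le_rfl⟩
    have hR := norm_integral_integral_shift_mul_sub_le hq hqi hw hM b1 a1 b2 a2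
    have e1 : (x' + t) / 2 - (x + t) / 2 = (x' - x) / 2 := by ring
    have e2 : (x' - t) / 2 - (x - t) / 2 = (x' - x) / 2 := by ring
    rw [e1, e2, abs_of_nonneg (by linarith), add_halves, ← hQ] at hR
    rw [goursatKernel, goursatKernel, hG _ b1 _ b2, hG _ a1 _ a2]
    have f1 : ∀ r, 1 / 2 * t + r / 2 = (r + t) / 2 := fun r => by ring
    have f2 : ∀ r, -(1 / 2) * t + r / 2 = (r - t) / 2 := fun r => by ring
    rw [f1, f1, f2, f2, add_sub_add_comm, add_sub_add_comm, ← mul_sub, ← mul_sub]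
    refine (norm_add_le _ _).trans (add_le_add ((norm_add_le _ _).trans (le_of_eq ?_)) hR)
    rw [norm_mul, norm_mul]
    norm_num
  have i1 := integral_norm_primitive_affine_le hq hqi (S := S) (c := h) (fun _ => rfl) hx.1
    (α := 1 / 2) (by norm_num) (y := x / 2) (y' := x' / 2) (by linarith)
  have i2 := integral_norm_primitive_affine_le hq hqi (S := S) (c := h) (fun _ => rfl) hx.1
    (α := -(1 / 2)) (by norm_num) (y := x / 2) (y' := x' / 2) (by linarith)
  rw [abs_neg] at i2
  rw [abs_of_pos (by norm_num), ← hQ] at i1 i2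
  have j1 : IntervalIntegrable (fun t => (1 / 2) *
      ‖S (1 / 2 * t + x' / 2) - S (1 / 2 * t + x / 2)‖) volume 0 x :=
    Continuous.intervalIntegrable (by fun_prop) _ _
  have j2 : IntervalIntegrable (fun t => (1 / 2) *
      ‖S (-(1 / 2) * t + x' / 2) - S (-(1 / 2) * t + x / 2)‖) volume 0 x :=
    Continuous.intervalIntegrable (by fun_prop) _ _
  calc _ ≤ ∫ t in (0 : ℝ)..x, ((1 / 2) * ‖S (1 / 2 * t + x' / 2) - S (1 / 2 * t + x / 2)‖ +
        (1 / 2) * ‖S (-(1 / 2) * t + x' / 2) - S (-(1 / 2) * t + x / 2)‖ + M * Q * (x' - x)) :=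
        intervalIntegral.integral_mono_on hx.1 (Continuous.intervalIntegrable (by fun_prop) _ _)
          ((j1.add j2).add intervalIntegrable_const) hpt
    _ = (1 / 2) * (∫ t in (0 : ℝ)..x, ‖S (1 / 2 * t + x' / 2) - S (1 / 2 * t + x / 2)‖) +
        (1 / 2) * (∫ t in (0 : ℝ)..x, ‖S (-(1 / 2) * t + x' / 2) - S (-(1 / 2) * t + x / 2)‖) +
        x * (M * Q * (x' - x)) := by
        rw [intervalIntegral.integral_add (j1.add j2) intervalIntegrable_const,
          intervalIntegral.integral_add j1 j2, intervalIntegral.integral_const_mul,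
          intervalIntegral.integral_const_mul, intervalIntegral.integral_const, smul_eq_mul,
          sub_zero]
    _ ≤ _ := by
        have h3 : x * (M * Q * (x' - x)) ≤ 2 * (M * Q * (x' - x)) :=
          mul_le_mul_of_nonneg_right hx.2 (by have := sub_nonneg.2 hle; positivity)
        norm_num at i1 i2 ⊢
        nlinarith

/-- Every `σ = h + ∫ q` has the transformation operator, and `φ_σ` has a square integrable
derivative. -/
theorem exists_transformData (h : ℂ) {q : ℝ → ℂ} (hq : Measurable q) (hqi : Integrable q)
    (hq2 : MemLp q 2 volume) :
    ∃ k φ, TransformData h q k φ ∧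
      ∃ p : ℝ → ℂ, MemLp p 2 (vol 0 2) ∧
        ∀ x ∈ Icc (0 : ℝ) 2, φ x = φ 0 + ∫ s in (0 : ℝ)..x, p s := by
  set Q := ∫ y, ‖q y‖ with hQ
  have hQ0 : 0 ≤ Q := integral_nonneg fun _ => norm_nonneg _
  set S : ℝ → ℂ := fun x => h + ∫ s in (0 : ℝ)..x, q s with hS
  have hSc : Continuous S := continuous_primitive_add hqi h
  obtain ⟨w, hw, hG⟩ := exists_goursat hSc hq hqi zero_le_two
  set k := goursatKernel w with hkd
  have hk : Continuous (Function.uncurry k) := continuous_goursatKernel hw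
  have hkx : ∀ x, Continuous (k x) := fun x => hk.comp (Continuous.prodMk_right x)
  -- for even `φ` the Gelfand–Levitan equation at `t = 0` is a Volterra equation for `ψ = 2 φ`
  obtain ⟨ψ, hψ, hψe⟩ := exists_levitan_phi hk zero_le_two
  set φ : ℝ → ℂ := fun y => (1 / 2) * ψ |y| with hφd
  have hφ : Continuous φ := by fun_prop
  have he : ∀ y, φ (-y) = φ y := fun y => by simp only [hφd, abs_neg]
  have hφpos : ∀ y, 0 ≤ y → φ y = (1 / 2) * ψ y := fun y hy => by simp only [hφd, abs_of_nonneg hy]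
  have h02 : (0 : ℝ) ∈ Icc (0 : ℝ) 2 := left_mem_Icc.2 zero_le_two
  have h0 : ∀ x ∈ Icc (0 : ℝ) 2, k x 0 + levitanSum k φ x 0 = 0 := by
    intro x hx
    have hf : ∀ s, 0 ≤ s → kernF φ s 0 = ψ s := fun s hs => by
      rw [kernF_even he, add_zero, sub_zero, hφpos s hs]; ring
    rw [levitanSum, hf x hx.1, hψe x hx]
    have : ∫ s in (0 : ℝ)..x, k x s * kernF φ s 0 = ∫ s in (0 : ℝ)..x, k x s * ψ s :=
      intervalIntegral.integral_congr fun s hs => by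
        rw [uIcc_of_le hx.1] at hs
        simp only [hf s hs.1]
    rw [this]; ring
  refine ⟨k, φ, ⟨hk, hφ, fun ν x hx => hG.intertwines hq hqi hw ν x ⟨hx.1, hx.2.trans one_le_two⟩,
    fun x hx => hG.diagonal ⟨hx.1, hx.2.trans one_le_two⟩,
    hG.gelfandLevitan hq hqi hw hφ he h0⟩, ?_⟩
  obtain ⟨M, hM0, hM⟩ := exists_bound_square hw 2
  obtain ⟨C, hC⟩ := (isCompact_Icc (a := (0 : ℝ)) (b := 2)).exists_bound_of_continuousOn
    hψ.continuousOn
  have hC0 : 0 ≤ C := (norm_nonneg _).trans (hC 0 h02)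
  -- all terms of the equation for `φ` but `-S(x / 2) / 2` are Lipschitz functions
  have lip1 := norm_volterra_integral_sub_le (F := fun x t => k x t * ψ t) (X := 2) (C := M * C)
    (L := C * ((1 + 2 * M) * Q)) (fun x => (hkx x).mul hψ)
    (fun x hx t ht => by
      rw [norm_mul]
      refine mul_le_mul (hM _ ⟨by linarith [ht.1, hx.1], by linarith [ht.2, hx.2]⟩ _
        ⟨by linarith [ht.2], by linarith [ht.1, hx.2]⟩) (hC t ⟨ht.1, ht.2.trans hx.2⟩)
        (norm_nonneg _) hM0)
    (fun x hx x' hx' hle => by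
      have hk1 := hkx x
      have hk2 := hkx x'
      calc _ ≤ ∫ t in (0 : ℝ)..x, C * ‖k x' t - k x t‖ := by
            refine intervalIntegral.integral_mono_on hx.1
              (Continuous.intervalIntegrable (by fun_prop) _ _)
              (Continuous.intervalIntegrable (by fun_prop) _ _) fun t ht => ?_
            rw [← sub_mul, norm_mul, mul_comm]
            exact mul_le_mul_of_nonneg_right (hC t ⟨ht.1, ht.2.trans hx.2⟩) (norm_nonneg _)
        _ ≤ C * ((1 + 2 * M) * Q * (x' - x)) := by
            rw [intervalIntegral.integral_const_mul]
            exact mul_le_mul_of_nonneg_left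
              (hG.integral_norm_kernel_sub_le hq hqi hw hM hx hx' hle) hC0
        _ = _ := by ring)
  have hk0 : ∀ x ∈ Icc (0 : ℝ) 2, k x 0 = S (x / 2) +
      ∫ a in (0 : ℝ)..(x / 2), ∫ b in (0 : ℝ)..(x / 2), q (a + b) * w (a, b) := fun x hx => by
    have hm : x / 2 ∈ Icc (0 : ℝ) 2 := ⟨by linarith [hx.1], by linarith [hx.1, hx.2]⟩
    rw [hkd, goursatKernel, add_zero, sub_zero, hG _ hm _ hm]
    ring
  have hB : ∀ x ∈ Icc (0 : ℝ) 2, φ x + (1 / 2) * S (x / 2) = -(1 / 2) *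
      ((∫ a in (0 : ℝ)..(x / 2), ∫ b in (0 : ℝ)..(x / 2), q (a + b) * w (a, b)) +
        ∫ t in (0 : ℝ)..x, k x t * ψ t) := fun x hx => by
    rw [hφpos x hx.1, hψe x hx, hk0 x hx]; ring
  obtain ⟨v, hvm, hvb, hv⟩ := exists_primitive_of_lipschitz (a := 0) (b := 2)
    (f := fun x => φ x + (1 / 2) * S (x / 2)) (L := M * Q + (M * C + C * ((1 + 2 * M) * Q)))
    (by positivity) (fun x hx x' hx' hle => by
      have hm : ∀ x ∈ Icc (0 : ℝ) 2, x / 2 ∈ Icc (0 : ℝ) 2 := fun x hx =>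
        ⟨by linarith [hx.1], by linarith [hx.1, hx.2]⟩
      have hR := norm_integral_integral_shift_mul_sub_le hq hqi hw hM (hm x' hx') (hm x hx)
        (hm x' hx') (hm x hx)
      rw [← sub_div, abs_of_nonneg (by linarith), add_halves, ← hQ] at hR
      have hl := lip1 x hx x' hx' hle
      rw [hB x hx, hB x' hx', ← mul_sub, add_sub_add_comm, norm_mul]
      have hn : ‖(-(1 / 2) : ℂ)‖ = 1 / 2 := by norm_num
      have := norm_add_le
        ((∫ a in (0 : ℝ)..(x' / 2), ∫ b in (0 : ℝ)..(x' / 2), q (a + b) * w (a, b)) -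
          ∫ a in (0 : ℝ)..(x / 2), ∫ b in (0 : ℝ)..(x / 2), q (a + b) * w (a, b))
        ((∫ t in (0 : ℝ)..x', k x' t * ψ t) - ∫ t in (0 : ℝ)..x, k x t * ψ t)
      rw [hn]
      have h0' := norm_nonneg
        (((∫ a in (0 : ℝ)..(x' / 2), ∫ b in (0 : ℝ)..(x' / 2), q (a + b) * w (a, b)) -
          ∫ a in (0 : ℝ)..(x / 2), ∫ b in (0 : ℝ)..(x / 2), q (a + b) * w (a, b)) +
        ((∫ t in (0 : ℝ)..x', k x' t * ψ t) - ∫ t in (0 : ℝ)..x, k x t * ψ t))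
      linarith)
  have hq' : MemLp (fun s => q (s / 2)) 2 (vol 0 2) := by
    refine MemLp.mono_measure Measure.restrict_le_self ?_
    have hm : Measurable fun s => q (s / 2) := by fun_prop
    rw [memLp_two_iff_integrable_sq_norm hm.aestronglyMeasurable]
    exact ((memLp_two_iff_integrable_sq_norm hq.aestronglyMeasurable).1 hq2).comp_div two_ne_zero
  have hv2 : MemLp v 2 (vol 0 2) :=
    MemLp.of_bound hvm.aestronglyMeasurable _ (ae_of_all _ hvb)
  refine ⟨fun s => v s - (1 / 4) * q (s / 2), hv2.sub (hq'.const_mul _), fun x hx => ?_⟩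
  have iv : IntervalIntegrable v volume 0 x :=
    (intervalIntegrable_iff_vol hx.1).2
      (Integrable.of_bound hvm.aestronglyMeasurable _ (ae_of_all _ hvb))
  have iq : IntervalIntegrable (fun s => q (s / 2)) volume 0 x :=
    (hqi.comp_div two_ne_zero).intervalIntegrable
  rw [intervalIntegral.integral_sub iv (iq.const_mul _), intervalIntegral.integral_const_mul,
    intervalIntegral.integral_comp_div (fun s => q s) two_ne_zero]
  have h1 := hv x hx
  simp only [hS, zero_div, intervalIntegral.integral_same, Complex.real_smul] at h1 ⊢
  push_cast
  linear_combination h1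


/-! ### Truncations of a factorizable operator -/

/-- The product of `u ∈ L₂(0, 1)` and the indicator function of `(-∞, x)`. -/
noncomputable def cutoffFun (x : ℝ) (u : L2 0 1) : L2 0 1 :=
  MemLp.toLp ((Iio x).indicator u) ((Lp.memLp u).indicator measurableSet_Iio)

theorem cutoffFun_ae (x : ℝ) (u : L2 0 1) : cutoffFun x u =ᵐ[vol 0 1] (Iio x).indicator u :=
  MemLp.coeFn_toLp _

theorem cutoffFun_add (x : ℝ) (u v : L2 0 1) :
    cutoffFun x (u + v) = cutoffFun x u + cutoffFun x v := by
  refine Lp.ext ?_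
  filter_upwards [cutoffFun_ae x (u + v), cutoffFun_ae x u, cutoffFun_ae x v,
    Lp.coeFn_add (cutoffFun x u) (cutoffFun x v), Lp.coeFn_add u v] with y h1 h2 h3 h4 h5
  rw [h1, h4, Pi.add_apply, h2, h3]
  by_cases hy : y ∈ Iio x
  · rw [indicator_of_mem hy, indicator_of_mem hy, indicator_of_mem hy, h5, Pi.add_apply]
  · rw [indicator_of_notMem hy, indicator_of_notMem hy, indicator_of_notMem hy, add_zero]

theorem cutoffFun_smul (x : ℝ) (c : ℂ) (u : L2 0 1) :
    cutoffFun x (c • u) = c • cutoffFun x u := by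
  refine Lp.ext ?_
  filter_upwards [cutoffFun_ae x (c • u), cutoffFun_ae x u,
    Lp.coeFn_smul c (cutoffFun x u), Lp.coeFn_smul c u] with y h1 h2 h4 h5
  rw [h1, h4, Pi.smul_apply, h2]
  by_cases hy : y ∈ Iio x
  · rw [indicator_of_mem hy, indicator_of_mem hy, h5, Pi.smul_apply]
  · rw [indicator_of_notMem hy, indicator_of_notMem hy, smul_zero]

theorem norm_cutoffFun_le (x : ℝ) (u : L2 0 1) : ‖cutoffFun x u‖ ≤ ‖u‖ := by
  refine Lp.norm_le_norm_of_ae_le ?_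
  filter_upwards [cutoffFun_ae x u] with y h1
  rw [h1]
  exact norm_indicator_le_norm_self _ _

/-- Multiplication by the indicator function of `(-∞, x)` in `L₂(0, 1)`. -/
noncomputable def cutoff (x : ℝ) : L2 0 1 →L[ℂ] L2 0 1 :=
  LinearMap.mkContinuous ⟨⟨cutoffFun x, cutoffFun_add x⟩, cutoffFun_smul x⟩ 1
    (fun u => by rw [one_mul]; exact norm_cutoffFun_le x u)

theorem cutoff_ae (x : ℝ) (u : L2 0 1) : cutoff x u =ᵐ[vol 0 1] (Iio x).indicator u :=
  cutoffFun_ae x u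

theorem norm_cutoff_le (x : ℝ) (u : L2 0 1) : ‖cutoff x u‖ ≤ ‖u‖ := norm_cutoffFun_le x u

theorem cutoff_mul_self (x : ℝ) : cutoff x * cutoff x = cutoff x := by
  ext1 u
  refine Lp.ext ?_
  filter_upwards [cutoff_ae x (cutoff x u), cutoff_ae x u] with y h1 h2
  change cutoff x (cutoff x u) y = _
  rw [h1, h2]
  by_cases hy : y ∈ Iio x
  · rw [indicator_of_mem hy, h2]
  · rw [indicator_of_notMem hy, indicator_of_notMem hy]

theorem HasKernel.cutoff_mul {A : L2 0 1 →L[ℂ] L2 0 1} {k : ℝ → ℝ → ℂ} (hA : HasKernel A k)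
    (x : ℝ) : HasKernel (cutoff x * A) fun y t => if y < x then k y t else 0 := by
  have hs : MeasurableSet {p : ℝ × ℝ | p.1 < x} := measurableSet_lt measurable_fst measurable_const
  refine ⟨?_, fun u => ?_⟩
  · refine (memLp_congr_ae (ae_of_all _ fun p => ?_)).1 (hA.1.indicator hs)
    simp only [indicator_apply, mem_ofPred_eq]
  · filter_upwards [cutoff_ae x (A u), hA.2 u] with y h1 h2
    change cutoff x (A u) y = _
    rw [h1]
    by_cases hy : y < x
    · rw [indicator_of_mem (mem_Iio.2 hy), h2]; simp only [if_pos hy]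
    · rw [indicator_of_notMem (by simpa using hy)]; simp only [if_neg hy, zero_mul, integral_zero]

theorem IsVolterraPlus.cutoff_mul {A : L2 0 1 →L[ℂ] L2 0 1} (hA : IsVolterraPlus A) (x : ℝ) :
    IsVolterraPlus (cutoff x * A) := by
  obtain ⟨k, hk, hk0⟩ := hA
  refine ⟨_, hk.cutoff_mul x, hk0.mono fun p hp hlt => ?_⟩
  split_ifs
  · exact hp hlt
  · rfl

theorem IsVolterraMinus.one_sub_cutoff_mul {A : L2 0 1 →L[ℂ] L2 0 1} (hA : IsVolterraMinus A)
    (x : ℝ) : IsVolterraMinus ((1 - cutoff x) * A) := by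
  obtain ⟨k, hk, hk0⟩ := hA
  have e : (1 - cutoff x) * A = A + (-1 : ℂ) • (cutoff x * A) := by
    rw [sub_mul, one_mul, neg_one_smul, ← sub_eq_add_neg]
  rw [e]
  refine ⟨_, hk.add ((hk.cutoff_mul x).smul (-1)), hk0.mono fun p hp hlt => ?_⟩
  split_ifs <;> simp [hp hlt]

/-- A lower triangular operator maps the functions vanishing on `(0, x)` into themselves. -/
theorem IsVolterraPlus.cutoff_mul_eq {A : L2 0 1 →L[ℂ] L2 0 1} (hA : IsVolterraPlus A) (x : ℝ) :
    cutoff x * A = cutoff x * A * cutoff x := by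
  obtain ⟨k, hk, hk0⟩ := hA
  ext1 u
  refine Lp.ext ?_
  have e : (cutoff x * A * cutoff x) u = cutoff x (A (cutoff x u)) := rfl
  rw [e]
  change (cutoff x (A u) : L2 0 1) =ᵐ[vol 0 1] cutoff x (A (cutoff x u))
  filter_upwards [cutoff_ae x (A u), cutoff_ae x (A (cutoff x u)), hk.2 u, hk.2 (cutoff x u),
    Measure.ae_ae_of_ae_prod hk0] with y h1 h2 h3 h4 h5
  rw [h1, h2]
  by_cases hy : y < x
  · rw [indicator_of_mem (mem_Iio.2 hy), indicator_of_mem (mem_Iio.2 hy), h3, h4]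
    refine integral_congr_ae ?_
    filter_upwards [h5, cutoff_ae x u] with t h6 h7
    rcases lt_or_ge y t with hlt | hle
    · rw [h6 hlt, zero_mul, zero_mul]
    · rw [h7, indicator_of_mem (mem_Iio.2 (hle.trans_lt hy))]
  · rw [indicator_of_notMem (by simpa using hy), indicator_of_notMem (by simpa using hy)]

/-- An upper triangular operator maps the functions vanishing on `(x, 1)` into themselves. -/
theorem IsVolterraMinus.mul_cutoff_eq {A : L2 0 1 →L[ℂ] L2 0 1} (hA : IsVolterraMinus A) (x : ℝ) :
    A * cutoff x = cutoff x * A * cutoff x := by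
  obtain ⟨k, hk, hk0⟩ := hA
  ext1 u
  refine Lp.ext ?_
  have e : (cutoff x * A * cutoff x) u = cutoff x (A (cutoff x u)) := rfl
  rw [e]
  change (A (cutoff x u) : L2 0 1) =ᵐ[vol 0 1] cutoff x (A (cutoff x u))
  filter_upwards [cutoff_ae x (A (cutoff x u)), hk.2 (cutoff x u),
    Measure.ae_ae_of_ae_prod hk0] with y h2 h4 h5
  rw [h2]
  by_cases hy : y < x
  · rw [indicator_of_mem (mem_Iio.2 hy)]
  · rw [indicator_of_notMem (by simpa using hy), h4]
    refine integral_eq_zero_of_ae ?_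
    filter_upwards [h5, cutoff_ae x u] with t h6 h7
    rcases lt_or_ge t y with hlt | hle
    · simp [h6 hlt]
    · rw [h7, indicator_of_notMem (by simp only [mem_Iio, not_lt]; linarith), mul_zero]; rfl

/-- The algebra behind the inversion of truncations: if `1 + F = L U` with the inverse `a` of `L`
lower triangular and the inverse `b` of `U` upper triangular with respect to the projection `P`,
then `1 - F b P a` is the inverse of `1 + F P`. -/
theorem isUnit_one_add_mul_projection {R : Type*} [Ring R] {F P a b L U : R}
    (ha : P * a = P * a * P) (hb : b * P = P * b * P)
    (hL : P * L = P * L * P) (hU : U * P = P * U * P) (haL : a * L = 1) (hLa : L * a = 1)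
    (hbU : b * U = 1) (hUb : U * b = 1) (hF : 1 + F = L * U) : IsUnit (1 + F * P) := by
  have e1 : P * (F * (b * P * a)) = P - b * P * a := by
    have h1 : P * ((1 + F) * (b * P * a)) = P := by
      rw [hF]
      calc P * (L * U * (b * P * a)) = P * L * (U * b) * P * a := by simp only [mul_assoc]
        _ = P * L * P * a := by rw [hUb, mul_one]
        _ = P := by rw [← hL, mul_assoc, hLa, mul_one]
    have h2 : P * (b * P * a) = b * P * a := by
      rw [← mul_assoc, ← mul_assoc, ← hb]
    rw [add_mul, one_mul, mul_add, h2] at h1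
    exact eq_sub_of_add_eq' h1
  have e2 : b * P * a * (F * P) = P - b * P * a := by
    have h1 : b * P * a * ((1 + F) * P) = P := by
      rw [hF]
      calc b * P * a * (L * U * P) = b * P * (a * L) * (U * P) := by simp only [mul_assoc]
        _ = b * (P * U * P) := by rw [haL, mul_one]; simp only [mul_assoc]
        _ = P := by rw [← hU, ← mul_assoc, hbU, one_mul]
    have h2 : b * P * a * P = b * P * a := by
      rw [mul_assoc b P a, mul_assoc b (P * a) P, ← ha]
    rw [add_mul, one_mul, mul_add, h2] at h1
    exact eq_sub_of_add_eq' h1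
  refine ⟨⟨1 + F * P, 1 - F * (b * P * a), ?_, ?_⟩, rfl⟩
  · have : (1 + F * P) * (1 - F * (b * P * a)) =
        1 + F * P - F * (b * P * a) - F * (P * (F * (b * P * a))) := by noncomm_ring
    rw [this, e1]
    noncomm_ring
  · have : (1 - F * (b * P * a)) * (1 + F * P) =
        1 + F * P - F * (b * P * a) - F * (b * P * a * (F * P)) := by noncomm_ring
    rw [this, e2]
    noncomm_ring

/-- If `I + F` admits the factorization, then all of its truncations are invertible. -/
theorem Factorizable.isUnit_one_add_mul_cutoff {F : L2 0 1 →L[ℂ] L2 0 1} (hF : Factorizable F)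
    (x : ℝ) : IsUnit (1 + F * cutoff x) := by
  obtain ⟨Rp, Rm, hp, hm, up, um, hfac⟩ := hF
  set P := cutoff x with hP
  have hPP : P * P = P := cutoff_mul_self x
  set L := Ring.inverse (1 + Rp) with hL
  set U := Ring.inverse (1 + Rm) with hU
  have haL : (1 + Rp) * L = 1 := Ring.mul_inverse_cancel _ up
  have hbU : (1 + Rm) * U = 1 := Ring.mul_inverse_cancel _ um
  have ha : P * (1 + Rp) = P * (1 + Rp) * P := by
    rw [mul_add, mul_one, add_mul, hPP, ← hp.cutoff_mul_eq x]
  have hb : (1 + Rm) * P = P * (1 + Rm) * P := by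
    rw [mul_add, mul_one, add_mul, add_mul, one_mul, hPP, ← hm.mul_cutoff_eq x]
  refine isUnit_one_add_mul_projection ha hb ?_ ?_ haL (Ring.inverse_mul_cancel _ up) hbU
    (Ring.inverse_mul_cancel _ um) hfac
  · -- `P L (1 - P) = 0`, because `1 + P Rp` is injective
    rw [← sub_eq_zero]
    ext1 v
    refine (hp.cutoff_mul x).eq_zero_of_add_eq_zero ?_
    have e : (1 + P * Rp) * (P * L - P * L * P) = 0 := by
      have h1 : P * Rp * P = P * Rp := (hp.cutoff_mul_eq x).symm
      calc (1 + P * Rp) * (P * L - P * L * P) = (P + P * Rp * P) * L * (1 - P) := by noncomm_ring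
        _ = P * ((1 + Rp) * L) * (1 - P) := by rw [h1]; noncomm_ring
        _ = P - P * P := by rw [haL]; noncomm_ring
        _ = 0 := by rw [hPP, sub_self]
    exact congrArg (fun T : L2 0 1 →L[ℂ] L2 0 1 => T v) e
  · rw [← sub_eq_zero]
    ext1 v
    refine (hm.one_sub_cutoff_mul x).eq_zero_of_add_eq_zero ?_
    have e : (1 + (1 - P) * Rm) * (U * P - P * U * P) = 0 := by
      have h1 : (1 - P) * Rm * P = 0 := by
        have := hm.mul_cutoff_eq x
        rw [sub_mul, sub_mul, one_mul, ← hP] at *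
        rw [← this, sub_self]
      calc (1 + (1 - P) * Rm) * (U * P - P * U * P) =
          (1 - P) * ((1 + Rm) * U) * P - (1 - P) * Rm * P * (U * P) := by noncomm_ring
        _ = P - P * P := by rw [hbU, h1]; noncomm_ring
        _ = 0 := by rw [hPP, sub_self]
    exact congrArg (fun T : L2 0 1 →L[ℂ] L2 0 1 => T v) e


/-! ### The Gelfand–Levitan equation for a factorizable operator -/

/-- The bilinear form `∫₀¹ v u`. -/
noncomputable def pairing (v u : L2 0 1) : ℂ := ∫ s, v s * u s ∂(vol 0 1)

theorem norm_pairing_le (v u : L2 0 1) : ‖pairing v u‖ ≤ ‖v‖ * ‖u‖ := by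
  have h := norm_integral_mul_sq_le (Lp.memLp v) (Lp.memLp u)
  rw [← norm_sq_eq_integral, ← norm_sq_eq_integral, ← mul_pow] at h
  exact le_of_sq_le_sq h (by positivity)

theorem pairing_sub_left (v v' u : L2 0 1) :
    pairing (v - v') u = pairing v u - pairing v' u := by
  unfold pairing
  rw [← integral_sub (integrable_mul_of_memLp (Lp.memLp v) (Lp.memLp u))
    (integrable_mul_of_memLp (Lp.memLp v') (Lp.memLp u))]
  refine integral_congr_ae ((Lp.coeFn_sub v v').mono fun s hs => ?_)
  simp only [hs, Pi.sub_apply, sub_mul]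

theorem pairing_sub_right (v u u' : L2 0 1) :
    pairing v (u - u') = pairing v u - pairing v u' := by
  unfold pairing
  rw [← integral_sub (integrable_mul_of_memLp (Lp.memLp v) (Lp.memLp u))
    (integrable_mul_of_memLp (Lp.memLp v) (Lp.memLp u'))]
  refine integral_congr_ae ((Lp.coeFn_sub u u').mono fun s hs => ?_)
  simp only [hs, Pi.sub_apply, mul_sub]

/-- The section `f(x, ·)` of a continuous kernel as an element of `L₂(0, 1)`. -/
noncomputable def kernelSection {f : ℝ → ℝ → ℂ} (hf : Continuous (Function.uncurry f)) (x : ℝ) :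
    L2 0 1 :=
  MemLp.toLp (f x) (memLp_of_continuous (hf.comp (Continuous.prodMk_right x)))

theorem kernelSection_ae {f : ℝ → ℝ → ℂ} (hf : Continuous (Function.uncurry f)) (x : ℝ) :
    kernelSection hf x =ᵐ[vol 0 1] f x := MemLp.coeFn_toLp _

theorem pairing_kernelSection {f : ℝ → ℝ → ℂ} (hf : Continuous (Function.uncurry f)) (x : ℝ)
    (u : L2 0 1) : pairing (kernelSection hf x) u = ∫ s, f x s * u s ∂(vol 0 1) :=
  integral_congr_ae ((kernelSection_ae hf x).mono fun s hs => by simp only [hs])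

theorem continuous_kernelSection {f : ℝ → ℝ → ℂ} (hf : Continuous (Function.uncurry f)) :
    Continuous (kernelSection hf) := by
  refine continuous_iff_continuousAt.2 fun y => ?_
  have hc : Continuous fun x => ∫ t in (0 : ℝ)..1, ‖f x t - f y t‖ ^ 2 := by
    refine intervalIntegral.continuous_parametric_intervalIntegral_of_continuous
      (f := fun x t => ‖f x t - f y t‖ ^ 2) (s := fun _ : ℝ => 1) ?_ continuous_const
    exact ((hf.sub (hf.comp (continuous_const.prodMk continuous_snd))).norm).pow 2
  have h0 : Filter.Tendsto (fun x => Real.sqrt (∫ t in (0 : ℝ)..1, ‖f x t - f y t‖ ^ 2)) (nhds y)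
      (nhds 0) := by
    have := (Real.continuous_sqrt.comp hc).tendsto y
    simpa [Function.comp_def] using this
  refine tendsto_iff_norm_sub_tendsto_zero.2 (h0.congr fun x => ?_)
  rw [intervalIntegral_eq_integral_vol zero_le_one, ← Real.sqrt_sq (norm_nonneg _),
    norm_sq_eq_integral]
  congr 1
  refine integral_congr_ae ?_
  filter_upwards [kernelSection_ae hf x, kernelSection_ae hf y,
    Lp.coeFn_sub (kernelSection hf x) (kernelSection hf y)] with t h1 h2 h3
  rw [h3, Pi.sub_apply, h1, h2]

/-- Moving the point of truncation from `y` to `x` changes the truncated integral of `g u` by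
`O(√|x - y|)`, by the Cauchy–Schwarz inequality. -/
theorem norm_integral_mul_cutoff_sub_le {g : ℝ → ℂ} (hg : Continuous g) {C : ℝ} (hC0 : 0 ≤ C)
    (hC : ∀ s ∈ Ioo (0 : ℝ) 1, ‖g s‖ ≤ C) (x y : ℝ) (u : L2 0 1) :
    ‖∫ s, g s * (cutoff x u - cutoff y u : L2 0 1) s ∂(vol 0 1)‖ ≤
      C * Real.sqrt |x - y| * ‖u‖ := by
  set χ : ℝ → ℂ := fun s => (Iio x).indicator 1 s - (Iio y).indicator 1 s with hχ
  have hχm : Measurable χ :=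
    (measurable_one.indicator measurableSet_Iio).sub (measurable_one.indicator measurableSet_Iio)
  have hχ0 : ∀ s, s ∉ uIcc x y → χ s = 0 := by
    intro s hs
    rw [uIcc, mem_Icc, not_and_or, not_le, not_le] at hs
    rcases hs with hs | hs
    · simp [hχ, lt_min_iff.1 hs]
    · have h1 : x ≤ s := (le_max_left x y).trans hs.le
      have h2 : y ≤ s := (le_max_right x y).trans hs.le
      simp [hχ, h1, h2]
  have hχ1 : ∀ s, ‖χ s‖ ≤ 1 := by
    intro s
    by_cases h1 : s < x <;> by_cases h2 : s < y <;> simp [hχ, h1, h2]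
  have hp : ∀ s ∈ Ioo (0 : ℝ) 1, ‖g s * χ s‖ ≤ C := fun s hs => by
    rw [norm_mul]
    exact (mul_le_of_le_one_right (norm_nonneg _) (hχ1 s)).trans (hC s hs)
  have hpL : MemLp (fun s => g s * χ s) 2 (vol 0 1) :=
    MemLp.of_bound (hg.measurable.mul hχm).aestronglyMeasurable C
      ((ae_restrict_mem measurableSet_Ioo).mono hp)
  have e : ∫ s, g s * (cutoff x u - cutoff y u : L2 0 1) s ∂(vol 0 1) =
      ∫ s, (g s * χ s) * u s ∂(vol 0 1) := by
    refine integral_congr_ae ?_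
    filter_upwards [Lp.coeFn_sub (cutoff x u) (cutoff y u), cutoff_ae x u, cutoff_ae y u]
      with s h1 h2 h3
    rw [h1, Pi.sub_apply, h2, h3]
    by_cases h1 : s < x <;> by_cases h2 : s < y <;> simp [hχ, h1, h2]
  have hb : ∫ s, ‖g s * χ s‖ ^ 2 ∂(vol 0 1) ≤ C ^ 2 * |x - y| := by
    have hi : Integrable ((uIcc x y).indicator fun _ : ℝ => C ^ 2) volume :=
      (integrable_indicator_iff measurableSet_uIcc).2 (integrableOn_const (by
        rw [uIcc, Real.volume_Icc]; exact ENNReal.ofReal_ne_top))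
    calc _ ≤ ∫ s, (uIcc x y).indicator (fun _ : ℝ => C ^ 2) s ∂(vol 0 1) := by
          refine integral_mono_ae (integrable_sq_norm hpL) hi.restrict ?_
          filter_upwards [ae_restrict_mem measurableSet_Ioo] with s hs
          by_cases hm : s ∈ uIcc x y
          · simp only [indicator_of_mem hm]
            exact pow_le_pow_left₀ (norm_nonneg _) (hp s hs) 2
          · simp only [indicator_of_notMem hm, hχ0 s hm]
            simp
      _ ≤ ∫ s, (uIcc x y).indicator (fun _ : ℝ => C ^ 2) s :=
          setIntegral_le_integral hi
            (ae_of_all _ fun s => indicator_nonneg (fun _ _ => sq_nonneg C) s)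
      _ = C ^ 2 * |x - y| := by
          rw [integral_indicator measurableSet_uIcc, setIntegral_const, smul_eq_mul, mul_comm,
            Measure.real, Real.volume_interval, ENNReal.toReal_ofReal (abs_nonneg _), abs_sub_comm]
  rw [e]
  refine le_of_sq_le_sq ?_ (by positivity)
  refine (norm_integral_mul_sq_le hpL (Lp.memLp u)).trans ?_
  rw [← norm_sq_eq_integral, mul_pow, mul_pow, Real.sq_sqrt (abs_nonneg _)]
  exact mul_le_mul_of_nonneg_right hb (sq_nonneg _)

/-- The truncations of an operator with a continuous kernel depend continuously on the point of
truncation. -/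
theorem HasKernel.continuous_mul_cutoff {F : L2 0 1 →L[ℂ] L2 0 1} {f : ℝ → ℝ → ℂ}
    (hf : Continuous (Function.uncurry f)) (hF : HasKernel F f) :
    Continuous fun x => F * cutoff x := by
  obtain ⟨C, hC0, hC⟩ := exists_bound_square hf 1
  have hb : ∀ x y, ‖F * cutoff x - F * cutoff y‖ ≤ C * Real.sqrt |x - y| := by
    intro x y
    refine ContinuousLinearMap.opNorm_le_bound _ (by positivity) fun u => ?_
    have e : (F * cutoff x - F * cutoff y) u = F (cutoff x u - cutoff y u) := by
      rw [map_sub]; rfl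
    rw [e]
    refine norm_le_of_ae_bound (by positivity) ?_
    filter_upwards [hF.2 (cutoff x u - cutoff y u), ae_restrict_mem measurableSet_Ioo] with t h1 ht
    rw [h1]
    exact norm_integral_mul_cutoff_sub_le (hf.comp (Continuous.prodMk_right t)) hC0
      (fun s hs => hC t (Ioo_subset_Icc_self ht) s (Ioo_subset_Icc_self hs)) x y u
  refine continuous_iff_continuousAt.2 fun y => tendsto_iff_norm_sub_tendsto_zero.2
    (squeeze_zero (fun _ => norm_nonneg _) (fun x => hb x y) ?_)
  have hc : Continuous fun x => C * Real.sqrt |x - y| := by fun_prop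
  simpa using hc.tendsto y

theorem integral_mul_cutoff {x : ℝ} (hx1 : x ≤ 1) (hx0 : 0 ≤ x) {u : L2 0 1} {v g : ℝ → ℂ}
    (hu : u =ᵐ[vol 0 1] v) :
    ∫ s, g s * cutoff x u s ∂(vol 0 1) = ∫ s in (0 : ℝ)..x, g s * v s := by
  have e : vol 0 x = (vol 0 1).restrict (Iio x) := by
    rw [vol, vol, Measure.restrict_restrict measurableSet_Iio]
    congr 1
    ext s
    simp only [mem_inter_iff, mem_Iio, mem_Ioo]
    exact ⟨fun h => ⟨h.2, h.1, h.2.trans_le hx1⟩, fun h => ⟨h.2.1, h.1⟩⟩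
  rw [intervalIntegral_eq_integral_vol hx0, e, ← integral_indicator measurableSet_Iio]
  refine integral_congr_ae ?_
  filter_upwards [cutoff_ae x u, hu] with s h1 h2
  rw [h1]
  by_cases hs : s ∈ Iio x
  · simp only [indicator_of_mem hs, h2]
  · simp only [indicator_of_notMem hs, mul_zero]

/-- For a factorizable operator the Gelfand–Levitan equation has a continuous solution: its
sections are obtained from the inverses of the truncations, which depend continuously on the point
of truncation. -/
theorem Factorizable.exists_gelfandLevitan {F : L2 0 1 →L[ℂ] L2 0 1} {φ : ℝ → ℂ}
    (hfac : Factorizable F) (hφ : Continuous φ) (hF : HasKernel F (kernF φ)) :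
    ∃ k : ℝ → ℝ → ℂ, Continuous (Function.uncurry k) ∧ GelfandLevitan k φ := by
  have hf := continuous_kernF hφ
  set sec := kernelSection hf with hsec
  have hsecc : Continuous sec := continuous_kernelSection hf
  have hinv : Continuous fun x => Ring.inverse (1 + F * cutoff x) := by
    refine continuous_iff_continuousAt.2 fun x => ?_
    obtain ⟨U, hU⟩ := hfac.isUnit_one_add_mul_cutoff x
    have h1 := NormedRing.inverse_continuousAt U
    rw [hU] at h1
    exact ContinuousAt.comp (f := fun x => 1 + F * cutoff x) h1
      (continuous_const.add (hF.continuous_mul_cutoff hf)).continuousAt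
  -- `κ x` solves `κ + F P_x κ = -f(x, ·)`, where `P_x` is the truncation at `x`
  set κ : ℝ → L2 0 1 := fun x => -(Ring.inverse (1 + F * cutoff x) (sec x)) with hκ
  have hκc : Continuous κ := (hinv.clm_apply hsecc).neg
  have hκe : ∀ x, κ x + F (cutoff x (κ x)) = -sec x := by
    intro x
    have h1 := Ring.mul_inverse_cancel _ (hfac.isUnit_one_add_mul_cutoff x)
    have h2 := congrArg (fun T : L2 0 1 →L[ℂ] L2 0 1 => T (-sec x)) h1
    change Ring.inverse (1 + F * cutoff x) (-sec x) +
      F (cutoff x (Ring.inverse (1 + F * cutoff x) (-sec x))) = -sec x at h2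
    rw [map_neg] at h2
    exact h2
  -- `g (x, t) = ∫₀ˣ κ_x(s) f(s, t) ds`
  set g : ℝ × ℝ → ℂ := fun p => pairing (sec p.2) (cutoff p.1 (κ p.1)) with hg
  have hgc : Continuous g := by
    refine continuous_iff_continuousAt.2 fun ⟨y, r⟩ => ?_
    have hfr : Continuous (kernF φ r) := hf.comp (Continuous.prodMk_right r)
    obtain ⟨C, hC⟩ := (isCompact_Icc (a := (0 : ℝ)) (b := 1)).exists_bound_of_continuousOn
      hfr.continuousOn
    have hC0 : 0 ≤ C := (norm_nonneg _).trans (hC 0 (left_mem_Icc.2 zero_le_one))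
    refine tendsto_iff_norm_sub_tendsto_zero.2 (squeeze_zero (fun _ => norm_nonneg _)
      (g := fun p : ℝ × ℝ => ‖sec p.2 - sec r‖ * ‖κ p.1‖ + ‖sec r‖ * ‖κ p.1 - κ y‖ +
        C * Real.sqrt |p.1 - y| * ‖κ y‖) (fun p => ?_) ?_)
    · have e : g p - g (y, r) = pairing (sec p.2 - sec r) (cutoff p.1 (κ p.1)) +
          pairing (sec r) (cutoff p.1 (κ p.1 - κ y)) +
          pairing (sec r) (cutoff p.1 (κ y) - cutoff y (κ y)) := by
        rw [pairing_sub_left, pairing_sub_right, map_sub, pairing_sub_right]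
        simp only [hg]
        ring
      rw [e]
      refine (norm_add_le _ _).trans (add_le_add ((norm_add_le _ _).trans (add_le_add ?_ ?_)) ?_)
      · exact (norm_pairing_le _ _).trans
          (mul_le_mul_of_nonneg_left (norm_cutoff_le _ _) (norm_nonneg _))
      · exact (norm_pairing_le _ _).trans
          (mul_le_mul_of_nonneg_left (norm_cutoff_le _ _) (norm_nonneg _))
      · rw [pairing_kernelSection]
        exact norm_integral_mul_cutoff_sub_le hfr hC0
          (fun s hs => hC s (Ioo_subset_Icc_self hs)) _ _ _
    · have hc : Continuous fun p : ℝ × ℝ => ‖sec p.2 - sec r‖ * ‖κ p.1‖ +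
          ‖sec r‖ * ‖κ p.1 - κ y‖ + C * Real.sqrt |p.1 - y| * ‖κ y‖ := by fun_prop
      simpa using hc.tendsto (y, r)
  -- the continuous representative of `κ x`
  set k : ℝ → ℝ → ℂ := fun x t => -kernF φ x t - g (x, t) with hk
  have hae : ∀ x, κ x =ᵐ[vol 0 1] k x := by
    intro x
    have h0 : κ x = -sec x - F (cutoff x (κ x)) := eq_sub_of_add_eq (hκe x)
    have h1 : κ x =ᵐ[vol 0 1] (-sec x - F (cutoff x (κ x)) : L2 0 1) := by rw [← h0]
    filter_upwards [h1, Lp.coeFn_sub (-sec x) (F (cutoff x (κ x))), Lp.coeFn_neg (sec x),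
      kernelSection_ae hf x, hF.2 (cutoff x (κ x))] with t h1 h2 h3 h4 h5
    rw [h1, h2, Pi.sub_apply, h3, Pi.neg_apply, h4, h5]
    simp only [hk, hg, hsec, pairing_kernelSection]
  refine ⟨k, hf.neg.sub hgc, fun x t ht htx hx => ?_⟩
  have h1 : g (x, t) = ∫ s in (0 : ℝ)..x, k x s * kernF φ s t := by
    simp only [hg, hsec, pairing_kernelSection]
    rw [integral_mul_cutoff hx (ht.trans htx) (hae x)]
    refine intervalIntegral.integral_congr fun s _ => ?_
    simp only [kernF_comm φ t s, mul_comm]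
  rw [← h1]
  simp only [hk]
  ring


/-! ### Uniqueness of the triangular factor -/

/-- If `‖u t‖ ≤ M e^{μ (y + t)}` for `0 ≤ t ≤ x`, then the integral of `u` over `(0, x)` gains a
factor `1 / μ`. -/
theorem norm_integral_le_of_exp_bound {u : ℝ → ℂ} {M μ x y : ℝ} (hμ : 0 < μ) (hM : 0 ≤ M)
    (hx : 0 ≤ x) (hu : ∀ t ∈ Icc 0 x, ‖u t‖ ≤ M * Real.exp (μ * (y + t))) :
    ‖∫ t in (0 : ℝ)..x, u t‖ ≤ M / μ * Real.exp (μ * (y + x)) := by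
  have hi : IntervalIntegrable (fun t => M * Real.exp (μ * y) * Real.exp (μ * t)) volume 0 x :=
    Continuous.intervalIntegrable (by fun_prop) _ _
  refine (intervalIntegral.norm_integral_le_of_norm_le hx (g := fun t =>
    M * Real.exp (μ * y) * Real.exp (μ * t)) (ae_of_all _ fun t ht => ?_) hi).trans ?_
  · refine (hu t (Ioc_subset_Icc_self ht)).trans_eq ?_
    rw [mul_add, Real.exp_add, mul_assoc]
  · rw [intervalIntegral.integral_const_mul]
    refine (mul_le_mul_of_nonneg_left (integral_exp_mul_le hμ x) (by positivity)).trans_eq ?_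
    rw [mul_add, Real.exp_add]
    ring

/-- The triangular factor is determined as soon as `φ₁ - φ₂` is controlled by the difference of the
diagonal terms of the factorizations. The hypothesis `hφ` holds if `φ₁ = φ₂`, and also if `m₁` and
`m₂` agree on the diagonal and `φ₁(0) = φ₂(0)`. -/
theorem TriangularFactor.eq_of_norm_le {m₁ m₂ : ℝ → ℝ → ℂ} {φ₁ φ₂ : ℝ → ℂ}
    (hm₁ : Continuous (Function.uncurry m₁)) (hm₂ : Continuous (Function.uncurry m₂))
    (h₁ : TriangularFactor m₁ φ₁) (h₂ : TriangularFactor m₂ φ₂)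
    (hφ : ∀ x ∈ Icc (0 : ℝ) 1, ‖φ₁ (2 * x) - φ₂ (2 * x)‖ ≤
      ‖∫ t in (0 : ℝ)..x, (m₁ x t ^ 2 - m₂ x t ^ 2)‖) {x t : ℝ} (ht : 0 ≤ t) (htx : t ≤ x)
    (hx : x ≤ 1) : m₁ x t = m₂ x t := by
  obtain ⟨C₁, hC₁0, hC₁⟩ := exists_bound_square hm₁ 1
  obtain ⟨C₂, hC₂0, hC₂⟩ := exists_bound_square hm₂ 1
  set C := C₁ + C₂ + 1 with hCdef
  have hC0 : 0 < C := by positivity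
  have b₁ : ∀ a ∈ Icc (0 : ℝ) 1, ∀ b ∈ Icc (0 : ℝ) 1, ‖m₁ a b‖ ≤ C := fun a ha b hb =>
    (hC₁ a ha b hb).trans (by linarith)
  have b₂ : ∀ a ∈ Icc (0 : ℝ) 1, ∀ b ∈ Icc (0 : ℝ) 1, ‖m₂ a b‖ ≤ C := fun a ha b hb =>
    (hC₂ a ha b hb).trans (by linarith)
  -- with the weight `exp (μ (x + t))` each of the three terms of `e` below is at most
  -- `2 C M / μ = M / 6` times the weight
  set μ := 12 * C with hμdef
  have hμ : 0 < μ := by positivity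
  have key := eq_zero_of_halving (ρ := fun p : ℝ × ℝ => Real.exp (μ * (p.1 + p.2)))
    (d := fun p : ℝ × ℝ => m₁ p.1 p.2 - m₂ p.1 p.2)
    (s := {p : ℝ × ℝ | 0 ≤ p.2 ∧ p.2 ≤ p.1 ∧ p.1 ≤ 1}) ?_ ?_
  · exact sub_eq_zero.1 (key (x, t) ⟨ht, htx, hx⟩)
  · refine ⟨C + C, by positivity, fun ⟨x, t⟩ ⟨ht, htx, hx⟩ => ?_⟩
    dsimp only at ht htx hx ⊢
    have hx' : x ∈ Icc (0 : ℝ) 1 := ⟨ht.trans htx, hx⟩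
    have ht' : t ∈ Icc (0 : ℝ) 1 := ⟨ht, htx.trans hx⟩
    refine ((norm_sub_le _ _).trans (add_le_add (b₁ x hx' t ht') (b₂ x hx' t ht'))).trans ?_
    exact le_mul_of_one_le_right (by positivity)
      (Real.one_le_exp (mul_nonneg hμ.le (add_nonneg hx'.1 ht)))
  · intro M hM hd
    have hd' : ∀ x t, 0 ≤ t → t ≤ x → x ≤ 1 →
        ‖m₁ x t - m₂ x t‖ ≤ M * Real.exp (μ * (x + t)) := fun x t h0 h1 h2 =>
      hd (x, t) ⟨h0, h1, h2⟩
    have hφ' : ∀ y, 0 ≤ y → y ≤ 2 →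
        ‖φ₁ y - φ₂ y‖ ≤ M / 6 * Real.exp (μ * y) := by
      intro y hy0 hy2
      have h3 := hφ (y / 2) ⟨by linarith, by linarith⟩
      rw [mul_div_cancel₀ y two_ne_zero] at h3
      refine h3.trans ((norm_integral_le_of_exp_bound (M := 2 * C * M) (y := y / 2) hμ
        (by positivity) (by linarith) fun t ht => ?_).trans_eq ?_)
      · have hx' : y / 2 ∈ Icc (0 : ℝ) 1 := ⟨by linarith, by linarith⟩
        have ht' : t ∈ Icc (0 : ℝ) 1 := ⟨ht.1, ht.2.trans hx'.2⟩
        rw [show m₁ (y / 2) t ^ 2 - m₂ (y / 2) t ^ 2 =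
          (m₁ (y / 2) t + m₂ (y / 2) t) * (m₁ (y / 2) t - m₂ (y / 2) t) by ring, norm_mul]
        calc _ ≤ (C + C) * (M * Real.exp (μ * (y / 2 + t))) :=
              mul_le_mul ((norm_add_le _ _).trans (add_le_add (b₁ _ hx' _ ht') (b₂ _ hx' _ ht')))
                (hd' _ _ ht.1 ht.2 hx'.2) (norm_nonneg _) (by positivity)
          _ = _ := by ring
      · rw [add_halves, hμdef]
        field_simp
        ring
    rintro ⟨x, t⟩ ⟨ht, htx, hx⟩
    dsimp only at ht htx hx ⊢
    have hx' : x ∈ Icc (0 : ℝ) 1 := ⟨ht.trans htx, hx⟩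
    have ht' : t ∈ Icc (0 : ℝ) 1 := ⟨ht, htx.trans hx⟩
    have hsec : ∀ {m : ℝ → ℝ → ℂ}, Continuous (Function.uncurry m) → ∀ a, Continuous (m a) :=
      fun hm a => hm.comp (Continuous.prodMk_right a)
    have e : m₁ x t - m₂ x t = (φ₁ (x + t) - φ₂ (x + t)) + (φ₁ |x - t| - φ₂ |x - t|) -
        ∫ s in (0 : ℝ)..t, (m₁ x s * m₁ t s - m₂ x s * m₂ t s) := by
      have h3 := h₁ x t ht htx hx
      have h4 := h₂ x t ht htx hx
      rw [intervalIntegral.integral_sub (f := fun s => m₁ x s * m₁ t s)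
        (g := fun s => m₂ x s * m₂ t s)
        (((hsec hm₁ x).mul (hsec hm₁ t)).intervalIntegrable _ _)
        (((hsec hm₂ x).mul (hsec hm₂ t)).intervalIntegrable _ _)]
      unfold kernF at h3 h4
      linear_combination h4 - h3
    have hI : ‖∫ s in (0 : ℝ)..t, (m₁ x s * m₁ t s - m₂ x s * m₂ t s)‖ ≤
        M / 6 * Real.exp (μ * (x + t)) := by
      refine (norm_integral_le_of_exp_bound (M := 2 * C * M) (y := x) hμ
        (by positivity) ht fun s hs => ?_).trans_eq ?_
      · have hs' : s ∈ Icc (0 : ℝ) 1 := ⟨hs.1, hs.2.trans ht'.2⟩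
        have h5 : Real.exp (μ * (t + s)) ≤ Real.exp (μ * (x + s)) :=
          Real.exp_le_exp.2 (mul_le_mul_of_nonneg_left (by linarith) hμ.le)
        rw [show m₁ x s * m₁ t s - m₂ x s * m₂ t s =
          (m₁ x s - m₂ x s) * m₁ t s + m₂ x s * (m₁ t s - m₂ t s) by ring]
        refine (norm_add_le _ _).trans ?_
        rw [norm_mul, norm_mul]
        have h6 : ‖m₁ x s - m₂ x s‖ * ‖m₁ t s‖ ≤ M * Real.exp (μ * (x + s)) * C :=
          mul_le_mul (hd' _ _ hs.1 (hs.2.trans htx) hx) (b₁ _ ht' _ hs') (norm_nonneg _)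
            (by positivity)
        have h7 : ‖m₂ x s‖ * ‖m₁ t s - m₂ t s‖ ≤ C * (M * Real.exp (μ * (x + s))) :=
          mul_le_mul (b₂ _ hx' _ hs')
            ((hd' _ _ hs.1 hs.2 ht'.2).trans (mul_le_mul_of_nonneg_left h5 hM)) (norm_nonneg _)
            hC0.le
        linarith
      · rw [hμdef]
        field_simp
        ring
    have hp := hφ' (x + t) (by linarith [hx'.1]) (by linarith [ht'.2])
    have hm := hφ' |x - t| (abs_nonneg _) (by rw [abs_of_nonneg (by linarith)]; linarith)
    have hm' : Real.exp (μ * |x - t|) ≤ Real.exp (μ * (x + t)) := by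
      rw [abs_of_nonneg (by linarith)]
      exact Real.exp_le_exp.2 (mul_le_mul_of_nonneg_left (by linarith) hμ.le)
    rw [e]
    refine (norm_sub_le _ _).trans ((add_le_add (norm_add_le _ _) le_rfl).trans ?_)
    have : M / 6 * Real.exp (μ * |x - t|) ≤ M / 6 * Real.exp (μ * (x + t)) :=
      mul_le_mul_of_nonneg_left hm' (by positivity)
    linarith

theorem TriangularFactor.eq_of_phi_eq {m₁ m₂ : ℝ → ℝ → ℂ} {φ₁ φ₂ : ℝ → ℂ}
    (hm₁ : Continuous (Function.uncurry m₁)) (hm₂ : Continuous (Function.uncurry m₂))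
    (h₁ : TriangularFactor m₁ φ₁) (h₂ : TriangularFactor m₂ φ₂) (hφ : EqOn φ₁ φ₂ (Icc 0 2))
    {x t : ℝ} (ht : 0 ≤ t) (htx : t ≤ x) (hx : x ≤ 1) : m₁ x t = m₂ x t := by
  refine h₁.eq_of_norm_le hm₁ hm₂ h₂ (fun x hx => ?_) ht htx hx
  rw [hφ ⟨by linarith [hx.1], by linarith [hx.2]⟩, sub_self, norm_zero]
  exact norm_nonneg _

/-- The diagonal of the triangular factor determines `φ`. -/
theorem TriangularFactor.phi_eq_of_diagonal_eq {m₁ m₂ : ℝ → ℝ → ℂ} {φ₁ φ₂ : ℝ → ℂ}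
    (hm₁ : Continuous (Function.uncurry m₁)) (hm₂ : Continuous (Function.uncurry m₂))
    (h₁ : TriangularFactor m₁ φ₁) (h₂ : TriangularFactor m₂ φ₂)
    (hd : ∀ x ∈ Icc (0 : ℝ) 1, m₁ x x = m₂ x x) : EqOn φ₁ φ₂ (Icc 0 2) := by
  have h0 : φ₁ 0 = φ₂ 0 := by
    have hz : (0 : ℝ) ∈ Icc (0 : ℝ) 1 := left_mem_Icc.2 zero_le_one
    have e₁ := h₁.diagonal hz
    have e₂ := h₂.diagonal hz
    simp only [mul_zero, intervalIntegral.integral_same, add_zero] at e₁ e₂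
    rw [hd 0 hz] at e₁
    linear_combination (1 / 2) * e₁ - (1 / 2) * e₂
  have hsub : ∀ x ∈ Icc (0 : ℝ) 1, φ₁ (2 * x) - φ₂ (2 * x) =
      ∫ t in (0 : ℝ)..x, (m₁ x t ^ 2 - m₂ x t ^ 2) := by
    intro x hx
    rw [intervalIntegral.integral_sub (f := fun t => m₁ x t ^ 2) (g := fun t => m₂ x t ^ 2)
      (((hm₁.comp (Continuous.prodMk_right x)).pow 2).intervalIntegrable _ _)
      (((hm₂.comp (Continuous.prodMk_right x)).pow 2).intervalIntegrable _ _)]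
    have e₁ := h₁.diagonal hx
    rw [hd x hx, h0] at e₁
    linear_combination e₁ - h₂.diagonal hx
  intro y hy
  have hx : y / 2 ∈ Icc (0 : ℝ) 1 := ⟨by linarith [hy.1], by linarith [hy.2]⟩
  have e := hsub (y / 2) hx
  rw [mul_div_cancel₀ y two_ne_zero] at e
  rw [← sub_eq_zero, e, intervalIntegral.integral_congr (g := fun _ => 0),
    intervalIntegral.integral_zero]
  intro t ht
  rw [uIcc_of_le hx.1] at ht
  simp only [h₁.eq_of_norm_le hm₁ hm₂ h₂ (fun x hx => (congrArg norm (hsub x hx)).le) ht.1 ht.2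
    hx.2, sub_self]


/-! ### Regularity of the solution of the Gelfand–Levitan equation on the diagonal -/

/-- If `φ(y) = c + ∫₀^|y| p`, the increments in `x` of the kernel `m` of the triangular
factorization are small in the norm of `L₁`. -/
theorem integral_norm_invKernel_sub_le {p : ℝ → ℂ} (hp : Measurable p) (hpi : Integrable p)
    (c : ℂ) {k : ℝ → ℝ → ℂ} (hk : Continuous (Function.uncurry k)) {M : ℝ}
    (hM : ∀ a ∈ Icc (0 : ℝ) 1, ∀ b ∈ Icc (0 : ℝ) 1, ‖k a b‖ ≤ M) {φ : ℝ → ℂ}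
    (hφ : ∀ y, φ y = c + ∫ s in (0 : ℝ)..|y|, p s) {x x' : ℝ}
    (hx : x ∈ Icc (0 : ℝ) 1) (hle : x ≤ x') :
    ∫ t in (0 : ℝ)..x, ‖invKernel k φ x' t - invKernel k φ x t‖ ≤
      2 * (1 + M) * (∫ y, ‖p y‖) * (x' - x) := by
  set P := ∫ y, ‖p y‖ with hP
  have hP0 : 0 ≤ P := integral_nonneg fun _ => norm_nonneg _
  have hM0 : 0 ≤ M := (norm_nonneg _).trans (hM x hx x hx)
  set S : ℝ → ℂ := fun y => c + ∫ s in (0 : ℝ)..y, p s with hS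
  have hSc : Continuous S := continuous_primitive_add hpi c
  have hφc : Continuous φ := by
    rw [show φ = fun y => S |y| from funext hφ]
    fun_prop
  have hfx : ∀ x, Continuous (kernF φ x) := fun x =>
    (continuous_kernF hφc).comp (Continuous.prodMk_right x)
  have hmx : ∀ x, Continuous (invKernel k φ x) := fun x =>
    (continuous_invKernel hk hφc).comp (Continuous.prodMk_right x)
  have hkx : ∀ x, Continuous (k x) := fun x => hk.comp (Continuous.prodMk_right x)
  -- for `t ≤ x ≤ r` the kernel `f(r, t)` is `S(r + t) + S(r - t)`, without the absolute value
  set D : ℝ → ℝ := fun t => ‖S (1 * t + x') - S (1 * t + x)‖ + ‖S (-1 * t + x') - S (-1 * t + x)‖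
    with hD
  have hDc : Continuous D := by fun_prop
  have hD0 : ∀ t, 0 ≤ D t := fun t => add_nonneg (norm_nonneg _) (norm_nonneg _)
  have hDi : ∀ t, 0 ≤ t → ∫ s in (0 : ℝ)..t, D s ≤ 2 * P * (x' - x) := by
    intro t ht
    have i1 := integral_norm_primitive_affine_le hp hpi (S := S) (c := c) (fun _ => rfl) ht
      (α := 1) one_ne_zero hle
    have i2 := integral_norm_primitive_affine_le hp hpi (S := S) (c := c) (fun _ => rfl) ht
      (α := -1) (by norm_num) hle
    rw [abs_neg] at i2
    rw [abs_one, inv_one, one_mul] at i1 i2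
    rw [hD, intervalIntegral.integral_add (Continuous.intervalIntegrable (by fun_prop) _ _)
      (Continuous.intervalIntegrable (by fun_prop) _ _)]
    linarith
  have hf : ∀ t ∈ Icc 0 x, ‖kernF φ x' t - kernF φ x t‖ ≤ D t := by
    intro t ht
    have e : ∀ r, x ≤ r → kernF φ r t = S (1 * t + r) + S (-1 * t + r) := fun r hr => by
      rw [kernF, hφ, hφ, abs_abs, abs_of_nonneg (by linarith [ht.1, ht.2] : 0 ≤ r + t),
        abs_of_nonneg (by linarith [ht.2] : 0 ≤ r - t)]
      simp only [hS]
      rw [one_mul, add_comm t r, neg_one_mul, neg_add_eq_sub]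
    rw [e x le_rfl, e x' hle, add_sub_add_comm]
    exact norm_add_le _ _
  have hm : ∀ t ∈ Icc 0 x, ‖invKernel k φ x' t - invKernel k φ x t‖ ≤
      D t + M * (2 * P * (x' - x)) := by
    intro t ht
    have h1 := hfx x
    have h2 := hfx x'
    have h3 := hkx t
    have e : invKernel k φ x' t - invKernel k φ x t = (kernF φ x' t - kernF φ x t) +
        ∫ s in (0 : ℝ)..t, (kernF φ x' s - kernF φ x s) * k t s := by
      simp only [sub_mul]
      rw [intervalIntegral.integral_sub (Continuous.intervalIntegrable (by fun_prop) _ _)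
        (Continuous.intervalIntegrable (by fun_prop) _ _), invKernel, invKernel]
      ring
    rw [e]
    refine (norm_add_le _ _).trans (add_le_add (hf t ht) ?_)
    refine (intervalIntegral.norm_integral_le_of_norm_le ht.1 (g := fun s => M * D s)
      (ae_of_all _ fun s hs => ?_) (Continuous.intervalIntegrable (by fun_prop) _ _)).trans ?_
    · rw [norm_mul, mul_comm]
      exact mul_le_mul (hM t ⟨ht.1, ht.2.trans hx.2⟩ s ⟨hs.1.le, hs.2.trans (ht.2.trans hx.2)⟩)
        (hf s ⟨hs.1.le, hs.2.trans ht.2⟩) (norm_nonneg _) hM0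
    · rw [intervalIntegral.integral_const_mul]
      exact mul_le_mul_of_nonneg_left (hDi t ht.1) hM0
  have m1 := hmx x
  have m2 := hmx x'
  refine (intervalIntegral.integral_mono_on hx.1 (Continuous.intervalIntegrable (by fun_prop) _ _)
    (Continuous.intervalIntegrable (by fun_prop) _ _) hm).trans ?_
  rw [intervalIntegral.integral_add (Continuous.intervalIntegrable (by fun_prop) _ _)
    (Continuous.intervalIntegrable (by fun_prop) _ _), intervalIntegral.integral_const, smul_eq_mul,
    sub_zero]
  have h4 : x * (M * (2 * P * (x' - x))) ≤ 1 * (M * (2 * P * (x' - x))) :=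
    mul_le_mul_of_nonneg_right hx.2 (by have := sub_nonneg.2 hle; positivity)
  linarith [hDi x hx.1]

/-- If `φ(y) = c + ∫₀^|y| p` with `p ∈ L₂`, the diagonal `k(x, x)` of a continuous solution of the
Gelfand–Levitan equation also has a derivative in `L₂`: it equals
`-φ(2x) - φ(0) + ∫₀ˣ m(x, t)² dt`, where the last term is Lipschitz. -/
theorem GelfandLevitan.exists_primitive_diagonal {p : ℝ → ℂ} (hp : Measurable p)
    (hpi : Integrable p) (hp2 : MemLp p 2 volume) (c : ℂ) {k : ℝ → ℝ → ℂ} {φ : ℝ → ℂ}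
    (hk : Continuous (Function.uncurry k)) (hφ : ∀ y, φ y = c + ∫ s in (0 : ℝ)..|y|, p s)
    (h : GelfandLevitan k φ) :
    ∃ r : ℝ → ℂ, Measurable r ∧ MemLp r 2 (vol 0 1) ∧
      ∀ x ∈ Icc (0 : ℝ) 1, k x x = k 0 0 + ∫ s in (0 : ℝ)..x, r s := by
  have hφc : Continuous φ := by
    rw [show φ = fun y => c + ∫ s in (0 : ℝ)..|y|, p s from funext hφ]
    exact (continuous_primitive_add hpi c).comp continuous_abs
  set m := invKernel k φ with hm
  have hmc := continuous_invKernel hk hφc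
  have hmx : ∀ x, Continuous (m x) := fun x => hmc.comp (Continuous.prodMk_right x)
  obtain ⟨M, hM0, hM⟩ := exists_bound_square hk 1
  obtain ⟨C, hC0, hC⟩ := exists_bound_square hmc 1
  set P := ∫ y, ‖p y‖ with hP
  have hP0 : 0 ≤ P := integral_nonneg fun _ => norm_nonneg _
  have lip := norm_volterra_integral_sub_le (F := fun x t => m x t ^ 2) (X := 1) (C := C ^ 2)
    (L := (C + C) * (2 * (1 + M) * P)) (fun x => (hmx x).pow 2)
    (fun x hx t ht => by
      rw [norm_pow]
      exact pow_le_pow_left₀ (norm_nonneg _) (hC x hx t ⟨ht.1, ht.2.trans hx.2⟩) 2)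
    (fun x hx x' hx' hle => by
      have h1 := hmx x
      have h2 := hmx x'
      calc _ ≤ ∫ t in (0 : ℝ)..x, (C + C) * ‖m x' t - m x t‖ := by
            refine intervalIntegral.integral_mono_on hx.1
              (Continuous.intervalIntegrable (by fun_prop) _ _)
              (Continuous.intervalIntegrable (by fun_prop) _ _) fun t ht => ?_
            have ht' : t ∈ Icc (0 : ℝ) 1 := ⟨ht.1, ht.2.trans hx.2⟩
            rw [sq_sub_sq, norm_mul]
            exact mul_le_mul_of_nonneg_right
              ((norm_add_le _ _).trans (add_le_add (hC x' hx' t ht') (hC x hx t ht')))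
              (norm_nonneg _)
        _ ≤ (C + C) * (2 * (1 + M) * P * (x' - x)) := by
            rw [intervalIntegral.integral_const_mul]
            exact mul_le_mul_of_nonneg_left
              (integral_norm_invKernel_sub_le hp hpi c hk hM hφ hx hle) (by positivity)
        _ = _ := by ring)
  obtain ⟨v, hvm, hvb, hv⟩ := exists_primitive_of_lipschitz (by positivity) lip
  refine ⟨fun s => v s - 2 * p (2 * s), by fun_prop, ?_, fun x hx => ?_⟩
  · refine (MemLp.of_bound hvm.aestronglyMeasurable _ (ae_of_all _ hvb)).sub (MemLp.const_mul ?_ _)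
    refine MemLp.mono_measure Measure.restrict_le_self ?_
    have hm : Measurable fun s => p (2 * s) := by fun_prop
    rw [memLp_two_iff_integrable_sq_norm hm.aestronglyMeasurable]
    exact ((memLp_two_iff_integrable_sq_norm hp.aestronglyMeasurable).1 hp2).comp_mul_left'
      two_ne_zero
  · have iv : IntervalIntegrable v volume 0 x := (intervalIntegrable_iff_vol hx.1).2
      (Integrable.of_bound hvm.aestronglyMeasurable _ (ae_of_all _ hvb))
    have ip : IntervalIntegrable (fun s => p (2 * s)) volume 0 x :=
      (hpi.comp_mul_left' two_ne_zero).intervalIntegrable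
    rw [intervalIntegral.integral_sub iv (ip.const_mul _), intervalIntegral.integral_const_mul,
      intervalIntegral.integral_comp_mul_left (fun s => p s) two_ne_zero]
    have h0 : (0 : ℝ) ∈ Icc (0 : ℝ) 1 := left_mem_Icc.2 zero_le_one
    have d0 := (h.triangularFactor hk hφc).diagonal h0
    have d1 := (h.triangularFactor hk hφc).diagonal hx
    rw [h.invKernel_diagonal h0] at d0
    rw [h.invKernel_diagonal hx] at d1
    have h1 := hv x hx
    have e1 := hφ (2 * x)
    have e0 := hφ 0
    rw [abs_of_nonneg (by linarith [hx.1] : 0 ≤ 2 * x)] at e1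
    simp only [abs_zero, mul_zero, intervalIntegral.integral_same, add_zero, zero_add,
      Complex.real_smul] at h1 e0 e1 d0 d1 ⊢
    push_cast
    linear_combination h1 + d1 - d0 - e1 + e0


/-! ### The mapping `σ ↦ φ_σ` on the Sobolev space -/

/-- A function in `L₂(a, b)` has a measurable representative, extended by zero. -/
theorem exists_measurable_indicator {a b : ℝ} {r : ℝ → ℂ} (hr : MemLp r 2 (vol a b)) :
    ∃ q : ℝ → ℂ, Measurable q ∧ Integrable q ∧ MemLp q 2 volume ∧ q =ᵐ[vol a b] r := by
  obtain ⟨g, hg, hrg⟩ := hr.1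
  have hgL : MemLp g 2 (vol a b) := hr.ae_eq hrg
  refine ⟨(Ioo a b).indicator g, hg.measurable.indicator measurableSet_Ioo,
    (integrable_indicator_iff measurableSet_Ioo).2 (hgL.integrable one_le_two),
    (memLp_indicator_iff_restrict measurableSet_Ioo).2 hgL, ?_⟩
  filter_upwards [hrg, ae_restrict_mem measurableSet_Ioo] with x hx hxm
  rw [indicator_of_mem hxm, hx]

/-- The primitive of a function in `L₂` is in the Sobolev space. -/
theorem mem_W12_of_ae_eq_primitive {b : ℝ} (hb : 0 < b) {u : L2 0 b} {c : ℂ} {p : ℝ → ℂ}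
    (hp : MemLp p 2 (vol 0 b)) (hu : u =ᵐ[vol 0 b] fun x => c + ∫ s in (0 : ℝ)..x, p s) :
    u ∈ W12 0 b :=
  ⟨hp.toLp p, (hasWeakDeriv_primitive hb c (hp.integrable one_le_two)).congr hu.symm
    hp.coeFn_toLp.symm⟩

theorem exists_primitive_of_mem_W12 {b : ℝ} (hb : 0 < b) {u : L2 0 b} (hu : u ∈ W12 0 b) :
    ∃ (c : ℂ) (q : ℝ → ℂ), Measurable q ∧ Integrable q ∧ MemLp q 2 volume ∧
      u =ᵐ[vol 0 b] fun x => c + ∫ s in (0 : ℝ)..x, q s := by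
  obtain ⟨v, hv⟩ := hu
  obtain ⟨q, hq, hqi, hq2, hqv⟩ := exists_measurable_indicator (Lp.memLp v)
  obtain ⟨c, hc⟩ := (hv.congr Filter.EventuallyEq.rfl hqv.symm).ae_eq_primitive hb
  exact ⟨c, q, hq, hqi, hq2, hc⟩

theorem TransformData.phiOf_ae {σ : L2 0 1} {h : ℂ} {q : ℝ → ℂ} {k : ℝ → ℝ → ℂ} {φ : ℝ → ℂ}
    (hT : TransformData h q k φ) (hq : MemLp q 2 (vol 0 1))
    (hσ : σ =ᵐ[vol 0 1] fun x => h + ∫ s in (0 : ℝ)..x, q s) : phiOf σ =ᵐ[vol 0 2] φ := by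
  refine (hT.isPhiOf_iff hq hσ _).1 (Classical.epsilon_spec (p := IsPhiOf σ) ?_)
  exact ⟨_, (hT.isPhiOf_iff hq hσ _).2
    (memLp_of_continuous (a := 0) (b := 2) hT.continuous_phi).coeFn_toLp⟩

theorem TransformData.invKernel_diagonal {h : ℂ} {q : ℝ → ℂ} {k : ℝ → ℝ → ℂ} {φ : ℝ → ℂ}
    (hT : TransformData h q k φ) {x : ℝ} (hx : x ∈ Icc (0 : ℝ) 1) :
    invKernel k φ x x = -((1 / 2) * ((h + ∫ s in (0 : ℝ)..x, q s) + h)) := by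
  rw [hT.gelfandLevitan.invKernel_diagonal hx, hT.diagonal x hx]

/-- The data of the transformation operator of `σ ∈ W¹₂(0, 1)`. -/
theorem exists_transformData_of_mem_W12 {σ : L2 0 1} (hσ : σ ∈ W12 0 1) :
    ∃ h q k φ, TransformData h q k φ ∧ MemLp q 2 (vol 0 1) ∧
      (σ =ᵐ[vol 0 1] fun x => h + ∫ s in (0 : ℝ)..x, q s) ∧
      ∃ p : ℝ → ℂ, MemLp p 2 (vol 0 2) ∧
        ∀ x ∈ Icc (0 : ℝ) 2, φ x = φ 0 + ∫ s in (0 : ℝ)..x, p s := by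
  obtain ⟨h, q, hq, hqi, hq2, hσq⟩ := exists_primitive_of_mem_W12 one_pos hσ
  obtain ⟨k, φ, hT, hp⟩ := exists_transformData h hq hqi hq2
  exact ⟨h, q, k, φ, hT, hq2.mono_measure Measure.restrict_le_self, hσq, hp⟩

theorem existsUnique_isPhiOf {σ : L2 0 1} (hσ : σ ∈ W12 0 1) : ∃! φ : L2 0 2, IsPhiOf σ φ := by
  obtain ⟨h, q, k, φ, hT, hq, hσq, -⟩ := exists_transformData_of_mem_W12 hσ
  have hφ := (memLp_of_continuous (a := 0) (b := 2) hT.continuous_phi).coeFn_toLp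
  exact ⟨_, (hT.isPhiOf_iff hq hσq _).2 hφ, fun ψ hψ =>
    Lp.ext (((hT.isPhiOf_iff hq hσq ψ).1 hψ).trans hφ.symm)⟩

theorem mapsTo_phiOf : MapsTo phiOf (W12 0 1) (factorizableSet ∩ W12 0 2) := by
  intro σ hσ
  obtain ⟨h, q, k, φ, hT, hq, hσq, p, hp, hφp⟩ := exists_transformData_of_mem_W12 hσ
  have hφ := hT.phiOf_ae hq hσq
  refine ⟨hT.gelfandLevitan.mem_factorizableSet hT.continuous_kernel hT.continuous_phi hφ,
    mem_W12_of_ae_eq_primitive two_pos (c := φ 0) hp ?_⟩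
  filter_upwards [hφ, ae_restrict_mem measurableSet_Ioo] with x hx hxm
  rw [hx, hφp x (Ioo_subset_Icc_self hxm)]

/-- `φ_σ` determines the triangular factor, whose diagonal is `-(σ(x) + σ(0)) / 2`. -/
theorem injOn_phiOf : InjOn phiOf (W12 0 1) := by
  intro σ₁ hσ₁ σ₂ hσ₂ heq
  obtain ⟨h₁, q₁, k₁, φ₁, hT₁, hq₁, hσq₁, -⟩ := exists_transformData_of_mem_W12 hσ₁
  obtain ⟨h₂, q₂, k₂, φ₂, hT₂, hq₂, hσq₂, -⟩ := exists_transformData_of_mem_W12 hσ₂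
  have e₂ := hT₂.phiOf_ae hq₂ hσq₂
  rw [← heq] at e₂
  have hφ : EqOn φ₁ φ₂ (Icc 0 2) := eqOn_Icc_of_ae_eq_vol two_pos
    ((hT₁.phiOf_ae hq₁ hσq₁).symm.trans e₂) hT₁.continuous_phi.continuousOn
    hT₂.continuous_phi.continuousOn
  have hd : ∀ x ∈ Icc (0 : ℝ) 1, (h₁ + ∫ s in (0 : ℝ)..x, q₁ s) + h₁ =
      (h₂ + ∫ s in (0 : ℝ)..x, q₂ s) + h₂ := by
    intro x hx
    have e := (hT₁.gelfandLevitan.triangularFactor hT₁.continuous_kernel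
      hT₁.continuous_phi).eq_of_phi_eq
      (continuous_invKernel hT₁.continuous_kernel hT₁.continuous_phi)
      (continuous_invKernel hT₂.continuous_kernel hT₂.continuous_phi)
      (hT₂.gelfandLevitan.triangularFactor hT₂.continuous_kernel hT₂.continuous_phi) hφ
      hx.1 le_rfl hx.2
    rw [hT₁.invKernel_diagonal hx, hT₂.invKernel_diagonal hx] at e
    linear_combination -2 * e
  have h0 := hd 0 (left_mem_Icc.2 zero_le_one)
  simp only [intervalIntegral.integral_same, add_zero] at h0
  refine Lp.ext ?_
  filter_upwards [hσq₁, hσq₂, ae_restrict_mem measurableSet_Ioo] with x hx₁ hx₂ hx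
  rw [hx₁, hx₂]
  linear_combination hd x (Ioo_subset_Icc_self hx) - (1 / 2) * h0

/-- Given `ψ`, the solution `k` of the Gelfand–Levitan equation provides the candidate
`σ(x) = 2 k(x, x) - k(0, 0)`. The kernel of its transformation operator has the same values on the
diagonal, and the diagonal determines `φ_σ`. -/
theorem surjOn_phiOf : SurjOn phiOf (W12 0 1) (factorizableSet ∩ W12 0 2) := by
  rintro ψ ⟨⟨F, hF, hfac⟩, hψ⟩
  obtain ⟨c, p, hp, hpi, hp2, hψp⟩ := exists_primitive_of_mem_W12 two_pos hψ
  set φ : ℝ → ℂ := fun y => c + ∫ s in (0 : ℝ)..|y|, p s with hφdef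
  have hφ : Continuous φ := (continuous_primitive_add hpi c).comp continuous_abs
  have hψφ : ψ =ᵐ[vol 0 2] φ := by
    filter_upwards [hψp, ae_restrict_mem measurableSet_Ioo] with x hx hxm
    simp only [hx, hφdef, abs_of_pos hxm.1]
  have hF' : HasKernel F (kernF φ) :=
    hF.congr (kernF_congr_ae (Lp.stronglyMeasurable ψ).measurable hφ.measurable hψφ)
  obtain ⟨k, hk, hGL⟩ := hfac.exists_gelfandLevitan hφ hF'
  obtain ⟨r, hr, hr2, hrk⟩ := hGL.exists_primitive_diagonal hp hpi hp2 c hk (fun _ => rfl)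
  obtain ⟨q, hq, hqi, hq2, hqr⟩ := exists_measurable_indicator (hr2.const_mul 2)
  -- `σ = h + ∫ q` with `h = k(0, 0)` and `q = 2 (d / dx) k(x, x)`
  obtain ⟨k', φ', hT, -⟩ := exists_transformData (k 0 0) hq hqi hq2
  have hq2' : MemLp q 2 (vol 0 1) := hq2.mono_measure Measure.restrict_le_self
  set S : ℝ → ℂ := fun x => k 0 0 + ∫ s in (0 : ℝ)..x, q s with hS
  have hSL : MemLp S 2 (vol 0 1) := memLp_of_continuous (continuous_primitive_add hqi _)
  refine ⟨hSL.toLp S, mem_W12_of_ae_eq_primitive one_pos hq2' hSL.coeFn_toLp, ?_⟩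
  have hφφ : EqOn φ' φ (Icc 0 2) := by
    refine (hT.gelfandLevitan.triangularFactor hT.continuous_kernel
      hT.continuous_phi).phi_eq_of_diagonal_eq
      (continuous_invKernel hT.continuous_kernel hT.continuous_phi) (continuous_invKernel hk hφ)
      (hGL.triangularFactor hk hφ) fun x hx => ?_
    have e : ∫ s in (0 : ℝ)..x, q s = 2 * ∫ s in (0 : ℝ)..x, r s := by
      rw [intervalIntegral_congr_vol hqr hx, intervalIntegral.integral_const_mul]
    rw [hT.invKernel_diagonal hx, hGL.invKernel_diagonal hx, hrk x hx, e]
    ring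
  refine Lp.ext ((hT.phiOf_ae hq2' hSL.coeFn_toLp).trans ?_)
  filter_upwards [hψφ, ae_restrict_mem measurableSet_Ioo] with x hx hxm
  rw [hx, hφφ (Ioo_subset_Icc_self hxm)]

end HalfInverse

theorem theorem3p4 :
    (∀ σ ∈ HalfInverse.W12 0 1, ∃! φ : HalfInverse.L2 0 2, HalfInverse.IsPhiOf σ φ) ∧
    Set.BijOn HalfInverse.phiOf (HalfInverse.W12 0 1)
      (HalfInverse.factorizableSet ∩ HalfInverse.W12 0 2) :=
  ⟨fun _ hσ => HalfInverse.existsUnique_isPhiOf hσ, HalfInverse.mapsTo_phiOf,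
    HalfInverse.injOn_phiOf, HalfInverse.surjOn_phiOf⟩
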